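/- **Setting.** Let $\kappa>0$ and let $\gamma:\mathbb R\to\mathbb R^2$ be real-analytic, $2\pi$-periodic, injective on $[0,2\pi)$, with $|\gamma'(t)|>0$ for all $t$. Put $n(t)=(\gamma_2'(t),-\gamma_1'(t))$. Functions are complex-valued and $2\pi$-periodic on $\mathbb R$. For such $u$ let $\hat u_m=\frac1{2\pi}\int_0^{2\pi}u(t)e^{-imt}dt$ and $\|u\|_p=\big(\sum_{m\in\mathbb Z}(1+m^2)^p|\hat u_m|^2\big)^{1/2}\in[0,\infty]$; for pairs $\|\eta\|_p=\|\eta_1\|_p+\|\eta_2\|_p$. For $n\ge 1$ let $X_n$ be the space of functions $\sum_{m=0}^n a_m\cos mt+\sum_{m=1}^{n-1}b_m\sin mt$ with $a_m,b_m\in\mathbb C$. Let $P_n$ be the trigonometric interpolation operator onto $X_n$ with nodes $\zeta_j=\pi j/n$, $j=0,\dots,2n-1$, and $\mathcal P_n(g_1,g_2)=(P_ng_1,P_ng_2)$. **Elementary operators.** Let $\Lambda(x)=\ln(4\sin^2\frac x2)$. For kernels $b_1,b_2$ let $$(B[b_1,b_2]\phi)(t)=\int_0^{2\pi}\Lambda(t-\zeta)\,b_1(t,\zeta)\phi(\zeta)\,d\zeta+\int_0^{2\pi}b_2(t,\zeta)\phi(\zeta)\,d\zeta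 ,$$ $$(B_n[b_1,b_2]\phi)(t)=\int_0^{2\pi}\Lambda(t-\zeta)\,P_n[b_1(t,\cdot)\phi](\zeta)\,d\zeta+\int_0^{2\pi}P_n[b_2(t,\cdot)\phi](\zeta)\,d\zeta .$$ Put $m_1(x)=\cot\frac x2\sin^2x$ and $m_2(x)=\cot\frac x2\sin2x-\cos^2\frac x2$, extended analytically to $x\in 2\pi\mathbb Z$. The operators are the following $B[b_1,b_2]$, with $x=t-\zeta$: * $\widetilde S_0$: $b_1=-\frac1{2\pi}$, $b_2=0$; $\quad M_0$: $b_1=0$, $b_2=\frac i{2\pi}$; $\quad S_0=\widetilde S_0+M_0$; * $S_1$: $b_1=\frac1{4\pi}\sin x$, $b_2=0$; $\quad S_2$: $b_1=-\frac1{8\pi}\sin^2x$, $b_2=0$; * $B_1$: $b_1=-\frac1{8\pi}\sin2x$, $b_2=-\frac1{8\pi}m_1(x)$; $\quad B_2$: $b_1=-\frac1{4\pi}(\cos2x-1)$, $b_2=-\frac1{4\pi}m_2(x)$; * $\widetilde B_3$: $b_1=-\frac{1}{2\pi}(e_1(\zeta)-e_1(t))$, $b_2=0$; $\quad B_3$: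 the same $b_1$, $b_2=\frac{i}{2\pi}(e_1(\zeta)-e_1(t))$; $\quad\widetilde B_4$: $b_1=-\frac1{2\pi}(e_2(\zeta)-e_2(t))$, $b_2=0$. $E_j$ is multiplication by $e_j$, where $e_1=\kappa^2|\gamma'|^2$, $e_2=\kappa^2n\cdot\gamma''$, $e_3=\kappa^2\gamma'\cdot\gamma''$, $e_4=\kappa^4|\gamma'|^4+2\kappa^2\gamma'\cdot\gamma'''$, $e_5=-\frac34\kappa^4|\gamma'|^4+\kappa^2\gamma'\cdot\gamma'''$, $e_6=e_4-e_5$, $e_7=2\kappa^2(|\gamma''|^2+\gamma'\cdot\gamma''')$, $e_8=\kappa^2(n\cdot\gamma''''+n'\cdot\gamma''')$, $e_9=\kappa^2n\cdot\gamma'''$. **The operator $\mathcal J$.** With $A=\frac12E_1S_0+E_3S_1+E_6S_2$ let $$\begin{aligned} F_1&=2E_2S_2+E_2S_2E_2S_2+S_0(E_3S_1+E_6S_2)+E_1S_2A,\\ F_2&=E_2S_2(S_0+E_1S_2)-(S_0+E_1S_2)E_2S_2,\\ F_3&=AE_2S_2-E_2S_2A,\\ F_4&=2E_2S_2+E_2S_2E_2S_2+(E_3S_1+E_6S_2)S_0+AE_1S_2,\\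 J_1&=\tfrac12\widetilde B_3\widetilde S_0+\widetilde S_0E_7S_2+4\widetilde S_0E_3B_1+\widetilde S_0E_1B_2-\tfrac12E_1M_0S_0+M_0E_1S_2,\\ J_2&=\tfrac12B_3S_0+E_1B_2\widetilde S_0-\tfrac12E_1M_0S_0+E_1S_2M_0,\\ J_3&=\tfrac12\widetilde B_4\widetilde S_0+\widetilde S_0E_8S_2+2\widetilde S_0E_9B_1+\widetilde S_0E_2B_2-E_2B_2\widetilde S_0+M_0E_2S_2-E_2S_2M_0, \end{aligned}$$ $$\mathcal J=\begin{bmatrix}F_1+J_2&F_2\\F_3+J_3&F_4+J_1\end{bmatrix},\qquad \mathcal E=\begin{bmatrix}E_1&0\\0&E_1\end{bmatrix}.$$ The fully discrete operator $\mathcal J_n$ is given by the same formulas, in which $S_0,S_1,S_2$ are replaced by $S_0P_n,S_1P_n,S_2P_n$, each of the operators $\widetilde S_0,M_0,B_1,B_2,B_3,\widetilde B_3,\widetilde B_4$ of the form $B[b_1,b_2]$ is replaced by $B_n[b_1,b_2]$, and the $E_j$ are kept; $\mathcal E_n=\mathcal E$. **Theorem.** Let $p>1/2$. There is a constant $C>0$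 (depending only on $p$, $\kappa$, $\gamma$) such that for all $n\ge1$ and all $\psi\in X_n^2=X_n\times X_n$, $$\big\|\mathcal P_n\big[\mathcal E_n^{-1}\mathcal J_n-\mathcal E^{-1}\mathcal J\big]\psi\big\|_{p+2}\le \frac Cn\,\|\psi\|_p .$$ -/

import Mathlib

open scoped ENNReal

noncomputable section

namespace BiharmonicCavity

/-! ### Periodic functions, Sobolev norms, trigonometric interpolation

A `2π`-periodic function is represented by a function `ℝ → ℂ`. -/

/-- The Sobolev norm `‖u‖_p = (∑ₘ (1 + m²)^p |ûₘ|²)^(1/2)`, with value `∞` when the sum diverges;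
`ûₘ = (2π)⁻¹ ∫₀^{2π} u(t) e^{-imt} dt`. -/
def sobolevNorm (p : ℝ) (u : ℝ → ℂ) : ℝ≥0∞ :=
  (∑' m : ℤ, ENNReal.ofReal ((1 + (m : ℝ) ^ 2) ^ p) *
    ‖fourierCoeffOn Real.two_pi_pos u m‖ₑ ^ 2) ^ (1 / 2 : ℝ)

/-- The norm `‖η‖_p = ‖η₁‖_p + ‖η₂‖_p` of a pair of functions. -/
def sobolevNorm₂ (p : ℝ) (η : (ℝ → ℂ) × (ℝ → ℂ)) : ℝ≥0∞ :=
  sobolevNorm p η.1 + sobolevNorm p η.2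

/-- The space `X_n` of the functions `∑_{m=0}^{n} aₘ cos mt + ∑_{m=1}^{n-1} bₘ sin mt`. -/
def trigPoly (n : ℕ) : Set (ℝ → ℂ) :=
  {φ | ∃ a b : ℕ → ℂ, ∀ t : ℝ, φ t =
    ∑ m ∈ Finset.range (n + 1), a m * (Real.cos (m * t) : ℂ) +
    ∑ m ∈ Finset.Ico 1 n, b m * (Real.sin (m * t) : ℂ)}

/-- The interpolation points `ζ_j = πj/n`, `j = 0, …, 2n-1`. -/
def node (n j : ℕ) : ℝ := Real.pi * j / n

/-- The Lagrange basis of `X_n` for the points `ζ_0, …, ζ_{2n-1}`. -/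
def lagrangeBasis (n j : ℕ) (t : ℝ) : ℝ :=
  1 / (2 * n) * (1 + 2 * ∑ k ∈ Finset.Ico 1 n, Real.cos (k * (t - node n j)) +
    Real.cos (n * (t - node n j)))

/-- The trigonometric interpolation operator `P_n`, written in the Lagrange basis. -/
def interp (n : ℕ) (g : ℝ → ℂ) (t : ℝ) : ℂ :=
  ∑ j ∈ Finset.range (2 * n), g (node n j) * (lagrangeBasis n j t : ℂ)

/-- The interpolation operator on pairs. -/
def interp₂ (n : ℕ) (g : (ℝ → ℂ) × (ℝ → ℂ)) : (ℝ → ℂ) × (ℝ → ℂ) :=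
  (interp n g.1, interp n g.2)

/-! ### Integral operators with logarithmic kernels and their quadrature -/

/-- Operators on functions. Sums and differences are pointwise, products are compositions `∘`. -/
abbrev Op := (ℝ → ℂ) → (ℝ → ℂ)

/-- The logarithmic kernel `ln (4 sin² (x/2))`, at `x = t - ζ`. -/
def logKer (x : ℝ) : ℂ := (Real.log (4 * Real.sin (x / 2) ^ 2) : ℂ)

/-- `(Bφ)(t) = ∫₀^{2π} ln(4 sin²((t-ζ)/2)) b₁(t,ζ) φ(ζ) dζ + ∫₀^{2π} b₂(t,ζ) φ(ζ) dζ`. -/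
def intOp (b₁ b₂ : ℝ → ℝ → ℂ) : Op := fun φ t =>
  (∫ ζ in (0 : ℝ)..(2 * Real.pi), logKer (t - ζ) * (b₁ t ζ * φ ζ)) +
  ∫ ζ in (0 : ℝ)..(2 * Real.pi), b₂ t ζ * φ ζ

/-- The quadrature operator of `intOp b₁ b₂`: `bᵢ(t,·)φ` is replaced by its interpolant. -/
def quadOp (n : ℕ) (b₁ b₂ : ℝ → ℝ → ℂ) : Op := fun φ t =>
  (∫ ζ in (0 : ℝ)..(2 * Real.pi), logKer (t - ζ) * interp n (fun s => b₁ t s * φ s) ζ) +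
  ∫ ζ in (0 : ℝ)..(2 * Real.pi), interp n (fun s => b₂ t s * φ s) ζ

/-- The kernel factor of `S̃₀φ = -(2π)⁻¹ ∫ ln(4 sin²((t-ζ)/2)) φ(ζ) dζ`. -/
def kerSt₀ (_ _ : ℝ) : ℂ := -1 / (2 * Real.pi)

/-- The kernel of `M₀φ = i(2π)⁻¹ ∫ φ(ζ) dζ`. -/
def kerM₀ (_ _ : ℝ) : ℂ := Complex.I / (2 * Real.pi)

/-- The kernel factor of `S₁`. -/
def kerS₁ (t ζ : ℝ) : ℂ := 1 / (4 * Real.pi) * (Real.sin (t - ζ) : ℂ)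

/-- The kernel factor of `S₂`. -/
def kerS₂ (t ζ : ℝ) : ℂ := -1 / (8 * Real.pi) * (Real.sin (t - ζ) : ℂ) ^ 2

/-- The analytic function `m₁ = cot(x/2) sin² x`, at `x = t - ζ`. -/
def m₁ (x : ℝ) : ℝ := 2 * Real.cos (x / 2) ^ 2 * Real.sin x

/-- The analytic function `m₂ = cot(x/2) sin 2x - cos²(x/2)`, at `x = t - ζ`
(with its limit value `3` at `x = 0`). -/
def m₂ (x : ℝ) : ℝ := Real.cos (x / 2) ^ 2 * (4 * Real.cos x - 1)

lemma m₁_eq (x : ℝ) (hx : Real.sin (x / 2) ≠ 0) :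
    m₁ x = Real.cot (x / 2) * Real.sin x ^ 2 := by
  have h : Real.sin x = 2 * Real.sin (x / 2) * Real.cos (x / 2) := by
    rw [← Real.sin_two_mul]; ring_nf
  rw [m₁, Real.cot_eq_cos_div_sin, h]
  field_simp

lemma m₂_eq (x : ℝ) (hx : Real.sin (x / 2) ≠ 0) :
    m₂ x = Real.cot (x / 2) * Real.sin (2 * x) - Real.cos (x / 2) ^ 2 := by
  have h : Real.sin x = 2 * Real.sin (x / 2) * Real.cos (x / 2) := by
    rw [← Real.sin_two_mul]; ring_nf
  rw [m₂, Real.cot_eq_cos_div_sin, Real.sin_two_mul, h]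
  field_simp
  ring

/-- The logarithmic part of the kernel of `B₁`. -/
def kerB₁log (t ζ : ℝ) : ℂ := -1 / (8 * Real.pi) * (Real.sin (2 * (t - ζ)) : ℂ)
/-- The smooth part of the kernel of `B₁`. -/
def kerB₁smooth (t ζ : ℝ) : ℂ := -1 / (8 * Real.pi) * (m₁ (t - ζ) : ℂ)
/-- The logarithmic part of the kernel of `B₂`. -/
def kerB₂log (t ζ : ℝ) : ℂ := -1 / (4 * Real.pi) * ((Real.cos (2 * (t - ζ)) : ℂ) - 1)
/-- The smooth part of the kernel of `B₂`. -/
def kerB₂smooth (t ζ : ℝ) : ℂ := -1 / (4 * Real.pi) * (m₂ (t - ζ) : ℂ)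

/-! ### The boundary curve and the multiplication operators -/

/-- The plane `ℝ²`. -/
abbrev Plane := EuclideanSpace ℝ (Fin 2)

/-- `γ` is a `2π`-periodic analytic regular parametrization of a simple closed curve. -/
structure IsAnalyticBoundary (γ : ℝ → Plane) : Prop where
  analytic : AnalyticOnNhd ℝ γ Set.univ
  periodic : Function.Periodic γ (2 * Real.pi)
  regular : ∀ t, 0 < ‖deriv γ t‖
  simple : Set.InjOn γ (Set.Ico 0 (2 * Real.pi))

/-- The rotation `(v₁, v₂) ↦ (v₂, -v₁)`, so that `n(t) = rot (γ'(t))`. -/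
def rot (v : Plane) : Plane := !₂[v 1, -v 0]

/-- `γ^{(k)}(t)`. -/
abbrev dγ (γ : ℝ → Plane) (k : ℕ) (t : ℝ) : Plane := iteratedDeriv k γ t

/-- The multiplier of `E₁`, `κ² |γ'|²`. -/
def e₁ (κ : ℝ) (γ : ℝ → Plane) (t : ℝ) : ℝ := κ ^ 2 * ‖dγ γ 1 t‖ ^ 2
/-- The multiplier of `E₂`, `κ² n · γ''`. -/
def e₂ (κ : ℝ) (γ : ℝ → Plane) (t : ℝ) : ℝ := κ ^ 2 * inner ℝ (rot (dγ γ 1 t)) (dγ γ 2 t)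
/-- The multiplier of `E₃`, `κ² γ' · γ''`. -/
def e₃ (κ : ℝ) (γ : ℝ → Plane) (t : ℝ) : ℝ := κ ^ 2 * inner ℝ (dγ γ 1 t) (dγ γ 2 t)
/-- The multiplier of `E₄`, `κ⁴ |γ'|⁴ + 2 κ² γ' · γ'''`. -/
def e₄ (κ : ℝ) (γ : ℝ → Plane) (t : ℝ) : ℝ :=
  κ ^ 4 * ‖dγ γ 1 t‖ ^ 4 + 2 * κ ^ 2 * inner ℝ (dγ γ 1 t) (dγ γ 3 t)
/-- The multiplier of `E₅`, `-(3/4) κ⁴ |γ'|⁴ + κ² γ' · γ'''`. -/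
def e₅ (κ : ℝ) (γ : ℝ → Plane) (t : ℝ) : ℝ :=
  -(3 / 4) * κ ^ 4 * ‖dγ γ 1 t‖ ^ 4 + κ ^ 2 * inner ℝ (dγ γ 1 t) (dγ γ 3 t)
/-- The multiplier of `E₆ = E₄ - E₅`. -/
def e₆ (κ : ℝ) (γ : ℝ → Plane) (t : ℝ) : ℝ := e₄ κ γ t - e₅ κ γ t
/-- The multiplier of `E₇`, `(κ² |γ'|²)'' = 2 κ² (|γ''|² + γ' · γ''')`. -/
def e₇ (κ : ℝ) (γ : ℝ → Plane) (t : ℝ) : ℝ :=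
  2 * κ ^ 2 * (‖dγ γ 2 t‖ ^ 2 + inner ℝ (dγ γ 1 t) (dγ γ 3 t))
/-- The multiplier of `E₈`, `(κ² n · γ'')'' = κ² (n · γ'''' + n' · γ''')`. -/
def e₈ (κ : ℝ) (γ : ℝ → Plane) (t : ℝ) : ℝ :=
  κ ^ 2 * (inner ℝ (rot (dγ γ 1 t)) (dγ γ 4 t) + inner ℝ (rot (dγ γ 2 t)) (dγ γ 3 t))
/-- The multiplier of `E₉`, `(κ² n · γ'')' = κ² n · γ'''`. -/
def e₉ (κ : ℝ) (γ : ℝ → Plane) (t : ℝ) : ℝ := κ ^ 2 * inner ℝ (rot (dγ γ 1 t)) (dγ γ 3 t)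

/-- Multiplication by a real function. -/
def mulOp (f : ℝ → ℝ) : Op := fun φ t => (f t : ℂ) * φ t

/-- `E₁⁻¹`, multiplication by `(κ² |γ'|²)⁻¹`. -/
def E₁inv (κ : ℝ) (γ : ℝ → Plane) : Op := mulOp fun t => (e₁ κ γ t)⁻¹

lemma E₁inv_mul {κ : ℝ} (hκ : 0 < κ) {γ : ℝ → Plane} (hγ : IsAnalyticBoundary γ) (φ : ℝ → ℂ) :
    E₁inv κ γ (mulOp (e₁ κ γ) φ) = φ ∧ mulOp (e₁ κ γ) (E₁inv κ γ φ) = φ := by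
  have h : ∀ t, (e₁ κ γ t : ℂ) ≠ 0 := fun t => by
    have h1 := hγ.regular t
    have : 0 < e₁ κ γ t := by
      simp only [e₁, dγ, iteratedDeriv_one]
      positivity
    exact_mod_cast this.ne'
  constructor <;> funext t <;> simp [E₁inv, mulOp, h t]

/-- `𝓔⁻¹ = diag(E₁⁻¹, E₁⁻¹)`. -/
def calEinv (κ : ℝ) (γ : ℝ → Plane) (ψ : (ℝ → ℂ) × (ℝ → ℂ)) : (ℝ → ℂ) × (ℝ → ℂ) :=
  (E₁inv κ γ ψ.1, E₁inv κ γ ψ.2)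

/-! ### The elementary integral operators, exact and discretized

`𝓙` and its fully discrete version are given by the same formulas in the elementary operators;
these are collected in a structure with one exact and one discretized instance. -/

/-- `S₀, S̃₀, M₀, S₁, S₂, B₁, B₂, B₃, B̃₃, B̃₄`. -/
structure Ops where
  S₀ : Op
  St₀ : Op
  M₀ : Op
  S₁ : Op
  S₂ : Op
  B₁ : Op
  B₂ : Op
  B₃ : Op
  Bt₃ : Op
  Bt₄ : Op

/-- The kernel factor of `S̃₀ f - f S̃₀`, `-(2π)⁻¹ (f(ζ) - f(t))`. -/
def kerComm (f : ℝ → ℝ) (t ζ : ℝ) : ℂ := -1 / (2 * Real.pi) * ((f ζ : ℂ) - (f t : ℂ))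

/-- The smooth kernel of `M₀ f - f M₀`, `i (2π)⁻¹ (f(ζ) - f(t))`. -/
def kerCommM (f : ℝ → ℝ) (t ζ : ℝ) : ℂ := Complex.I / (2 * Real.pi) * ((f ζ : ℂ) - (f t : ℂ))

/-- `S₀ = S̃₀ + M₀`. -/
def opS₀ : Op := intOp kerSt₀ kerM₀
/-- `S₁`. -/
def opS₁ : Op := intOp kerS₁ 0
/-- `S₂`. -/
def opS₂ : Op := intOp kerS₂ 0

/-- The exact operators. -/
def contOps (κ : ℝ) (γ : ℝ → Plane) : Ops where
  S₀ := opS₀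
  St₀ := intOp kerSt₀ 0
  M₀ := intOp 0 kerM₀
  S₁ := opS₁
  S₂ := opS₂
  B₁ := intOp kerB₁log kerB₁smooth
  B₂ := intOp kerB₂log kerB₂smooth
  B₃ := intOp (kerComm (e₁ κ γ)) (kerCommM (e₁ κ γ))
  Bt₃ := intOp (kerComm (e₁ κ γ)) 0
  Bt₄ := intOp (kerComm (e₂ κ γ)) 0

/-- The quadrature operators: `S_{j,n} = S_j P_n` for `j = 0, 1, 2`, and interpolatory quadrature
for the other integral operators. -/
def discOps (κ : ℝ) (γ : ℝ → Plane) (n : ℕ) : Ops where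
  S₀ := opS₀ ∘ interp n
  St₀ := quadOp n kerSt₀ 0
  M₀ := quadOp n 0 kerM₀
  S₁ := opS₁ ∘ interp n
  S₂ := opS₂ ∘ interp n
  B₁ := quadOp n kerB₁log kerB₁smooth
  B₂ := quadOp n kerB₂log kerB₂smooth
  B₃ := quadOp n (kerComm (e₁ κ γ)) (kerCommM (e₁ κ γ))
  Bt₃ := quadOp n (kerComm (e₁ κ γ)) 0
  Bt₄ := quadOp n (kerComm (e₂ κ γ)) 0

/-! ### The operator `𝓙` and its fully discrete version -/

section entries

variable (κ : ℝ) (γ : ℝ → Plane) (Q : Ops)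

/-- `½ E₁S₀ + E₃S₁ + E₆S₂`. -/
def opA : Op := fun φ =>
  (1 / 2 : ℂ) • mulOp (e₁ κ γ) (Q.S₀ φ) + mulOp (e₃ κ γ) (Q.S₁ φ) + mulOp (e₆ κ γ) (Q.S₂ φ)

/-- `F₁ = 2E₂S₂ + E₂S₂E₂S₂ + S₀(E₃S₁ + E₆S₂) + E₁S₂(½E₁S₀ + E₃S₁ + E₆S₂)`. -/
def opF₁ : Op := fun φ =>
  (2 : ℂ) • mulOp (e₂ κ γ) (Q.S₂ φ) +
  mulOp (e₂ κ γ) (Q.S₂ (mulOp (e₂ κ γ) (Q.S₂ φ))) +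
  Q.S₀ (mulOp (e₃ κ γ) (Q.S₁ φ) + mulOp (e₆ κ γ) (Q.S₂ φ)) +
  mulOp (e₁ κ γ) (Q.S₂ (opA κ γ Q φ))

/-- `F₂ = E₂S₂(S₀ + E₁S₂) - (S₀ + E₁S₂)E₂S₂`. -/
def opF₂ : Op := fun φ =>
  mulOp (e₂ κ γ) (Q.S₂ (Q.S₀ φ + mulOp (e₁ κ γ) (Q.S₂ φ))) -
  (Q.S₀ (mulOp (e₂ κ γ) (Q.S₂ φ)) +
    mulOp (e₁ κ γ) (Q.S₂ (mulOp (e₂ κ γ) (Q.S₂ φ))))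

/-- `F₃ = (½E₁S₀ + E₃S₁ + E₆S₂)E₂S₂ - E₂S₂(½E₁S₀ + E₃S₁ + E₆S₂)`. -/
def opF₃ : Op := fun φ =>
  opA κ γ Q (mulOp (e₂ κ γ) (Q.S₂ φ)) - mulOp (e₂ κ γ) (Q.S₂ (opA κ γ Q φ))

/-- `F₄ = 2E₂S₂ + E₂S₂E₂S₂ + (E₃S₁ + E₆S₂)S₀ + (½E₁S₀ + E₃S₁ + E₆S₂)E₁S₂`. -/
def opF₄ : Op := fun φ =>
  (2 : ℂ) • mulOp (e₂ κ γ) (Q.S₂ φ) +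
  mulOp (e₂ κ γ) (Q.S₂ (mulOp (e₂ κ γ) (Q.S₂ φ))) +
  (mulOp (e₃ κ γ) (Q.S₁ (Q.S₀ φ)) + mulOp (e₆ κ γ) (Q.S₂ (Q.S₀ φ))) +
  opA κ γ Q (mulOp (e₁ κ γ) (Q.S₂ φ))

/-- `J₁ = ½B̃₃S̃₀ + S̃₀E₇S₂ + 4S̃₀E₃B₁ + S̃₀E₁B₂ - ½E₁M₀S₀ + M₀E₁S₂`. -/
def opJ₁ : Op := fun φ =>
  (1 / 2 : ℂ) • Q.Bt₃ (Q.St₀ φ) +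
  Q.St₀ (mulOp (e₇ κ γ) (Q.S₂ φ)) +
  (4 : ℂ) • Q.St₀ (mulOp (e₃ κ γ) (Q.B₁ φ)) +
  Q.St₀ (mulOp (e₁ κ γ) (Q.B₂ φ)) -
  (1 / 2 : ℂ) • mulOp (e₁ κ γ) (Q.M₀ (Q.S₀ φ)) +
  Q.M₀ (mulOp (e₁ κ γ) (Q.S₂ φ))

/-- `J₂ = ½B₃S₀ + E₁B₂S̃₀ - ½E₁M₀S₀ + E₁S₂M₀`. -/
def opJ₂ : Op := fun φ =>
  (1 / 2 : ℂ) • Q.B₃ (Q.S₀ φ) +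
  mulOp (e₁ κ γ) (Q.B₂ (Q.St₀ φ)) -
  (1 / 2 : ℂ) • mulOp (e₁ κ γ) (Q.M₀ (Q.S₀ φ)) +
  mulOp (e₁ κ γ) (Q.S₂ (Q.M₀ φ))

/-- `J₃ = ½B̃₄S̃₀ + S̃₀E₈S₂ + 2S̃₀E₉B₁ + S̃₀E₂B₂ - E₂B₂S̃₀ + M₀E₂S₂ - E₂S₂M₀`,
which is `T₀E₂S₂ - E₂S₂T₀` in the exact case. -/
def opJ₃ : Op := fun φ =>
  (1 / 2 : ℂ) • Q.Bt₄ (Q.St₀ φ) +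
  Q.St₀ (mulOp (e₈ κ γ) (Q.S₂ φ)) +
  (2 : ℂ) • Q.St₀ (mulOp (e₉ κ γ) (Q.B₁ φ)) +
  Q.St₀ (mulOp (e₂ κ γ) (Q.B₂ φ)) -
  mulOp (e₂ κ γ) (Q.B₂ (Q.St₀ φ)) +
  Q.M₀ (mulOp (e₂ κ γ) (Q.S₂ φ)) -
  mulOp (e₂ κ γ) (Q.S₂ (Q.M₀ φ))

/-- The matrix operator `[[F₁ + J₂, F₂], [F₃ + J₃, F₄ + J₁]]`. -/
def calJ (ψ : (ℝ → ℂ) × (ℝ → ℂ)) : (ℝ → ℂ) × (ℝ → ℂ) :=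
  (opF₁ κ γ Q ψ.1 + opJ₂ κ γ Q ψ.1 + opF₂ κ γ Q ψ.2,
   opF₃ κ γ Q ψ.1 + opJ₃ κ γ Q ψ.1 + (opF₄ κ γ Q ψ.2 + opJ₁ κ γ Q ψ.2))

end entries

/-- The operator `𝓙`. -/
def opJ (κ : ℝ) (γ : ℝ → Plane) (ψ : (ℝ → ℂ) × (ℝ → ℂ)) : (ℝ → ℂ) × (ℝ → ℂ) :=
  calJ κ γ (contOps κ γ) ψ

/-- The fully discrete operator `𝓙_n`. -/
def opJn (κ : ℝ) (γ : ℝ → Plane) (n : ℕ) (ψ : (ℝ → ℂ) × (ℝ → ℂ)) : (ℝ → ℂ) × (ℝ → ℂ) :=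
  calJ κ γ (discOps κ γ n) ψ

/-- `𝓔_n⁻¹`; since `E_{1,n} = E₁`, this is `𝓔⁻¹`. -/
def calEnInv (κ : ℝ) (γ : ℝ → Plane) (_n : ℕ) (ψ : (ℝ → ℂ) × (ℝ → ℂ)) :
    (ℝ → ℂ) × (ℝ → ℂ) :=
  calEinv κ γ ψ

end BiharmonicCavity

end

/-! Everything is read off in Fourier coefficients. The logarithmic potential is the multiplier
1/|m| (`logOp_mult`), the mean is the projection onto m = 0, and a logarithmic kernel times a
trigonometric polynomial in t − ζ that vanishes on the diagonal gives a multiplier of order −2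
(`ordOp_trigKer`). So S₀, S̃₀, M₀ gain at least one order, and S₁, S₂, B₁, B₂ gain two.
Interpolation folds all frequencies congruent modulo 2n onto those of modulus at most n
(`hat_interp`). Weighted Schur tests then show that P_n is bounded in order q > 1/2, and that P_n −
1 is O(1/n) at the price of one order (`interp_bound`, `interp_error`).

Where P_n stands between two operators that together gain three orders, this price leaves the two
orders required (`small_interp_between`). Where P_n acts on an element of X_n, or on its image under
an even multiplier, there is no error at all.

The quadrature operators are the delicate point. Once the kernel is separated, their error is built
from T P_n fφ − T fφ with T of order −1 and f smooth; the gain of T is eaten by the price of 1/n, so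
nothing is left. The outer interpolation rescues one order: at frequency l the interpolated error is
a sum of (τ_l − τ_m) times the m-th coefficient of fφ over the aliases m of l. Since φ has
frequencies |s| ≤ n and f has rapidly decaying coefficients, only m just outside [−n, n] matters;
then |l| is close to |m|, and since τ is even, τ_l − τ_m is O(n⁻²) instead of O(n⁻¹) (`TameSymbol`,
`alias_error`).

Hence errors are measured only through their interpolants (`Small`). This notion survives
multiplication by smooth functions, composition on the right with a tame operator, and application
of a tame operator after P_n. A product such as B₂S̃₀ uses the quadrature error in order p + 1; a
product such as S̃₀E₁B₂ uses it in order p and lets S̃₀ supply the missing order (`Small.post_mul`).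
Every entry of the error matrix is a finite sum of such terms, and 𝓔⁻¹ is multiplication by a smooth
function. -/

noncomputable section

namespace BiharmonicCavity

/-! ### Fourier coefficients and absolutely convergent Fourier series -/

/-- The `m`-th Fourier coefficient of a function on `[0, 2π]`. -/
def hat (u : ℝ → ℂ) (m : ℤ) : ℂ := fourierCoeffOn Real.two_pi_pos u m

/-- The exponential `e^{imt}`. -/
def expi (m : ℤ) (t : ℝ) : ℂ := Complex.exp (Complex.I * m * t)

lemma expi_add (m k : ℤ) (t : ℝ) : expi (m + k) t = expi m t * expi k t := by
  simp only [expi, ← Complex.exp_add]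
  push_cast
  ring_nf

@[simp] lemma expi_zero (t : ℝ) : expi 0 t = 1 := by simp [expi]

lemma expi_neg_mul (m : ℤ) (t : ℝ) : expi (-m) t * expi m t = 1 := by
  rw [← expi_add]; simp

lemma expi_arg_sub (m : ℤ) (s t : ℝ) : expi m (s - t) = expi m s * expi (-m) t := by
  simp only [expi, ← Complex.exp_add]
  push_cast
  ring_nf

lemma expi_arg_add (m : ℤ) (s t : ℝ) : expi m (s + t) = expi m s * expi m t := by
  simp only [expi, ← Complex.exp_add]
  push_cast
  ring_nf

lemma norm_expi (m : ℤ) (t : ℝ) : ‖expi m t‖ = 1 := by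
  rw [expi, show Complex.I * m * t = ((m * t : ℝ) : ℂ) * Complex.I by push_cast; ring]
  exact Complex.norm_exp_ofReal_mul_I _

lemma continuous_expi (m : ℤ) : Continuous (expi m) := by
  unfold expi; fun_prop

lemma expi_two_pi (m : ℤ) : expi m (2 * Real.pi) = 1 := by
  rw [expi, Complex.exp_eq_one_iff]
  exact ⟨m, by push_cast; ring⟩

lemma periodic_expi (m : ℤ) : Function.Periodic (expi m) (2 * Real.pi) := fun t => by
  rw [expi_arg_add, expi_two_pi, mul_one]

lemma integral_expi (m : ℤ) :
    ∫ t in (0 : ℝ)..(2 * Real.pi), expi m t = if m = 0 then 2 * Real.pi else 0 := by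
  split_ifs with h
  · subst h; simp
  · have h' : (Complex.I * m : ℂ) ≠ 0 := by simp [h]
    have := integral_exp_mul_complex (a := 0) (b := 2 * Real.pi) h'
    simp only [expi]
    rw [this]
    have h2 := expi_two_pi m
    simp only [expi] at h2
    rw [h2]; simp

lemma hat_eq (u : ℝ → ℂ) (m : ℤ) :
    hat u m = 1 / (2 * Real.pi) * ∫ t in (0 : ℝ)..(2 * Real.pi), expi (-m) t * u t := by
  rw [hat, fourierCoeffOn_eq_integral]
  simp only [sub_zero]
  rw [show (1 / (2 * (Real.pi : ℂ))) = ((1 / (2 * Real.pi) : ℝ) : ℂ) by push_cast; rfl,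
    Complex.real_smul]
  congr 1
  apply intervalIntegral.integral_congr
  intro t _
  simp only [smul_eq_mul]
  congr 1
  rw [fourier_coe_apply, expi]
  congr 1
  have : (Real.pi : ℂ) ≠ 0 := by exact_mod_cast Real.pi_ne_zero
  push_cast
  rw [sub_zero]
  field_simp

/-- Functions with an absolutely convergent Fourier series. -/
structure Wiener (u : ℝ → ℂ) : Prop where
  summable : Summable fun m => ‖hat u m‖
  hasSum : ∀ t, HasSum (fun m => hat u m * expi m t) (u t)

lemma continuous_of_hasSum {a : ℤ → ℂ} {u : ℝ → ℂ} (ha : Summable fun m => ‖a m‖)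
    (h : ∀ t, HasSum (fun m => a m * expi m t) (u t)) : Continuous u := by
  have : u = fun t => ∑' m, a m * expi m t := funext fun t => (h t).tsum_eq.symm
  rw [this]
  refine continuous_tsum (fun m => continuous_const.mul (continuous_expi m)) ha fun m t => ?_
  rw [norm_mul, norm_expi, mul_one]

/-- Termwise integration of an absolutely convergent Fourier series against a kernel. -/
lemma hasSum_integral_kernel {a : ℤ → ℂ} {u k : ℝ → ℂ} (ha : Summable fun m => ‖a m‖)
    (h : ∀ t, HasSum (fun m => a m * expi m t) (u t)) {x y : ℝ}
    (hk : IntervalIntegrable k MeasureTheory.volume x y) :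
    HasSum (fun m => a m * ∫ t in x..y, k t * expi m t) (∫ t in x..y, k t * u t) := by
  have := intervalIntegral.hasSum_integral_of_dominated_convergence (μ := MeasureTheory.volume)
    (a := x) (b := y) (F := fun m t => a m * (k t * expi m t)) (f := fun t => k t * u t)
    (fun m t => ‖a m‖ * ‖k t‖) ?_ ?_ ?_ ?_ ?_
  · simpa only [intervalIntegral.integral_const_mul] using this
  · intro m
    exact (hk.def'.aestronglyMeasurable.mul
      (continuous_expi m).aestronglyMeasurable).const_mul _
  · intro m
    refine Filter.Eventually.of_forall fun t _ => ?_
    simp [norm_expi]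
  · exact Filter.Eventually.of_forall fun t _ => ha.mul_right _
  · simp only [tsum_mul_right]
    exact hk.norm.const_mul _
  · refine Filter.Eventually.of_forall fun t _ => ?_
    have := (h t).mul_left (k t)
    simpa only [mul_left_comm (k t)] using this

lemma hat_expi_mul (m k : ℤ) :
    ∫ t in (0 : ℝ)..(2 * Real.pi), expi (-m) t * expi k t = if k = m then 2 * Real.pi else 0 := by
  simp only [← expi_add, integral_expi, neg_add_eq_zero, eq_comm]

lemma hat_of_hasSum {a : ℤ → ℂ} {u : ℝ → ℂ} (ha : Summable fun m => ‖a m‖)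
    (h : ∀ t, HasSum (fun m => a m * expi m t) (u t)) (m : ℤ) : hat u m = a m := by
  have hs := hasSum_integral_kernel ha h (x := 0) (y := 2 * Real.pi)
    ((continuous_expi (-m)).intervalIntegrable _ _)
  simp only [hat_expi_mul] at hs
  have h2 : HasSum (fun k => a k * ((if k = m then 2 * Real.pi else 0 : ℝ) : ℂ))
      (a m * (2 * Real.pi)) := by
    convert hasSum_single m ?_ using 1
    · simp
    · intro k hk; simp [hk]
  have h3 : (∫ t in (0 : ℝ)..(2 * Real.pi), expi (-m) t * u t) = a m * (2 * Real.pi) := by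
    apply hs.unique
    convert h2 using 3
  rw [hat_eq, h3]
  have : (Real.pi : ℂ) ≠ 0 := by exact_mod_cast Real.pi_ne_zero
  field_simp

/-- Absolute summability permits termwise integration, so a representing sequence must be the
Fourier sequence. All later constructions obtain membership and coefficients together from this. -/
lemma Wiener.of_hasSum {a : ℤ → ℂ} {u : ℝ → ℂ} (ha : Summable fun m => ‖a m‖)
    (h : ∀ t, HasSum (fun m => a m * expi m t) (u t)) : Wiener u ∧ ∀ m, hat u m = a m := by
  have := hat_of_hasSum ha h
  exact ⟨⟨by simpa only [this] using ha, fun t => by simpa only [this] using h t⟩, this⟩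

lemma Wiener.continuous {u : ℝ → ℂ} (h : Wiener u) : Continuous u :=
  continuous_of_hasSum h.summable h.hasSum

lemma Wiener.ext {u v : ℝ → ℂ} (hu : Wiener u) (hv : Wiener v) (h : ∀ m, hat u m = hat v m) :
    u = v := by
  funext t
  refine (hu.hasSum t).unique ?_
  simpa only [h] using hv.hasSum t

lemma Wiener.add' {u v : ℝ → ℂ} (hu : Wiener u) (hv : Wiener v) :
    Wiener (u + v) ∧ ∀ m, hat (u + v) m = hat u m + hat v m := by
  apply Wiener.of_hasSum
  · exact Summable.of_nonneg_of_le (fun _ => norm_nonneg _) (fun m => norm_add_le _ _)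
      (hu.summable.add hv.summable)
  · intro t
    simp only [add_mul]
    exact (hu.hasSum t).add (hv.hasSum t)

lemma Wiener.smul' {u : ℝ → ℂ} (c : ℂ) (hu : Wiener u) :
    Wiener (c • u) ∧ ∀ m, hat (c • u) m = c * hat u m := by
  apply Wiener.of_hasSum
  · simpa only [norm_mul] using hu.summable.mul_left ‖c‖
  · intro t
    simp only [mul_assoc]
    exact (hu.hasSum t).mul_left c

lemma Wiener.zero' : Wiener 0 ∧ ∀ m, hat 0 m = 0 := by
  apply Wiener.of_hasSum
  · simp
  · intro t
    simp

lemma Wiener.add {u v : ℝ → ℂ} (hu : Wiener u) (hv : Wiener v) : Wiener (u + v) :=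
  (hu.add' hv).1

lemma Wiener.smul {u : ℝ → ℂ} (c : ℂ) (hu : Wiener u) : Wiener (c • u) := (hu.smul' c).1

lemma Wiener.zero : Wiener 0 := Wiener.zero'.1

lemma Wiener.sub' {u v : ℝ → ℂ} (hu : Wiener u) (hv : Wiener v) :
    Wiener (u - v) ∧ ∀ m, hat (u - v) m = hat u m - hat v m := by
  have e : u - v = u + (-1 : ℂ) • v := by simp [sub_eq_add_neg]
  have h1 := hv.smul' (-1)
  have h2 := hu.add' h1.1
  rw [e]
  exact ⟨h2.1, fun m => by rw [h2.2, h1.2]; ring⟩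

lemma Wiener.sub {u v : ℝ → ℂ} (hu : Wiener u) (hv : Wiener v) : Wiener (u - v) :=
  (hu.sub' hv).1

/-- The convolution theorem. -/
lemma Wiener.mul' {f u : ℝ → ℂ} (hf : Wiener f) (hu : Wiener u) :
    Wiener (f * u) ∧ ∀ m, HasSum (fun s => hat f (m - s) * hat u s) (hat (f * u) m) := by
  -- A shear of the index lattice: it regroups the product of the two series by total frequency.
  let e : ℤ × ℤ ≃ ℤ × ℤ :=
    { toFun := fun p => (p.1 - p.2, p.2)
      invFun := fun p => (p.1 + p.2, p.2)
      left_inv := fun p => by simp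
      right_inv := fun p => by simp }
  have hs : Summable fun p : ℤ × ℤ => ‖hat f p.1 * hat u p.2‖ :=
    hf.summable.mul_norm hu.summable
  have hs' : Summable fun p : ℤ × ℤ => ‖hat f (p.1 - p.2) * hat u p.2‖ :=
    (Equiv.summable_iff e).mpr hs
  have hrow : ∀ m, Summable fun s => ‖hat f (m - s) * hat u s‖ := fun m =>
    hs'.prod_factor m
  have hW := Wiener.of_hasSum (a := fun m => ∑' s, hat f (m - s) * hat u s) (u := f * u) ?_ ?_
  · refine ⟨hW.1, fun m => ?_⟩
    rw [hW.2]
    exact (hrow m).of_norm.hasSum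
  · refine Summable.of_nonneg_of_le (fun _ => norm_nonneg _) (fun m => norm_tsum_le_tsum_norm
      (hrow m)) ?_
    exact hs'.prod
  · intro t
    have h1 : Summable fun m => ‖hat f m * expi m t‖ := by
      simpa only [norm_mul, norm_expi, mul_one] using hf.summable
    have h2 : Summable fun m => ‖hat u m * expi m t‖ := by
      simpa only [norm_mul, norm_expi, mul_one] using hu.summable
    have h3 : HasSum (fun p : ℤ × ℤ => (hat f p.1 * expi p.1 t) * (hat u p.2 * expi p.2 t))
        (f t * u t) := by
      rw [← (hf.hasSum t).tsum_eq, ← (hu.hasSum t).tsum_eq,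
        tsum_mul_tsum_of_summable_norm h1 h2]
      exact (summable_mul_of_summable_norm h1 h2).hasSum
    have h4 := (Equiv.hasSum_iff e).mpr h3
    have h5 : HasSum (fun p : ℤ × ℤ => (hat f (p.1 - p.2) * hat u p.2) * expi p.1 t)
        (f t * u t) := by
      have h6 : (fun p : ℤ × ℤ => (hat f (p.1 - p.2) * hat u p.2) * expi p.1 t) =
          (fun p : ℤ × ℤ => (hat f p.1 * expi p.1 t) * (hat u p.2 * expi p.2 t)) ∘ e := by
        funext p
        have := expi_add (p.1 - p.2) p.2 t
        rw [sub_add_cancel] at this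
        simp only [Function.comp, e, Equiv.coe_fn_mk]
        rw [this]; ring
      rw [h6]
      exact h4
    exact h5.prod_fiberwise fun m => (hrow m).of_norm.hasSum.mul_right (expi m t)

lemma Wiener.mul {f u : ℝ → ℂ} (hf : Wiener f) (hu : Wiener u) : Wiener (f * u) := (hf.mul' hu).1

lemma expi_wiener (k : ℤ) : Wiener (expi k) ∧ ∀ m, hat (expi k) m = if m = k then 1 else 0 := by
  apply Wiener.of_hasSum
  · apply summable_of_ne_finset_zero (s := {k})
    intro m hm
    simp at hm
    simp [hm]
  · intro t
    convert hasSum_single k ?_ using 1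
    · simp
    · intro m hm; simp [hm]

lemma Wiener.expi_mul' {u : ℝ → ℂ} (k : ℤ) (hu : Wiener u) :
    Wiener (expi k * u) ∧ ∀ m, hat (expi k * u) m = hat u (m - k) := by
  have h := (expi_wiener k).1.mul' hu
  refine ⟨h.1, fun m => (h.2 m).unique ?_⟩
  simp only [(expi_wiener k).2]
  convert hasSum_single (m - k) ?_ using 1
  · simp
  · intro s hs
    rw [if_neg (by omega), zero_mul]

/-- A Fourier multiplier with bounded symbol, given as a series. -/
lemma Wiener.mult {u v : ℝ → ℂ} {τ : ℤ → ℂ} {C : ℝ} (hu : Wiener u) (hτ : ∀ m, ‖τ m‖ ≤ C)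
    (h : ∀ t, HasSum (fun m => hat u m * (τ m * expi m t)) (v t)) :
    Wiener v ∧ ∀ m, hat v m = τ m * hat u m := by
  apply Wiener.of_hasSum
  · refine Summable.of_nonneg_of_le (fun _ => norm_nonneg _) (fun m => ?_)
      (hu.summable.mul_left C)
    rw [norm_mul]
    exact mul_le_mul_of_nonneg_right (hτ m) (norm_nonneg _)
  · intro t
    convert h t using 2
    ring

/-! ### The logarithmic potential as a Fourier multiplier -/

lemma intervalIntegrable_ofReal {f : ℝ → ℝ} {a b : ℝ}
    (h : IntervalIntegrable f MeasureTheory.volume a b) :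
    IntervalIntegrable (fun x => (f x : ℂ)) MeasureTheory.volume a b :=
  ⟨h.1.ofReal, h.2.ofReal⟩

/-- The real logarithmic kernel. -/
def rlog (x : ℝ) : ℝ := Real.log (4 * Real.sin (x / 2) ^ 2)

lemma logKer_eq (x : ℝ) : logKer x = (rlog x : ℂ) := rfl

/-- The logarithm of an analytic function is integrable across its zeros, so the singularities at
multiples of 2π need no separate estimate. -/
lemma intervalIntegrable_rlog (a b : ℝ) : IntervalIntegrable rlog MeasureTheory.volume a b := by
  have : AnalyticOnNhd ℝ (fun x : ℝ => 4 * Real.sin (x / 2) ^ 2) (Set.uIcc a b) := by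
    intro x _
    have : AnalyticAt ℝ (fun x : ℝ => x / 2) x := analyticAt_id.div analyticAt_const (by simp)
    exact analyticAt_const.mul ((Real.analyticAt_sin.comp this).pow 2)
  exact this.meromorphicOn.intervalIntegrable_log

lemma periodic_rlog : Function.Periodic rlog (2 * Real.pi) := fun x => by
  simp only [rlog]
  rw [show (x + 2 * Real.pi) / 2 = x / 2 + Real.pi by ring, Real.sin_add_pi, neg_sq]

lemma rlog_neg (x : ℝ) : rlog (-x) = rlog x := by
  simp only [rlog]
  rw [neg_div, Real.sin_neg, neg_sq]

/-- Halving the variable reduces this to the integral of log sin over [0, π], which is −π log 2 and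
cancels the contribution of log 4. -/
lemma integral_rlog : ∫ x in (0 : ℝ)..(2 * Real.pi), rlog x = 0 := by
  have h1 : ∫ x in (0 : ℝ)..(2 * Real.pi), rlog x =
      2 * ∫ x in (0 : ℝ)..Real.pi, Real.log (4 * Real.sin x ^ 2) := by
    have := intervalIntegral.integral_comp_div (a := 0) (b := 2 * Real.pi)
      (fun x => Real.log (4 * Real.sin x ^ 2)) (c := 2) two_ne_zero
    simp only [zero_div, smul_eq_mul] at this
    rw [show 2 * Real.pi / 2 = Real.pi by ring] at this
    exact this
  have h2 : ∫ x in (0 : ℝ)..Real.pi, Real.log (4 * Real.sin x ^ 2) =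
      ∫ x in (0 : ℝ)..Real.pi, (Real.log 4 + 2 * Real.log (Real.sin x)) := by
    rw [intervalIntegral.integral_of_le Real.pi_pos.le,
      intervalIntegral.integral_of_le Real.pi_pos.le, MeasureTheory.integral_Ioc_eq_integral_Ioo,
      MeasureTheory.integral_Ioc_eq_integral_Ioo]
    refine MeasureTheory.setIntegral_congr_fun measurableSet_Ioo fun x hx => ?_
    have : Real.sin x ≠ 0 := (Real.sin_pos_of_mem_Ioo hx).ne'
    rw [Real.log_mul (by norm_num) (by positivity), Real.log_pow]
    norm_num
  have h3 : IntervalIntegrable (fun x => Real.log (Real.sin x)) MeasureTheory.volume 0 Real.pi :=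
    intervalIntegrable_log_sin
  rw [h1, h2, intervalIntegral.integral_add (by simp) (h3.const_mul _),
    intervalIntegral.integral_const_mul, integral_log_sin_zero_pi]
  have : Real.log 4 = 2 * Real.log 2 := by
    rw [show (4 : ℝ) = 2 ^ 2 by norm_num, Real.log_pow]; norm_num
  simp only [intervalIntegral.integral_const, smul_eq_mul, this]
  ring

/-- `sin (n x) / sin (x / 2)` as a trigonometric sum. -/
lemma sin_nat_mul_eq (n : ℕ) (x : ℝ) : Real.sin (n * x) =
    Real.sin (x / 2) * ∑ k ∈ Finset.range n, 2 * Real.cos ((k + 1 / 2) * x) := by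
  induction n with
  | zero => simp
  | succ n ih =>
    rw [Finset.sum_range_succ, mul_add, ← ih]
    have h1 : ((n + 1 : ℕ) : ℝ) * x = (n + 1 / 2) * x + x / 2 := by push_cast; ring
    have h2 : (n : ℝ) * x = (n + 1 / 2) * x - x / 2 := by ring
    rw [h1, h2, Real.sin_add, Real.sin_sub]
    ring

/-- Together with `sin_nat_mul_eq` this turns cot(x/2) sin(nx), which comes from differentiating the
logarithm, into a cosine sum. -/
lemma cos_half_mul_sum (n : ℕ) (x : ℝ) :
    Real.cos (x / 2) * ∑ k ∈ Finset.range n, 2 * Real.cos ((k + 1 / 2) * x) =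
    ∑ k ∈ Finset.range n, (Real.cos ((k + 1) * x) + Real.cos (k * x)) := by
  rw [Finset.mul_sum]
  refine Finset.sum_congr rfl fun k _ => ?_
  have h1 : ((k : ℝ) + 1) * x = (k + 1 / 2) * x + x / 2 := by ring
  have h2 : (k : ℝ) * x = (k + 1 / 2) * x - x / 2 := by ring
  rw [h1, h2, Real.cos_add, Real.cos_sub]
  ring

/-- The factor sin(x/2) of sin(nx) tames the logarithm, because y log y is continuous at 0. -/
lemma continuous_rlog_mul_sin (n : ℕ) : Continuous fun x => rlog x * Real.sin (n * x) := by
  have : (fun x => rlog x * Real.sin (n * x)) = fun x =>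
      ((2 * Real.sin (x / 2)) * Real.log (2 * Real.sin (x / 2))) *
        ∑ k ∈ Finset.range n, 2 * Real.cos ((k + 1 / 2) * x) := by
    funext x
    rw [sin_nat_mul_eq, rlog, show 4 * Real.sin (x / 2) ^ 2 = (2 * Real.sin (x / 2)) ^ 2 by ring,
      Real.log_pow]
    push_cast
    ring
  rw [this]
  exact (Real.continuous_mul_log.comp (by fun_prop : Continuous fun x => 2 * Real.sin (x / 2))).mul
    (by fun_prop)

lemma integral_cos_int (k : ℤ) : ∫ x in (0 : ℝ)..(2 * Real.pi), Real.cos (k * x) =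
    if k = 0 then 2 * Real.pi else 0 := by
  split_ifs with h
  · subst h; simp
  · have hk : (k : ℝ) ≠ 0 := by exact_mod_cast h
    rw [intervalIntegral.integral_comp_mul_left (fun x => Real.cos x) hk, integral_cos]
    have : Real.sin (k * (2 * Real.pi)) = 0 := by
      rw [show (k : ℝ) * (2 * Real.pi) = ((2 * k : ℤ) : ℝ) * Real.pi by push_cast; ring]
      exact Real.sin_int_mul_pi _
    simp [this]

/-- Integrate the derivative of `rlog x * sin (n x)`, a function vanishing at both ends. The part
with the cotangent is a cosine sum of which only the constant term survives, contributing 2π; the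
rest is n times the integral sought. -/
lemma integral_rlog_mul_cos (n : ℕ) : ∫ x in (0 : ℝ)..(2 * Real.pi), rlog x * Real.cos (n * x) =
    -(2 * Real.pi) * (n : ℝ)⁻¹ := by
  -- For n = 0 the convention `0⁻¹ = 0` agrees with the vanishing mean of the logarithm.
  rcases Nat.eq_zero_or_pos n with rfl | hn
  · simp [integral_rlog]
  have hn0 : (n : ℝ) ≠ 0 := by positivity
  have hint : IntervalIntegrable (fun x => rlog x * Real.cos (n * x)) MeasureTheory.volume 0
      (2 * Real.pi) := (intervalIntegrable_rlog _ _).mul_continuousOn (by fun_prop)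
  have hintc : ∀ k : ℝ, IntervalIntegrable (fun x => Real.cos (k * x)) MeasureTheory.volume 0
      (2 * Real.pi) := fun k => (by fun_prop : Continuous fun x => Real.cos (k * x)).intervalIntegrable _ _
  have hintS : IntervalIntegrable (fun x => ∑ k ∈ Finset.range n,
      (Real.cos ((k + 1) * x) + Real.cos (k * x))) MeasureTheory.volume 0 (2 * Real.pi) :=
    (by fun_prop : Continuous fun x => ∑ k ∈ Finset.range n,
      (Real.cos ((k + 1) * x) + Real.cos (k * x))).intervalIntegrable _ _
  have hFTC := intervalIntegral.integral_eq_sub_of_hasDerivAt_of_le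
    (f := fun x => rlog x * Real.sin (n * x))
    (f' := fun x => (∑ k ∈ Finset.range n, (Real.cos ((k + 1) * x) + Real.cos (k * x))) +
      n * (rlog x * Real.cos (n * x))) Real.two_pi_pos.le
    (continuous_rlog_mul_sin n).continuousOn ?_ (hintS.add (hint.const_mul _))
  · rw [intervalIntegral.integral_add hintS (hint.const_mul _),
      intervalIntegral.integral_const_mul, intervalIntegral.integral_finsetSum
        (fun k _ => (hintc _).add (hintc _))] at hFTC
    have hterm : ∀ k : ℕ, ∫ x in (0 : ℝ)..(2 * Real.pi), (Real.cos ((k + 1) * x) + Real.cos (k * x))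
        = if k = 0 then 2 * Real.pi else 0 := by
      intro k
      rw [intervalIntegral.integral_add (hintc _) (hintc _)]
      have h1 := integral_cos_int (k + 1)
      have h2 := integral_cos_int k
      push_cast at h1 h2
      rw [h1, h2, if_neg (by omega)]
      simp
    simp only [hterm, Finset.sum_ite_eq', Finset.mem_range, hn, if_true] at hFTC
    have hz : Real.sin (n * (2 * Real.pi)) = 0 := by
      rw [show (n : ℝ) * (2 * Real.pi) = ((2 * n : ℕ) : ℝ) * Real.pi by push_cast; ring]
      exact Real.sin_nat_mul_pi _
    simp only [hz, mul_zero, Real.sin_zero, sub_zero] at hFTC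
    field_simp
    linarith
  · intro x hx
    have hs : Real.sin (x / 2) ≠ 0 :=
      (Real.sin_pos_of_mem_Ioo ⟨by linarith [hx.1], by linarith [hx.2]⟩).ne'
    have hd : HasDerivAt (fun x => 4 * Real.sin (x / 2) ^ 2)
        (4 * (2 * Real.sin (x / 2) * (Real.cos (x / 2) * (1 / 2)))) x := by
      have := ((((hasDerivAt_id x).div_const 2).sin).pow 2).const_mul 4
      simpa using this
    have h1 := (hd.log (by positivity)).mul (((hasDerivAt_id x).const_mul (n : ℝ)).sin)
    refine h1.congr_deriv ?_
    rw [← cos_half_mul_sum]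
    simp only [id, sin_nat_mul_eq n x, rlog, mul_one]
    field_simp

/-- Under x ↦ 2π − x the logarithm is even and the sine is odd. -/
lemma integral_rlog_mul_sin (n : ℤ) :
    ∫ x in (0 : ℝ)..(2 * Real.pi), rlog x * Real.sin (n * x) = 0 := by
  have h := intervalIntegral.integral_comp_sub_left (a := 0) (b := 2 * Real.pi)
    (fun x => rlog x * Real.sin (n * x)) (2 * Real.pi)
  simp only [sub_self, sub_zero] at h
  have h2 : ∀ x : ℝ, rlog (2 * Real.pi - x) * Real.sin (n * (2 * Real.pi - x)) =
      -(rlog x * Real.sin (n * x)) := by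
    intro x
    rw [show 2 * Real.pi - x = -x + 2 * Real.pi by ring, periodic_rlog, rlog_neg,
      show (n : ℝ) * (-x + 2 * Real.pi) = -(n * x) + n * (2 * Real.pi) by ring,
      Real.sin_add_int_mul_two_pi, Real.sin_neg]
    ring
  simp only [h2, intervalIntegral.integral_neg] at h
  linarith

/-- The symbol of the logarithmic potential: `1/|m|`, and `0` for `m = 0`. -/
def sym (m : ℤ) : ℝ := |(m : ℝ)|⁻¹

lemma integral_logKer_mul_expi (m : ℤ) :
    ∫ x in (0 : ℝ)..(2 * Real.pi), logKer x * expi m x = -(2 * Real.pi) * sym m := by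
  have he : ∀ x : ℝ, logKer x * expi m x =
      ((rlog x * Real.cos (m * x) : ℝ) : ℂ) + Complex.I * ((rlog x * Real.sin (m * x) : ℝ) : ℂ) := by
    intro x
    rw [expi, show Complex.I * m * x = ((m * x : ℝ) : ℂ) * Complex.I by push_cast; ring,
      Complex.exp_mul_I, logKer_eq]
    push_cast
    ring
  have i1 : IntervalIntegrable (fun x => ((rlog x * Real.cos (m * x) : ℝ) : ℂ))
      MeasureTheory.volume 0 (2 * Real.pi) := intervalIntegrable_ofReal <| (intervalIntegrable_rlog _ _).mul_continuousOn (by fun_prop)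
  have i2 : IntervalIntegrable (fun x => ((rlog x * Real.sin (m * x) : ℝ) : ℂ))
      MeasureTheory.volume 0 (2 * Real.pi) := intervalIntegrable_ofReal <| (intervalIntegrable_rlog _ _).mul_continuousOn (by fun_prop)
  have hc : ∫ x in (0 : ℝ)..(2 * Real.pi), rlog x * Real.cos (m * x) =
      -(2 * Real.pi) * sym m := by
    have := integral_rlog_mul_cos m.natAbs
    rw [sym, ← Int.cast_abs, Int.abs_eq_natAbs, Int.cast_natCast, ← this]
    congr 1
    funext x
    congr 1
    rcases Int.natAbs_eq m with h | h
    · conv_lhs => rw [h]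
      simp
    · conv_lhs => rw [h]
      simp
  simp only [he]
  rw [intervalIntegral.integral_add i1 (i2.const_mul _),
    intervalIntegral.integral_const_mul, intervalIntegral.integral_ofReal,
    intervalIntegral.integral_ofReal, hc, integral_rlog_mul_sin]
  push_cast
  ring

lemma intervalIntegrable_logKer (t a b : ℝ) :
    IntervalIntegrable (fun x => logKer (t - x)) MeasureTheory.volume a b := by
  have := ((intervalIntegrable_rlog (t - a) (t - b)).comp_sub_left t)
  simp only [sub_sub_cancel] at this
  exact intervalIntegrable_ofReal this

/-- The substitution x ↦ t − x splits off e^{imt} and reverses the frequency; periodicity restores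
the interval, and the symbol is even. -/
lemma integral_logKer_sub_mul_expi (m : ℤ) (t : ℝ) :
    ∫ x in (0 : ℝ)..(2 * Real.pi), logKer (t - x) * expi m x =
      -(2 * Real.pi) * (sym m * expi m t) := by
  have h1 := intervalIntegral.integral_comp_sub_left (a := 0) (b := 2 * Real.pi)
    (fun x => logKer x * expi (-m) x * expi m t) t
  have h2 : ∀ x, logKer (t - x) * expi (-m) (t - x) * expi m t = logKer (t - x) * expi m x := by
    intro x
    rw [expi_arg_sub, neg_neg]
    have := expi_neg_mul m t
    linear_combination (logKer (t - x) * expi m x) * this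
  simp only [h2] at h1
  rw [h1, intervalIntegral.integral_mul_const]
  have hper : Function.Periodic (fun x => logKer x * expi (-m) x) (2 * Real.pi) := by
    intro x
    simp only [logKer_eq, periodic_rlog x, periodic_expi (-m) x]
  have h3 := hper.intervalIntegral_add_eq (t - 2 * Real.pi) 0
  simp only [sub_add_cancel, zero_add] at h3
  rw [sub_zero, h3, integral_logKer_mul_expi]
  simp only [sym, Int.cast_neg, abs_neg]
  ring

/-- The logarithmic potential with symbol `sym`. -/
def logOp : Op := fun u t =>
  -1 / (2 * Real.pi) * ∫ ζ in (0 : ℝ)..(2 * Real.pi), logKer (t - ζ) * u ζ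

/-- The mean value, as a constant function. -/
def meanOp : Op := fun u _ => 1 / (2 * Real.pi) * ∫ ζ in (0 : ℝ)..(2 * Real.pi), u ζ

/-- The symbol of the mean value. -/
def dirac (m : ℤ) : ℝ := if m = 0 then 1 else 0

lemma sym_nonneg (m : ℤ) : 0 ≤ sym m := by unfold sym; positivity

lemma sym_le_one (m : ℤ) : sym m ≤ 1 := by
  unfold sym
  rcases eq_or_ne m 0 with rfl | h
  · simp
  · apply inv_le_one_of_one_le₀
    exact_mod_cast Int.one_le_abs h

lemma logOp_mult {u : ℝ → ℂ} (hu : Wiener u) :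
    Wiener (logOp u) ∧ ∀ m, hat (logOp u) m = sym m * hat u m := by
  refine hu.mult (C := 1) (fun m => ?_) fun t => ?_
  · simpa [abs_of_nonneg (sym_nonneg m)] using sym_le_one m
  · have := (hasSum_integral_kernel hu.summable hu.hasSum
      (intervalIntegrable_logKer t 0 (2 * Real.pi))).mul_left (-1 / (2 * Real.pi) : ℂ)
    simp only [integral_logKer_sub_mul_expi] at this
    have hpi : (Real.pi : ℂ) ≠ 0 := by exact_mod_cast Real.pi_ne_zero
    have he : (fun m => hat u m * ((sym m : ℂ) * expi m t)) = fun m => -1 / (2 * Real.pi : ℂ) *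
        (hat u m * (-(2 * Real.pi) * ((sym m : ℂ) * expi m t))) := by
      funext m
      field_simp
    rw [he]
    exact this

lemma meanOp_mult {u : ℝ → ℂ} (hu : Wiener u) :
    Wiener (meanOp u) ∧ ∀ m, hat (meanOp u) m = dirac m * hat u m := by
  refine hu.mult (C := 1) (fun m => ?_) fun t => ?_
  · unfold dirac
    split_ifs <;> simp
  · have h0 : meanOp u t = hat u 0 := by
      rw [hat_eq, meanOp]
      simp
    rw [h0]
    have := hasSum_single (f := fun m : ℤ => hat u m * ((dirac m : ℂ) * expi m t)) 0
      fun m hm => by simp [dirac, hm]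
    simpa [dirac] using this

/-! ### Weighted square sums and the Schur test -/

lemma ennreal_two_mul_le_add_sq (a b : ℝ≥0∞) : 2 * (a * b) ≤ a ^ 2 + b ^ 2 := by
  rcases eq_or_ne a ⊤ with rfl | ha
  · simp
  rcases eq_or_ne b ⊤ with rfl | hb
  · simp
  lift a to NNReal using ha
  lift b to NNReal using hb
  have := two_mul_le_add_sq a b
  rw [mul_assoc] at this
  exact_mod_cast this

/-- Cauchy–Schwarz with weights. -/
lemma tsum_mul_sq_le (K β y : ℤ → ℝ≥0∞) (h0 : ∀ m, β m ≠ 0) (ht : ∀ m, β m ≠ ⊤) :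
    (∑' m, K m * y m) ^ 2 ≤ (∑' m, K m * (β m)⁻¹) * ∑' m, K m * (β m * y m ^ 2) := by
  -- Doubling allows symmetrization: both sides become double sums, and each entry on the right is
  -- compared together with its transpose.
  have key : 2 * (∑' m, K m * y m) ^ 2 ≤
      2 * ((∑' m, K m * (β m)⁻¹) * ∑' m, K m * (β m * y m ^ 2)) := by
    have e1 : 2 * (∑' m, K m * y m) ^ 2 =
        ∑' m, ∑' s, K m * K s * (2 * (y m * y s)) := by
      rw [sq, ← ENNReal.tsum_mul_right, ← ENNReal.tsum_mul_left]
      refine tsum_congr fun m => ?_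
      rw [← ENNReal.tsum_mul_left, ← ENNReal.tsum_mul_left]
      refine tsum_congr fun s => ?_
      ring
    have e2 : (∑' m, K m * (β m)⁻¹) * (∑' m, K m * (β m * y m ^ 2)) =
        ∑' m, ∑' s, K m * K s * ((β m)⁻¹ * (β s * y s ^ 2)) := by
      rw [← ENNReal.tsum_mul_right]
      refine tsum_congr fun m => ?_
      rw [← ENNReal.tsum_mul_left]
      refine tsum_congr fun s => ?_
      ring
    have e3 : (∑' m, K m * (β m)⁻¹) * (∑' m, K m * (β m * y m ^ 2)) =
        ∑' m, ∑' s, K m * K s * ((β s)⁻¹ * (β m * y m ^ 2)) := by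
      rw [e2, ENNReal.tsum_comm]
      refine tsum_congr fun m => tsum_congr fun s => ?_
      ring
    rw [two_mul ((∑' m, K m * (β m)⁻¹) * _), e1]
    nth_rewrite 1 [e2]
    rw [e3, ← ENNReal.tsum_add]
    refine ENNReal.tsum_le_tsum fun m => ?_
    rw [← ENNReal.tsum_add]
    refine ENNReal.tsum_le_tsum fun s => ?_
    rw [← mul_add]
    gcongr
    have hm : (β m)⁻¹ * β m = 1 := ENNReal.inv_mul_cancel (h0 m) (ht m)
    have hs : (β s)⁻¹ * β s = 1 := ENNReal.inv_mul_cancel (h0 s) (ht s)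
    -- The square roots of β_s/β_m and β_m/β_s are attached to the two factors; their product is 1,
    -- so the mixed term is unweighted.
    have := ennreal_two_mul_le_add_sq
      (((β m)⁻¹ * β s) ^ (1 / 2 : ℝ) * y s) (((β s)⁻¹ * β m) ^ (1 / 2 : ℝ) * y m)
    have hsq : ∀ a : ℝ≥0∞, (a ^ (1 / 2 : ℝ)) ^ 2 = a := fun a => by
      rw [← ENNReal.rpow_natCast, ← ENNReal.rpow_mul]; norm_num
    rw [mul_pow, mul_pow, hsq, hsq] at this
    have h1 : ((β m)⁻¹ * β s) ^ (1 / 2 : ℝ) * ((β s)⁻¹ * β m) ^ (1 / 2 : ℝ) = 1 := by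
      rw [← ENNReal.mul_rpow_of_nonneg _ _ (by norm_num),
        show (β m)⁻¹ * β s * ((β s)⁻¹ * β m) = ((β m)⁻¹ * β m) * ((β s)⁻¹ * β s) by ring, hm, hs]
      simp
    calc 2 * (y m * y s) = 2 * ((((β m)⁻¹ * β s) ^ (1 / 2 : ℝ) * ((β s)⁻¹ * β m) ^ (1 / 2 : ℝ)) *
          (y m * y s)) := by rw [h1, one_mul]
      _ = 2 * (((β m)⁻¹ * β s) ^ (1 / 2 : ℝ) * y s * (((β s)⁻¹ * β m) ^ (1 / 2 : ℝ) * y m)) := by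
          ring
      _ ≤ _ := this
      _ = _ := by ring
  exact (ENNReal.mul_le_mul_iff_right (by simp) (by simp)).mp key

/-- The Schur test. -/
lemma schur {α β x y : ℤ → ℝ≥0∞} {K : ℤ → ℤ → ℝ≥0∞} {A B : ℝ≥0∞}
    (h0 : ∀ m, β m ≠ 0) (ht : ∀ m, β m ≠ ⊤)
    (hx : ∀ l, x l ≤ ∑' m, K l m * y m)
    (hA : ∀ l, α l * ∑' m, K l m * (β m)⁻¹ ≤ A) (hB : ∀ m, ∑' l, K l m ≤ B) :
    ∑' l, α l * x l ^ 2 ≤ A * B * ∑' m, β m * y m ^ 2 := by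
  calc ∑' l, α l * x l ^ 2
      ≤ ∑' l, A * ∑' m, K l m * (β m * y m ^ 2) := by
        refine ENNReal.tsum_le_tsum fun l => ?_
        calc α l * x l ^ 2 ≤ α l * ((∑' m, K l m * (β m)⁻¹) * ∑' m, K l m * (β m * y m ^ 2)) := by
              gcongr
              exact (pow_le_pow_left' (hx l) 2).trans (tsum_mul_sq_le _ _ _ h0 ht)
          _ = (α l * ∑' m, K l m * (β m)⁻¹) * ∑' m, K l m * (β m * y m ^ 2) := by ring
          _ ≤ _ := by gcongr; exact hA l
    _ = A * ∑' m, (∑' l, K l m) * (β m * y m ^ 2) := by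
        rw [ENNReal.tsum_mul_left, ENNReal.tsum_comm]
        congr 1
        refine tsum_congr fun m => ?_
        rw [ENNReal.tsum_mul_right]
    _ ≤ A * ∑' m, B * (β m * y m ^ 2) := by
        gcongr with m
        exact hB m
    _ = _ := by rw [ENNReal.tsum_mul_left, mul_assoc]

/-- The weight `(1 + m²)^p`. -/
def wt (p : ℝ) (m : ℤ) : ℝ≥0∞ := ENNReal.ofReal ((1 + (m : ℝ) ^ 2) ^ p)

lemma one_add_sq_pos (m : ℤ) : 0 < 1 + (m : ℝ) ^ 2 := by positivity

lemma wt_ne_zero (p : ℝ) (m : ℤ) : wt p m ≠ 0 := by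
  simp only [wt, ne_eq, ENNReal.ofReal_eq_zero, not_le]
  positivity

lemma wt_ne_top (p : ℝ) (m : ℤ) : wt p m ≠ ⊤ := ENNReal.ofReal_ne_top

lemma wt_add (p q : ℝ) (m : ℤ) : wt (p + q) m = wt p m * wt q m := by
  rw [wt, wt, wt, ← ENNReal.ofReal_mul (by positivity), Real.rpow_add (one_add_sq_pos m)]

lemma wt_inv (p : ℝ) (m : ℤ) : (wt p m)⁻¹ = wt (-p) m := by
  rw [wt, wt, Real.rpow_neg (one_add_sq_pos m).le, ENNReal.ofReal_inv_of_pos (by positivity)]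

/-- The squared Sobolev norm. -/
def nsq (p : ℝ) (u : ℝ → ℂ) : ℝ≥0∞ := ∑' m : ℤ, wt p m * ‖hat u m‖ₑ ^ 2

lemma sobolevNorm_eq (p : ℝ) (u : ℝ → ℂ) : sobolevNorm p u = (nsq p u) ^ (1 / 2 : ℝ) := rfl

lemma sobolevNorm_sq (p : ℝ) (u : ℝ → ℂ) : sobolevNorm p u ^ 2 = nsq p u := by
  rw [sobolevNorm_eq, ← ENNReal.rpow_natCast, ← ENNReal.rpow_mul]
  norm_num

lemma sobolevNorm_le_of_nsq {p q : ℝ} {u v : ℝ → ℂ} {C : ℝ≥0∞}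
    (h : nsq p u ≤ C ^ 2 * nsq q v) : sobolevNorm p u ≤ C * sobolevNorm q v := by
  rw [← sobolevNorm_sq, ← sobolevNorm_sq, ← mul_pow] at h
  exact (ENNReal.pow_le_pow_left_iff two_ne_zero).mp h

/-- Minkowski's inequality in ℓ², seen as L² of counting measure, with weight `wt (p / 2)` on each
coefficient. -/
lemma sobolevNorm_add_le (p : ℝ) {u v : ℝ → ℂ} (hu : Wiener u) (hv : Wiener v) :
    sobolevNorm p (u + v) ≤ sobolevNorm p u + sobolevNorm p v := by
  have key : ∀ w, sobolevNorm p w = (∫⁻ m : ℤ, (fun m => wt (p / 2) m * ‖hat w m‖ₑ) m ^ (2 : ℝ)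
      ∂MeasureTheory.Measure.count) ^ (1 / 2 : ℝ) := by
    intro w
    rw [sobolevNorm_eq, nsq, MeasureTheory.lintegral_count]
    congr 2
    funext m
    rw [show (2 : ℝ) = (2 : ℕ) by norm_num, ENNReal.rpow_natCast, mul_pow, sq (wt _ _), ← wt_add]
    norm_num
  rw [key u, key v, key (u + v)]
  refine le_trans ?_ (ENNReal.lintegral_Lp_add_le (by fun_prop) (by fun_prop) (by norm_num))
  gcongr with m
  simp only [Pi.add_apply]
  rw [(hu.add' hv).2, ← mul_add]
  gcongr
  exact enorm_add_le _ _

lemma sobolevNorm_smul (p : ℝ) {u : ℝ → ℂ} (c : ℂ) (hu : Wiener u) :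
    sobolevNorm p (c • u) ≤ ‖c‖ₑ * sobolevNorm p u := by
  refine sobolevNorm_le_of_nsq (le_of_eq ?_)
  rw [nsq, nsq, ← ENNReal.tsum_mul_left]
  refine tsum_congr fun m => ?_
  rw [(hu.smul' c).2, enorm_mul]
  ring

lemma sobolevNorm_zero (p : ℝ) : sobolevNorm p 0 = 0 := by
  rw [sobolevNorm_eq, nsq]
  simp [Wiener.zero'.2]

/-! ### Trigonometric interpolation in Fourier coefficients -/

/-- The weight of the frequency `l` in the Lagrange basis. -/
def freqWt (n : ℕ) (l : ℤ) : ℂ := if |l| < n then 1 else if |l| = n then 1 / 2 else 0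

lemma sum_Icc_symm_succ (F : ℤ → ℂ) (N : ℕ) :
    ∑ l ∈ Finset.Icc (-((N + 1 : ℕ) : ℤ)) ((N + 1 : ℕ) : ℤ), F l =
    ∑ l ∈ Finset.Icc (-(N : ℤ)) N, F l + F (N + 1) + F (-(N + 1)) := by
  have h : Finset.Icc (-((N + 1 : ℕ) : ℤ)) ((N + 1 : ℕ) : ℤ) =
      insert (-((N : ℤ) + 1)) (insert ((N : ℤ) + 1) (Finset.Icc (-(N : ℤ)) N)) := by
    ext x
    simp only [Finset.mem_Icc, Finset.mem_insert]
    push_cast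
    omega
  rw [h, Finset.sum_insert, Finset.sum_insert]
  · ring
  · simp
  · simp only [Finset.mem_insert, Finset.mem_Icc]
    omega

lemma expi_add_expi_neg (m : ℕ) (x : ℝ) :
    expi m x + expi (-m) x = 2 * (Real.cos (m * x) : ℂ) := by
  simp only [expi]
  rw [Complex.ofReal_cos, Complex.cos]
  push_cast
  ring_nf

lemma expi_sub_expi_neg (m : ℕ) (x : ℝ) :
    expi m x - expi (-m) x = 2 * Complex.I * (Real.sin (m * x) : ℂ) := by
  simp only [expi]
  rw [Complex.ofReal_sin, Complex.sin]
  push_cast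
  have : Complex.I * Complex.I = -1 := Complex.I_mul_I
  ring_nf
  simp only [Complex.I_sq]
  ring

lemma sum_expi_Icc (N : ℕ) (x : ℝ) : ∑ l ∈ Finset.Icc (-(N : ℤ)) N, expi l x =
    1 + 2 * ∑ k ∈ Finset.Ico 1 (N + 1), (Real.cos (k * x) : ℂ) := by
  induction N with
  | zero => simp
  | succ N ih =>
    rw [sum_Icc_symm_succ, ih, Finset.sum_Ico_succ_top (b := N + 1) (by omega), add_assoc]
    have := expi_add_expi_neg (N + 1) x
    push_cast at this
    push_cast
    rw [this]
    ring

/-- The single term cos(nx) splits evenly between the frequencies n and −n, which accounts for the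
weight 1/2 in `freqWt`. -/
lemma lagrangeBasis_eq {n : ℕ} (hn : 1 ≤ n) (j : ℕ) (t : ℝ) :
    (lagrangeBasis n j t : ℂ) =
      1 / (2 * n) * ∑ l ∈ Finset.Icc (-(n : ℤ)) n, freqWt n l * expi l (t - node n j) := by
  obtain ⟨N, rfl⟩ : ∃ N, n = N + 1 := ⟨n - 1, by omega⟩
  rw [lagrangeBasis, sum_Icc_symm_succ]
  set x := t - node (N + 1) j
  have h1 : ∑ l ∈ Finset.Icc (-(N : ℤ)) N, freqWt (N + 1) l * expi l x =
      ∑ l ∈ Finset.Icc (-(N : ℤ)) N, expi l x := by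
    refine Finset.sum_congr rfl fun l hl => ?_
    rw [Finset.mem_Icc] at hl
    rw [freqWt, if_pos, one_mul]
    rw [abs_lt]
    push_cast
    omega
  have h2 : freqWt (N + 1) (N + 1) = 1 / 2 := by
    rw [freqWt, abs_of_nonneg (by positivity)]
    simp
  have h3 : freqWt (N + 1) (-(N + 1)) = 1 / 2 := by
    rw [freqWt, abs_neg, abs_of_nonneg (by positivity)]
    simp
  have h4 := expi_add_expi_neg (N + 1) x
  push_cast at h4
  rw [h1, h2, h3, sum_expi_Icc]
  push_cast
  linear_combination (-1 / (2 * (N + 1)) * (1 / 2)) * h4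

/-- The discrete Fourier coefficient of a function on the nodes. -/
def nodeCoeff (n : ℕ) (g : ℝ → ℂ) (l : ℤ) : ℂ :=
  1 / (2 * n) * ∑ j ∈ Finset.range (2 * n), g (node n j) * expi (-l) (node n j)

lemma interp_eq {n : ℕ} (hn : 1 ≤ n) (g : ℝ → ℂ) (t : ℝ) :
    interp n g t =
      ∑ l ∈ Finset.Icc (-(n : ℤ)) n, (freqWt n l * nodeCoeff n g l) * expi l t := by
  simp only [interp, lagrangeBasis_eq hn, nodeCoeff, Finset.mul_sum, Finset.sum_mul]
  rw [Finset.sum_comm]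
  refine Finset.sum_congr rfl fun l _ => Finset.sum_congr rfl fun j _ => ?_
  rw [expi_arg_sub]
  ring

lemma freqWt_of_lt {n : ℕ} {l : ℤ} (h : n < |l|) : freqWt n l = 0 := by
  rw [freqWt, if_neg (by omega), if_neg (by omega)]

lemma norm_freqWt_le (n : ℕ) (l : ℤ) : ‖freqWt n l‖ ≤ 1 := by
  rw [freqWt]
  split_ifs <;> norm_num

lemma interp_wiener {n : ℕ} (hn : 1 ≤ n) (g : ℝ → ℂ) :
    Wiener (interp n g) ∧ ∀ l, hat (interp n g) l = freqWt n l * nodeCoeff n g l := by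
  have hz : ∀ l ∉ Finset.Icc (-(n : ℤ)) n, freqWt n l = 0 := by
    intro l hl
    apply freqWt_of_lt
    rw [Finset.mem_Icc, ← abs_le] at hl
    omega
  apply Wiener.of_hasSum
  · apply summable_of_ne_finset_zero (s := Finset.Icc (-(n : ℤ)) n)
    intro l hl
    simp [hz l hl]
  · intro t
    rw [interp_eq hn]
    apply hasSum_sum_of_ne_finset_zero
    intro l hl
    simp [hz l hl]

lemma expi_node (n : ℕ) (k : ℤ) (j : ℕ) :
    expi k (node n j) = Complex.exp (Complex.I * k * Real.pi / n) ^ j := by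
  rw [expi, node, ← Complex.exp_nat_mul]
  push_cast
  congr 1
  ring

/-- Discrete orthogonality. -/
lemma sum_expi_node {n : ℕ} (hn : 1 ≤ n) (k : ℤ) :
    (1 / (2 * n) : ℂ) * ∑ j ∈ Finset.range (2 * n), expi k (node n j) =
      if (2 * n : ℤ) ∣ k then 1 else 0 := by
  have hn0 : (n : ℂ) ≠ 0 := by exact_mod_cast (by omega : n ≠ 0)
  have hpi : (Real.pi : ℂ) ≠ 0 := by exact_mod_cast Real.pi_ne_zero
  simp only [expi_node]
  set r := Complex.exp (Complex.I * k * Real.pi / n) with hr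
  split_ifs with h
  · obtain ⟨z, rfl⟩ := h
    have : r = 1 := by
      rw [hr, Complex.exp_eq_one_iff]
      refine ⟨z, ?_⟩
      push_cast
      field_simp
    simp [this]
    field_simp
  · have h1 : r ≠ 1 := by
      intro h1
      rw [hr, Complex.exp_eq_one_iff] at h1
      obtain ⟨z, hz⟩ := h1
      apply h
      refine ⟨z, ?_⟩
      have hI := Complex.I_ne_zero
      field_simp at hz
      have : (k : ℂ) = ((2 * n * z : ℤ) : ℂ) := by
        push_cast
        linear_combination hz
      exact_mod_cast this
    have h2 : r ^ (2 * n) = 1 := by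
      rw [hr, ← Complex.exp_nat_mul, Complex.exp_eq_one_iff]
      refine ⟨k, ?_⟩
      push_cast
      field_simp
    rw [geom_sum_eq h1, h2]
    simp

/-- The matrix of the interpolation operator in Fourier coefficients. -/
def aliasMat (n : ℕ) (l m : ℤ) : ℂ := if (2 * n : ℤ) ∣ m - l then freqWt n l else 0

/-- On the nodes an exponential is known only modulo 2n: sampling the Fourier series and using
discrete orthogonality, every m congruent to l contributes to the coefficient l. -/
lemma hat_interp {n : ℕ} (hn : 1 ≤ n) {u : ℝ → ℂ} (hu : Wiener u) (l : ℤ) :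
    HasSum (fun m => aliasMat n l m * hat u m) (hat (interp n u) l) := by
  have h1 : ∀ j ∈ Finset.range (2 * n), HasSum
      (fun m => hat u m * (expi m (node n j) * expi (-l) (node n j)))
      (u (node n j) * expi (-l) (node n j)) := fun j _ => by
    have := (hu.hasSum (node n j)).mul_right (expi (-l) (node n j))
    simpa only [mul_assoc] using this
  have h2 := (hasSum_sum h1).mul_left (freqWt n l * (1 / (2 * n)))
  rw [(interp_wiener hn u).2, nodeCoeff, ← mul_assoc]
  have he : (fun m => aliasMat n l m * hat u m) = fun m => freqWt n l * (1 / (2 * n)) *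
      ∑ j ∈ Finset.range (2 * n), hat u m * (expi m (node n j) * expi (-l) (node n j)) := by
    funext m
    simp only [← expi_add]
    rw [← Finset.mul_sum, aliasMat]
    have := sum_expi_node hn (m + -l)
    rw [show freqWt n l * (1 / (2 * n)) * (hat u m *
        ∑ j ∈ Finset.range (2 * n), expi (m + -l) (node n j)) = freqWt n l * hat u m *
        (1 / (2 * n) * ∑ j ∈ Finset.range (2 * n), expi (m + -l) (node n j)) by ring, this,
      ← sub_eq_add_neg]
    split_ifs <;> simp
  rw [he]
  exact h2

lemma interp_node {n : ℕ} (hn : 1 ≤ n) (g : ℝ → ℂ) {i : ℕ} (hi : i < 2 * n) :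
    interp n g (node n i) = g (node n i) := by
  have hL : ∀ j ∈ Finset.range (2 * n),
      g (node n j) * (lagrangeBasis n j (node n i) : ℂ) = if i = j then g (node n j) else 0 := by
    intro j hj
    have hn0 : (n : ℂ) ≠ 0 := by exact_mod_cast (by omega : n ≠ 0)
    rw [lagrangeBasis_eq hn]
    set x := node n i - node n j with hx
    -- At a difference of nodes the frequencies n and −n coincide, so the two half terms merge into
    -- one and leave a full window of 2n frequencies.
    have hnx : expi n x = expi (-n) x := by
      have : expi (2 * n) x = 1 := by
        rw [expi, Complex.exp_eq_one_iff]
        refine ⟨i - j, ?_⟩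
        simp only [hx, node]
        push_cast
        field_simp
      have h2 := expi_neg_mul n x
      have h3 := expi_add n n x
      rw [← two_mul, this] at h3
      have h4 : expi (n : ℤ) x ≠ 0 := by
        rw [← norm_ne_zero_iff, norm_expi]; exact one_ne_zero
      exact mul_right_cancel₀ h4 (h3.symm.trans h2.symm)
    -- Frequency and node index exchange roles: e^{is(ζ_i − ζ_j)} = e^{i(i − j)ζ_s}, so discrete
    -- orthogonality applies.
    have hsum : ∑ l ∈ Finset.Icc (-(n : ℤ)) n, freqWt n l * expi l x =
        expi (-n) x * ∑ s ∈ Finset.range (2 * n), expi (i - j) (node n s) := by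
      have e1 : ∑ l ∈ Finset.Icc (-(n : ℤ)) n, freqWt n l * expi l x =
          ∑ l ∈ Finset.Ico (-(n : ℤ)) n, expi l x := by
        have a1 : Finset.Icc (-(n : ℤ)) n =
            insert (-(n : ℤ)) (insert (n : ℤ) (Finset.Ioo (-(n : ℤ)) n)) := by
          ext y; simp only [Finset.mem_Icc, Finset.mem_insert, Finset.mem_Ioo]; omega
        have a2 : Finset.Ico (-(n : ℤ)) n = insert (-(n : ℤ)) (Finset.Ioo (-(n : ℤ)) n) := by
          ext y; simp only [Finset.mem_Ico, Finset.mem_insert, Finset.mem_Ioo]; omega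
        have a3 : freqWt n n = 1 / 2 := by simp [freqWt]
        have a4 : freqWt n (-n) = 1 / 2 := by simp [freqWt]
        rw [a1, a2, Finset.sum_insert, Finset.sum_insert, Finset.sum_insert, a3, a4, hnx]
        · have : ∑ l ∈ Finset.Ioo (-(n : ℤ)) n, freqWt n l * expi l x =
              ∑ l ∈ Finset.Ioo (-(n : ℤ)) n, expi l x := by
            refine Finset.sum_congr rfl fun l hl => ?_
            rw [Finset.mem_Ioo, ← abs_lt] at hl
            rw [freqWt, if_pos hl, one_mul]
          rw [this]
          ring
        · simp
        · simp
        · simp only [Finset.mem_insert, Finset.mem_Ioo]; omega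
      rw [e1, Finset.mul_sum]
      symm
      refine Finset.sum_bij (fun s _ => (s : ℤ) - n) ?_ ?_ ?_ ?_
      · intro s hs
        simp only [Finset.mem_range] at hs
        simp only [Finset.mem_Ico]
        omega
      · intro a _ b _ h
        omega
      · intro b hb
        simp only [Finset.mem_Ico] at hb
        exact ⟨(b + n).toNat, by simp only [Finset.mem_range]; omega, by omega⟩
      · intro s _
        have : expi (i - j) (node n s) = expi s x := by
          simp only [expi, hx, node]
          congr 1
          push_cast
          ring
        rw [this, ← expi_add]
        congr 1
        ring
    have hort := sum_expi_node hn ((i : ℤ) - j)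
    rw [hsum, show 1 / (2 * (n : ℂ)) * (expi (-n) x *
      ∑ s ∈ Finset.range (2 * n), expi (i - j) (node n s)) = expi (-n) x * (1 / (2 * n) *
      ∑ s ∈ Finset.range (2 * n), expi (i - j) (node n s)) by ring, hort]
    rw [Finset.mem_range] at hj
    by_cases h : i = j
    · subst h
      simp [hx, expi]
    · rw [if_neg h, if_neg, mul_zero, mul_zero]
      rintro ⟨z, hz⟩
      have hz0 : z ≠ 0 := by rintro rfl; omega
      have : (2 * n : ℤ) ≤ |(i : ℤ) - j| := by
        rw [hz, abs_mul]
        have := Int.one_le_abs hz0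
        rw [abs_of_nonneg (by positivity : (0 : ℤ) ≤ 2 * n)]
        nlinarith
      rw [le_abs] at this
      omega
  rw [interp, Finset.sum_congr rfl hL, Finset.sum_ite_eq]
  simp [hi]

lemma interp_congr {n : ℕ} {f g : ℝ → ℂ} (h : ∀ i < 2 * n, f (node n i) = g (node n i)) :
    interp n f = interp n g := by
  funext t
  rw [interp, interp]
  refine Finset.sum_congr rfl fun i hi => ?_
  rw [h i (Finset.mem_range.mp hi)]

/-- Interpolation depends on node values only, and at the nodes an interpolant equals its function.
This lets smallness known only after interpolation pass through products. -/
lemma interp_mul_interp {n : ℕ} (hn : 1 ≤ n) (f g : ℝ → ℂ) :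
    interp n (f * interp n g) = interp n (f * g) :=
  interp_congr fun i hi => by simp only [Pi.mul_apply, interp_node hn g hi]

lemma interp_add (n : ℕ) (f g : ℝ → ℂ) : interp n (f + g) = interp n f + interp n g := by
  funext t
  simp [interp, add_mul, Finset.sum_add_distrib]

lemma interp_smul (n : ℕ) (c : ℂ) (f : ℝ → ℂ) : interp n (c • f) = c • interp n f := by
  funext t
  simp [interp, Finset.mul_sum, mul_assoc]

lemma interp_sub (n : ℕ) (f g : ℝ → ℂ) : interp n (f - g) = interp n f - interp n g := by
  funext t
  simp [interp, sub_mul, Finset.sum_sub_distrib]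

lemma interp_zero (n : ℕ) : interp n 0 = 0 := by
  funext t
  simp [interp]

/-- The space `X_n`, described by Fourier coefficients. -/
structure InX (n : ℕ) (u : ℝ → ℂ) : Prop where
  wiener : Wiener u
  vanish : ∀ m : ℤ, n < |m| → hat u m = 0
  symm : hat u n = hat u (-n)

lemma InX.add {n : ℕ} {u v : ℝ → ℂ} (hu : InX n u) (hv : InX n v) : InX n (u + v) := by
  have h := hu.wiener.add' hv.wiener
  exact ⟨h.1, fun m hm => by rw [h.2, hu.vanish m hm, hv.vanish m hm, add_zero],
    by rw [h.2, h.2, hu.symm, hv.symm]⟩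

lemma InX.smul {n : ℕ} {u : ℝ → ℂ} (c : ℂ) (hu : InX n u) : InX n (c • u) := by
  have h := hu.wiener.smul' c
  exact ⟨h.1, fun m hm => by rw [h.2, hu.vanish m hm, mul_zero], by rw [h.2, h.2, hu.symm]⟩

lemma InX.zero (n : ℕ) : InX n 0 :=
  ⟨Wiener.zero'.1, fun m _ => Wiener.zero'.2 m, by rw [Wiener.zero'.2, Wiener.zero'.2]⟩

lemma InX.sum {n : ℕ} {ι : Type*} (s : Finset ι) (u : ι → ℝ → ℂ) (h : ∀ i ∈ s, InX n (u i)) :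
    InX n (∑ i ∈ s, u i) := by
  classical
  induction s using Finset.induction_on with
  | empty => simpa using InX.zero n
  | insert a s ha ih =>
    rw [Finset.sum_insert ha]
    exact (h a (Finset.mem_insert_self a s)).add
      (ih fun i hi => h i (Finset.mem_insert_of_mem hi))

lemma inX_expi_add {n m : ℕ} (hm : m ≤ n) : InX n (expi m + expi (-m)) := by
  have h1 := expi_wiener m
  have h2 := expi_wiener (-m)
  have h := h1.1.add' h2.1
  refine ⟨h.1, fun k hk => ?_, ?_⟩
  · rw [h.2, h1.2, h2.2, if_neg, if_neg, add_zero] <;> (rintro rfl; simp at hk; omega)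
  · rw [h.2, h.2, h1.2, h2.2, h1.2, h2.2]
    simp only [neg_eq_iff_eq_neg, neg_neg]
    rw [add_comm]

lemma inX_expi {n : ℕ} {m : ℤ} (hm : |m| < n) : InX n (expi m) := by
  have h1 := expi_wiener m
  rw [abs_lt] at hm
  refine ⟨h1.1, fun k hk => ?_, ?_⟩
  · rw [h1.2, if_neg]
    rintro rfl
    rw [lt_abs] at hk
    omega
  · rw [h1.2, h1.2, if_neg (by omega), if_neg (by omega)]

lemma InX.of_trigPoly {n : ℕ} {φ : ℝ → ℂ} (h : φ ∈ trigPoly n) : InX n φ := by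
  obtain ⟨a, b, h⟩ := h
  have e : φ = ∑ m ∈ Finset.range (n + 1), (a m / 2) • (expi m + expi (-m)) +
      ∑ m ∈ Finset.Ico 1 n, (b m / (2 * Complex.I)) • (expi m + (-1 : ℂ) • expi (-m)) := by
    funext t
    rw [h t]
    simp only [Pi.add_apply, Finset.sum_apply, Pi.smul_apply, smul_eq_mul]
    congr 1
    · refine Finset.sum_congr rfl fun m _ => ?_
      rw [expi_add_expi_neg]
      ring
    · refine Finset.sum_congr rfl fun m _ => ?_
      rw [neg_one_mul, ← sub_eq_add_neg, expi_sub_expi_neg]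
      have := Complex.I_ne_zero
      field_simp
  rw [e]
  refine (InX.sum _ _ fun m hm => ?_).add (InX.sum _ _ fun m hm => ?_)
  · exact (inX_expi_add (by simp at hm; omega)).smul _
  · simp only [Finset.mem_Ico] at hm
    exact ((inX_expi (by simp; omega)).add ((inX_expi (by simp; omega)).smul _)).smul _

lemma inX_interp {n : ℕ} (hn : 1 ≤ n) (g : ℝ → ℂ) : InX n (interp n g) := by
  have h := interp_wiener hn g
  refine ⟨h.1, fun m hm => ?_, ?_⟩
  · rw [h.2, freqWt_of_lt hm, zero_mul]
  · rw [h.2, h.2]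
    have : freqWt n n = freqWt n (-n) := by simp [freqWt]
    rw [this, nodeCoeff, nodeCoeff]
    congr 2
    refine Finset.sum_congr rfl fun j _ => ?_
    congr 1
    have hn0 : (n : ℂ) ≠ 0 := by exact_mod_cast (by omega : n ≠ 0)
    -- The exponentials of frequencies n and −n differ by e^{2int}, which is 1 at every node.
    have h1 : expi (2 * n) (node n j) = 1 := by
      rw [expi, Complex.exp_eq_one_iff]
      refine ⟨j, ?_⟩
      simp only [node]
      push_cast
      field_simp
    have h2 := expi_add (-n) (2 * n) (node n j)
    rw [h1, mul_one] at h2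
    rw [← h2]
    congr 1
    ring

/-- Interpolation reproduces `X_n`. -/
lemma InX.interp_eq {n : ℕ} (hn : 1 ≤ n) {u : ℝ → ℂ} (hu : InX n u) : interp n u = u := by
  refine (inX_interp hn u).wiener.ext hu.wiener fun l => ?_
  have h := hat_interp hn hu.wiener l
  rcases lt_trichotomy |l| n with hl | hl | hl
  · refine h.unique ?_
    convert hasSum_single l ?_ using 1
    · simp [aliasMat, freqWt, hl]
    · intro m hm
      by_cases hd : (2 * n : ℤ) ∣ m - l
      · rw [hu.vanish, mul_zero]
        obtain ⟨z, hz⟩ := hd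
        have hz0 : z ≠ 0 := by rintro rfl; omega
        have h1 : (2 * n : ℤ) ≤ |m - l| := by
          rw [hz, abs_mul, abs_of_nonneg (by positivity : (0 : ℤ) ≤ 2 * n)]
          have := Int.one_le_abs hz0
          nlinarith
        have := abs_sub m l
        omega
      · rw [aliasMat, if_neg hd, zero_mul]
  -- At |l| = n both l and −l contribute with weight 1/2; equality of the two coefficients makes the
  -- sum whole. Every other alias lies outside [−n, n].
  · have hsym : hat u l = hat u (-l) := by
      rcases (abs_eq (by positivity)).mp hl with rfl | rfl
      · exact hu.symm
      · rw [neg_neg]; exact hu.symm.symm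
    have hl0 : l ≠ -l := by
      rcases (abs_eq (by positivity)).mp hl with rfl | rfl <;> omega
    refine h.unique ?_
    have h2 := hasSum_sum_of_ne_finset_zero (f := fun m => aliasMat n l m * hat u m)
      (s := {l, -l}) (L := .unconditional ℤ) ?_
    · convert h2 using 1
      rw [Finset.sum_pair hl0]
      have hd : (2 * n : ℤ) ∣ -l - l := by
        rcases (abs_eq (by positivity)).mp hl with rfl | rfl
        · exact ⟨-1, by ring⟩
        · exact ⟨1, by ring⟩
      simp only [aliasMat, sub_self, dvd_zero, if_true, hd, ← hsym, freqWt, hl, lt_irrefl, if_false]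
      ring
    · intro m hm
      simp only [Finset.mem_insert, Finset.mem_singleton, not_or] at hm
      by_cases hd : (2 * n : ℤ) ∣ m - l
      · rw [hu.vanish, mul_zero]
        by_contra hc
        have h3 : |m| ≠ n := fun h3 => by
          rw [← hl] at h3
          rcases abs_eq_abs.mp h3 with h3 | h3
          · exact hm.1 h3
          · exact hm.2 h3
        obtain ⟨z, hz⟩ := hd
        have hz0 : z ≠ 0 := by rintro rfl; omega
        have h1 : (2 * n : ℤ) ≤ |m - l| := by
          rw [hz, abs_mul, abs_of_nonneg (by positivity : (0 : ℤ) ≤ 2 * n)]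
          have := Int.one_le_abs hz0
          nlinarith
        have := abs_sub m l
        omega
      · rw [aliasMat, if_neg hd, zero_mul]
  · rw [hu.vanish l hl, (inX_interp hn u).vanish l hl]

/-! ### Bounds for multipliers, multiplication, and interpolation -/

/-- Peetre's inequality: a weight at l is moved to m at the cost of a power of l − m, which rapidly
decaying coefficients absorb. -/
lemma peetre (l m : ℝ) : 1 + l ^ 2 ≤ 2 * (1 + (l - m) ^ 2) * (1 + m ^ 2) := by
  nlinarith [sq_nonneg (l - 2 * m), sq_nonneg ((l - m) * m), sq_nonneg (l - m), sq_nonneg m]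

lemma wt_le_mul {q : ℝ} (hq : 0 ≤ q) (l m : ℤ) :
    wt q l ≤ ENNReal.ofReal (2 ^ q) * wt q (l - m) * wt q m := by
  rw [wt, wt, wt, ← ENNReal.ofReal_mul (by positivity), ← ENNReal.ofReal_mul (by positivity),
    ← Real.mul_rpow (by norm_num) (by positivity), ← Real.mul_rpow (by positivity) (by positivity)]
  apply ENNReal.ofReal_le_ofReal
  apply Real.rpow_le_rpow (by positivity) _ hq
  have := peetre l m
  push_cast
  exact this

lemma wt_mono {p q : ℝ} (h : p ≤ q) (m : ℤ) : wt p m ≤ wt q m := by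
  apply ENNReal.ofReal_le_ofReal
  exact Real.rpow_le_rpow_of_exponent_le (by nlinarith [sq_nonneg (m : ℝ)]) h

lemma sobolevNorm_mono {p q : ℝ} (h : p ≤ q) (u : ℝ → ℂ) : sobolevNorm p u ≤ sobolevNorm q u := by
  rw [sobolevNorm_eq, sobolevNorm_eq, nsq, nsq]
  gcongr with m
  exact wt_mono h m

lemma sobolevNorm_mult_le {p a c : ℝ} {u v : ℝ → ℂ} {τ : ℤ → ℂ}
    (hv : ∀ m, hat v m = τ m * hat u m)
    (hτ : ∀ m : ℤ, ‖τ m‖ ≤ c * (1 + (m : ℝ) ^ 2) ^ (-a / 2)) :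
    sobolevNorm (p + a) v ≤ ENNReal.ofReal c * sobolevNorm p u := by
  apply sobolevNorm_le_of_nsq
  rw [nsq, nsq, ← ENNReal.tsum_mul_left]
  refine ENNReal.tsum_le_tsum fun m => ?_
  have h1 : ‖τ m‖ₑ ≤ ENNReal.ofReal c * wt (-a / 2) m := by
    rw [wt, ← ENNReal.ofReal_mul' (by positivity), ← ofReal_norm]
    exact ENNReal.ofReal_le_ofReal (hτ m)
  have h2 : wt (p + a) m * (wt (-a / 2) m) ^ 2 = wt p m := by
    rw [sq, ← wt_add, ← wt_add]
    congr 1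
    ring
  rw [hv, enorm_mul]
  calc wt (p + a) m * (‖τ m‖ₑ * ‖hat u m‖ₑ) ^ 2
      ≤ wt (p + a) m * ((ENNReal.ofReal c * wt (-a / 2) m) * ‖hat u m‖ₑ) ^ 2 := by gcongr
    _ = ENNReal.ofReal c ^ 2 * ((wt (p + a) m * (wt (-a / 2) m) ^ 2) * ‖hat u m‖ₑ ^ 2) := by ring
    _ = _ := by rw [h2]

/-- Functions with rapidly decaying Fourier coefficients. -/
structure Rapid (f : ℝ → ℂ) : Prop where
  wiener : Wiener f
  decay : ∀ r : ℝ, ∑' k, wt r k * ‖hat f k‖ₑ ≠ ⊤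

lemma tsum_sub_left (g : ℤ → ℝ≥0∞) (l : ℤ) : ∑' m, g (l - m) = ∑' m, g m :=
  (Equiv.subLeft l).tsum_eq g

lemma tsum_sub_right (g : ℤ → ℝ≥0∞) (l : ℤ) : ∑' m, g (m - l) = ∑' m, g m :=
  (Equiv.subRight l).tsum_eq g

lemma enorm_le_of_hasSum {F : ℤ → ℂ} {x : ℂ} (h : HasSum F x) : ‖x‖ₑ ≤ ∑' m, ‖F m‖ₑ := by
  rw [← h.tsum_eq]
  exact enorm_tsum_le_tsum_enorm

lemma wt_zero (m : ℤ) : wt 0 m = 1 := by simp [wt]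

/-- A square root of a finite constant. -/
lemma exists_sq_eq {D : ℝ≥0∞} (hD : D ≠ ⊤) : ∃ C : ℝ≥0∞, C ≠ ⊤ ∧ C ^ 2 = D :=
  ⟨D ^ (1 / 2 : ℝ), ENNReal.rpow_ne_top_of_nonneg (by norm_num) hD, by
    rw [← ENNReal.rpow_natCast, ← ENNReal.rpow_mul]; norm_num⟩

/-- Multiplication by a smooth function is bounded. -/
lemma Rapid.mul_bound {f : ℝ → ℂ} (hf : Rapid f) {q : ℝ} (hq : 0 ≤ q) :
    ∃ C : ℝ≥0∞, C ≠ ⊤ ∧ ∀ u, Wiener u → sobolevNorm q (f * u) ≤ C * sobolevNorm q u := by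
  set A := ENNReal.ofReal (2 ^ q) * ∑' k, wt q k * ‖hat f k‖ₑ
  set B := ∑' k, wt 0 k * ‖hat f k‖ₑ
  have hA : A ≠ ⊤ := ENNReal.mul_ne_top ENNReal.ofReal_ne_top (hf.decay q)
  obtain ⟨C, hC, hC2⟩ := exists_sq_eq (ENNReal.mul_ne_top hA (hf.decay 0))
  refine ⟨C, hC, fun u hu => sobolevNorm_le_of_nsq ?_⟩
  rw [hC2, nsq, nsq]
  -- The kernel is that of convolution; in the row bound `wt_le_mul` puts the whole excess weight on
  -- the coefficients of f.
  refine schur (K := fun l m => ‖hat f (l - m)‖ₑ) (wt_ne_zero q) (wt_ne_top q) ?_ ?_ ?_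
  · intro l
    refine (enorm_le_of_hasSum ((hf.wiener.mul' hu).2 l)).trans_eq ?_
    simp only [enorm_mul]
  · intro l
    rw [← ENNReal.tsum_mul_left]
    calc ∑' m, wt q l * (‖hat f (l - m)‖ₑ * (wt q m)⁻¹)
        ≤ ∑' m, ENNReal.ofReal (2 ^ q) * (wt q (l - m) * ‖hat f (l - m)‖ₑ) := by
          refine ENNReal.tsum_le_tsum fun m => ?_
          calc wt q l * (‖hat f (l - m)‖ₑ * (wt q m)⁻¹)
              ≤ (ENNReal.ofReal (2 ^ q) * wt q (l - m) * wt q m) *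
                (‖hat f (l - m)‖ₑ * (wt q m)⁻¹) := by gcongr; exact wt_le_mul hq l m
            _ = ENNReal.ofReal (2 ^ q) * (wt q (l - m) * ‖hat f (l - m)‖ₑ) *
                (wt q m * (wt q m)⁻¹) := by ring
            _ = _ := by
              rw [ENNReal.mul_inv_cancel (wt_ne_zero q m) (wt_ne_top q m), mul_one]
      _ = A := by
          rw [ENNReal.tsum_mul_left, tsum_sub_left (fun k => wt q k * ‖hat f k‖ₑ) l]
  · intro m
    rw [tsum_sub_right (fun k => ‖hat f k‖ₑ) m]
    simp only [wt_zero, one_mul, le_refl]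

/-- Incidence of frequencies under aliasing. -/
def aliasInd (n : ℕ) (l m : ℤ) : ℝ≥0∞ := if |l| ≤ n ∧ (2 * n : ℤ) ∣ m - l then 1 else 0

lemma dvd_eq_of_lt {n : ℕ} {d : ℤ} (h : (2 * n : ℤ) ∣ d) (h1 : d < 2 * n) (h2 : -(2 * n : ℤ) < d) :
    d = 0 := by
  by_contra h0
  have := Int.le_of_dvd (abs_pos.mpr h0) ((dvd_abs _ _).mpr h)
  rw [le_abs] at this
  omega

lemma tsum_ind_le_one {P : ℤ → Prop} [DecidablePred P] (h : ∀ a b, P a → P b → a = b) :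
    ∑' l, (if P l then 1 else 0 : ℝ≥0∞) ≤ 1 := by
  by_cases hP : ∃ a, P a
  · obtain ⟨a, ha⟩ := hP
    rw [tsum_eq_single a fun b hb => if_neg fun hb' => hb (h b a hb' ha), if_pos ha]
  · push Not at hP
    simp [hP]

/-- Each m has at most one representative in the half-open window (−n, n]; the endpoint −n may add a
second one. -/
lemma tsum_aliasInd_le (n : ℕ) (hn : 1 ≤ n) (m : ℤ) : ∑' l, aliasInd n l m ≤ 2 := by
  calc ∑' l, aliasInd n l m ≤ ∑' l, ((if (-(n : ℤ) < l ∧ l ≤ n) ∧ (2 * n : ℤ) ∣ m - l then 1 else 0) +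
        (if l = -(n : ℤ) then 1 else 0) : ℝ≥0∞) := by
        refine ENNReal.tsum_le_tsum fun l => ?_
        rw [aliasInd]
        split_ifs with h1 h2 h3 h3 h2 h3 h3
        all_goals first
          | (simp; done)
          | (exfalso; rw [abs_le] at h1; omega)
    _ ≤ 1 + 1 := by
        rw [ENNReal.tsum_add]
        refine add_le_add (tsum_ind_le_one fun a b ha hb => ?_)
          (tsum_ind_le_one fun a b ha hb => ha.trans hb.symm)
        have hd := dvd_sub ha.2 hb.2
        rw [sub_sub_sub_cancel_left] at hd
        have := dvd_eq_of_lt hd (by omega) (by omega)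
        omega
    _ = 2 := one_add_one_eq_two

lemma abs_le_of_dvd {n : ℕ} {l j : ℤ} (hl : |l| ≤ n) (hj : j ≠ 0) :
    (n : ℤ) * |j| ≤ |l + 2 * n * j| := by
  have h1 : |2 * (n : ℤ) * j| = 2 * n * |j| := by
    rw [abs_mul, abs_of_nonneg (by positivity : (0 : ℤ) ≤ 2 * n)]
  have h2 := abs_sub_abs_le_abs_sub (2 * (n : ℤ) * j) (-l)
  rw [abs_neg, sub_neg_eq_add, h1, add_comm _ l] at h2
  have h3 := Int.one_le_abs hj
  nlinarith

lemma le_abs_of_dvd {n : ℕ} {l m : ℤ} (hl : |l| ≤ n) (hd : (2 * n : ℤ) ∣ m - l) (hm : m ≠ l) :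
    (n : ℤ) ≤ |m| := by
  obtain ⟨j, hj⟩ := hd
  have hj0 : j ≠ 0 := by rintro rfl; apply hm; linarith
  have h := abs_le_of_dvd hl hj0
  have h3 := Int.one_le_abs hj0
  rw [show m = l + 2 * n * j by linarith]
  nlinarith

/-- The constant in the aliasing bound. -/
def aliasConst (q : ℝ) : ℝ≥0∞ :=
  1 + ∑' j : ℤ, ENNReal.ofReal (2 ^ q * |(j : ℝ)| ^ (-(2 * q)))

lemma aliasConst_ne_top {q : ℝ} (hq : 1 / 2 < q) : aliasConst q ≠ ⊤ := by
  refine ENNReal.add_ne_top.mpr ⟨by simp, ?_⟩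
  exact ((Real.summable_abs_int_rpow (b := 2 * q) (by linarith)).mul_left _).tsum_ofReal_ne_top

/-- The aliases l + 2nj with j ≠ 0 have modulus at least n|j|, while 1 + l² ≤ 2n². The powers of n
cancel and leave a multiple of |j|^(−2q), summable because q > 1/2; hence the bound is uniform in n.
-/
lemma aliasInd_row {q : ℝ} (hq : 1 / 2 < q) {n : ℕ} (hn : 1 ≤ n) (l : ℤ) :
    wt q l * ∑' m, aliasInd n l m * (wt q m)⁻¹ ≤ aliasConst q := by
  by_cases hl : |l| ≤ n
  swap
  · simp [aliasInd, hl]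
  have hinj : Function.Injective fun j : ℤ => l + 2 * (n : ℤ) * j := by
    intro a b h
    have hn0 : (2 * n : ℤ) ≠ 0 := by omega
    exact mul_left_cancel₀ hn0 (add_left_cancel h)
  have hreindex : ∑' m, aliasInd n l m * (wt q m)⁻¹ = ∑' j : ℤ, (wt q (l + 2 * n * j))⁻¹ := by
    have := hinj.tsum_eq (f := fun m => aliasInd n l m * (wt q m)⁻¹) ?_
    · rw [← this]
      refine tsum_congr fun j => ?_
      simp [aliasInd, hl]
    · intro m hm
      rw [Function.mem_support] at hm
      by_cases hd : (2 * n : ℤ) ∣ m - l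
      · obtain ⟨j, hj⟩ := hd
        exact ⟨j, by simp only; omega⟩
      · simp [aliasInd, hd] at hm
  rw [hreindex, ← ENNReal.tsum_mul_left, aliasConst]
  calc ∑' j : ℤ, wt q l * (wt q (l + 2 * n * j))⁻¹
      ≤ ∑' j : ℤ, ((if j = 0 then 1 else 0) + ENNReal.ofReal (2 ^ q * |(j : ℝ)| ^ (-(2 * q)))) := by
        refine ENNReal.tsum_le_tsum fun j => ?_
        by_cases hj : j = 0
        · subst hj
          rw [mul_zero, add_zero, ENNReal.mul_inv_cancel (wt_ne_zero q l) (wt_ne_top q l), if_pos rfl]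
          exact le_self_add
        · rw [if_neg hj, zero_add, wt_inv, wt, wt, ← ENNReal.ofReal_mul (by positivity)]
          apply ENNReal.ofReal_le_ofReal
          have hnR : (1 : ℝ) ≤ n := by exact_mod_cast hn
          have hj1 : (1 : ℝ) ≤ |(j : ℝ)| := by exact_mod_cast Int.one_le_abs hj
          have hlR : (l : ℝ) ^ 2 ≤ (n : ℝ) ^ 2 := by
            rw [← sq_abs]
            have : |(l : ℝ)| ≤ n := by exact_mod_cast hl
            gcongr
          have hmR : (n : ℝ) * |(j : ℝ)| ≤ |((l + 2 * n * j : ℤ) : ℝ)| := by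
            exact_mod_cast abs_le_of_dvd hl hj
          have h1 : (1 + (l : ℝ) ^ 2) ^ q ≤ (2 * (n : ℝ) ^ 2) ^ q := by
            apply Real.rpow_le_rpow (by positivity) _ (by linarith)
            nlinarith
          have h2 : (1 + ((l + 2 * n * j : ℤ) : ℝ) ^ 2) ^ (-q) ≤ ((n * |(j : ℝ)|) ^ 2) ^ (-q) := by
            apply Real.rpow_le_rpow_of_nonpos (by positivity) _ (by linarith)
            rw [← sq_abs ((l + 2 * n * j : ℤ) : ℝ)]
            have := pow_le_pow_left₀ (by positivity) hmR 2
            linarith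
          calc _ ≤ (2 * (n : ℝ) ^ 2) ^ q * ((n * |(j : ℝ)|) ^ 2) ^ (-q) := by gcongr
            _ = 2 ^ q * |(j : ℝ)| ^ (-(2 * q)) := by
              have hnq : ((n : ℝ) ^ 2) ^ q * ((n : ℝ) ^ 2) ^ (-q) = 1 := by
                rw [← Real.rpow_add (by positivity)]; simp
              have hjq : (|(j : ℝ)| ^ 2) ^ (-q) = |(j : ℝ)| ^ (-(2 * q)) := by
                rw [← Real.rpow_natCast, ← Real.rpow_mul (by positivity)]
                congr 1
                push_cast
                ring
              rw [mul_pow, Real.mul_rpow (by positivity) (by positivity),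
                Real.mul_rpow (by positivity) (by positivity), hjq]
              linear_combination (2 ^ q * |(j : ℝ)| ^ (-(2 * q))) * hnq
    _ ≤ _ := by
        rw [ENNReal.tsum_add, tsum_ite_eq]

lemma enorm_aliasMat_le (n : ℕ) (l m : ℤ) : ‖aliasMat n l m‖ₑ ≤ aliasInd n l m := by
  rw [aliasMat, aliasInd]
  by_cases hd : (2 * n : ℤ) ∣ m - l
  · by_cases hl : |l| ≤ n
    · rw [if_pos hd, if_pos ⟨hl, hd⟩]
      have := ENNReal.ofReal_le_ofReal (norm_freqWt_le n l)
      rwa [ofReal_norm, ENNReal.ofReal_one] at this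
    · rw [if_pos hd, freqWt_of_lt (by omega)]
      simp
  · rw [if_neg hd]
    simp

/-- Interpolation is bounded in Sobolev norms of order greater than `1/2`. -/
lemma interp_bound {q : ℝ} (hq : 1 / 2 < q) : ∃ C : ℝ≥0∞, C ≠ ⊤ ∧ ∀ n : ℕ, 1 ≤ n → ∀ u, Wiener u →
    sobolevNorm q (interp n u) ≤ C * sobolevNorm q u := by
  obtain ⟨C, hC, hC2⟩ := exists_sq_eq (ENNReal.mul_ne_top (aliasConst_ne_top hq)
    (by simp : (2 : ℝ≥0∞) ≠ ⊤))
  refine ⟨C, hC, fun n hn u hu => sobolevNorm_le_of_nsq ?_⟩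
  rw [hC2, nsq, nsq]
  refine schur (K := aliasInd n) (wt_ne_zero q) (wt_ne_top q) ?_ (aliasInd_row hq hn)
    (tsum_aliasInd_le n hn)
  intro l
  refine (enorm_le_of_hasSum (hat_interp hn hu l)).trans (ENNReal.tsum_le_tsum fun m => ?_)
  rw [enorm_mul]
  gcongr
  exact enorm_aliasMat_le n l m

/-- The interpolation error, with one order of smoothness to spare. -/
lemma interp_error {q : ℝ} (hq : 1 / 2 < q) : ∃ C : ℝ≥0∞, C ≠ ⊤ ∧ ∀ n : ℕ, 1 ≤ n → ∀ u, Wiener u →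
    sobolevNorm q (interp n u - u) ≤ C * (n : ℝ≥0∞)⁻¹ * sobolevNorm (q + 1) u := by
  obtain ⟨C, hC, hC2⟩ := exists_sq_eq (ENNReal.mul_ne_top (ENNReal.add_ne_top.mpr
    ⟨aliasConst_ne_top hq, ENNReal.one_ne_top⟩) (by simp : (2 + 1 : ℝ≥0∞) ≠ ⊤))
  refine ⟨C, hC, fun n hn u hu => sobolevNorm_le_of_nsq ?_⟩
  have hn0 : (n : ℝ≥0∞) ≠ 0 := by simp; omega
  -- The matrix of P_n − 1 vanishes in columns |m| < n. In the remaining columns the extra order of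
  -- smoothness is worth n⁻² in the squared norm.
  let K : ℤ → ℤ → ℝ≥0∞ := fun l m =>
    if (n : ℤ) ≤ |m| then aliasInd n l m + (if l = m then 1 else 0) else 0
  have hKle : ∀ l m, K l m ≤ aliasInd n l m + (if l = m then 1 else 0) := by
    intro l m
    simp only [K]
    split_ifs <;> simp
  rw [mul_pow, hC2, mul_right_comm (aliasConst q + 1), nsq, nsq]
  refine schur (K := K) (wt_ne_zero _) (wt_ne_top _) ?_ ?_ ?_
  · intro l
    have h1 := hat_interp hn hu l
    have h2 : HasSum (fun m => (if l = m then 1 else 0) * hat u m) (hat u l) := by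
      have := hasSum_single (f := fun m => (if l = m then 1 else 0) * hat u m) l
        fun m hm => by simp [hm.symm]
      simpa using this
    have h3 := h1.sub h2
    rw [← ((interp_wiener hn u).1.sub' hu).2] at h3
    refine (enorm_le_of_hasSum h3).trans (ENNReal.tsum_le_tsum fun m => ?_)
    rw [← sub_mul, enorm_mul]
    gcongr
    simp only [K]
    by_cases hm : (n : ℤ) ≤ |m|
    · rw [if_pos hm]
      refine (enorm_sub_le).trans ?_
      gcongr
      · exact enorm_aliasMat_le n l m
      · split_ifs <;> simp
    · rw [if_neg hm]
      by_cases hlm : l = m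
      · subst hlm
        simp [aliasMat, freqWt, not_le.mp hm]
      · rw [if_neg hlm, sub_zero]
        refine (enorm_aliasMat_le n l m).trans (le_of_eq ?_)
        rw [aliasInd, if_neg]
        rintro ⟨h4, h5⟩
        exact hm (le_abs_of_dvd h4 h5 (Ne.symm hlm))
  · intro l
    have hnR : (0 : ℝ) < n := by exact_mod_cast hn
    have hterm : ∀ m, K l m * (wt (q + 1) m)⁻¹ ≤
        ((n : ℝ≥0∞)⁻¹) ^ 2 * ((aliasInd n l m + (if l = m then 1 else 0)) * (wt q m)⁻¹) := by
      intro m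
      by_cases hm : (n : ℤ) ≤ |m|
      · simp only [K, if_pos hm]
        rw [mul_left_comm]
        gcongr
        rw [wt_inv, wt_inv, neg_add, wt_add, mul_comm]
        gcongr
        rw [wt, ← ENNReal.ofReal_natCast, ← ENNReal.ofReal_inv_of_pos hnR,
          ← ENNReal.ofReal_pow (by positivity)]
        apply ENNReal.ofReal_le_ofReal
        rw [Real.rpow_neg_one, inv_pow]
        apply inv_anti₀ (by positivity)
        have : (n : ℝ) ≤ |(m : ℝ)| := by exact_mod_cast hm
        have := pow_le_pow_left₀ hnR.le this 2
        rw [sq_abs] at this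
        linarith
      · simp [K, hm]
    calc wt q l * ∑' m, K l m * (wt (q + 1) m)⁻¹
        ≤ wt q l * ∑' m, ((n : ℝ≥0∞)⁻¹) ^ 2 *
          ((aliasInd n l m + (if l = m then 1 else 0)) * (wt q m)⁻¹) := by
          exact mul_le_mul' le_rfl (ENNReal.tsum_le_tsum hterm)
      _ = (wt q l * ∑' m, aliasInd n l m * (wt q m)⁻¹ + wt q l * (wt q l)⁻¹) *
          ((n : ℝ≥0∞)⁻¹) ^ 2 := by
          rw [ENNReal.tsum_mul_left]
          simp only [add_mul, ENNReal.tsum_add, ite_mul, one_mul, zero_mul]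
          rw [tsum_eq_single l fun m hm => if_neg (Ne.symm hm), if_pos rfl]
          ring
      _ ≤ (aliasConst q + 1) * ((n : ℝ≥0∞)⁻¹) ^ 2 := by
          gcongr
          · exact aliasInd_row hq hn l
          · exact ENNReal.mul_inv_le_one _
  · intro m
    calc ∑' l, K l m ≤ ∑' l, (aliasInd n l m + (if l = m then 1 else 0)) :=
          ENNReal.tsum_le_tsum fun l => hKle l m
      _ ≤ 2 + 1 := by
          rw [ENNReal.tsum_add]
          gcongr
          · exact tsum_aliasInd_le n hn m
          · rw [tsum_ite_eq]

/-! ### Aliasing of multipliers -/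

/-- `T` is the Fourier multiplier with symbol `τ`. -/
def IsMult (T : Op) (τ : ℤ → ℂ) : Prop :=
  ∀ u, Wiener u → Wiener (T u) ∧ ∀ m, hat (T u) m = τ m * hat u m

/-- Even symbols of order `-1` that are nearly invariant under aliasing. -/
structure TameSymbol (τ : ℤ → ℂ) : Prop where
  even : ∀ m, τ (-m) = τ m
  decay : ∃ c : ℝ, ∀ m : ℤ, ‖τ m‖ ≤ c * (1 + (m : ℝ) ^ 2) ^ (-1 / 2 : ℝ)
  alias_le : ∃ c : ℝ, 0 ≤ c ∧ ∀ n : ℕ, 1 ≤ n → ∀ l m s : ℤ, |l| ≤ n → |s| ≤ n →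
    (2 * n : ℤ) ∣ m - l → ‖τ l - τ m‖ ≤ c * (1 + ((m - s : ℤ) : ℝ) ^ 2) / (n : ℝ) ^ 2

/-- For |s| ≤ n these say that a small m − s forces |m|, and therefore |l|, to be close to n. This
is the geometry behind the cancellation of aliased symbols. -/
lemma alias_facts {n : ℕ} {l m s : ℤ} (hl : |l| ≤ n) (hs : |s| ≤ n)
    (hd : (2 * n : ℤ) ∣ m - l) (hm : m ≠ l) :
    n ≤ |(m : ℝ)| ∧ 2 * n ≤ |(m : ℝ)| + |(l : ℝ)| ∧ |(m : ℝ)| - n ≤ |((m - s : ℤ) : ℝ)| := by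
  refine ⟨by exact_mod_cast le_abs_of_dvd hl hd hm, ?_, ?_⟩
  · have h1 : (2 * n : ℤ) ≤ |m - l| :=
      Int.le_of_dvd (abs_pos.mpr (sub_ne_zero.mpr hm)) ((dvd_abs _ _).mpr hd)
    have h2 := abs_sub m l
    exact_mod_cast h1.trans h2
  · have h1 := abs_sub_abs_le_abs_sub m s
    have : |m| - n ≤ |m - s| := by omega
    exact_mod_cast this

lemma sym_decay (m : ℤ) : sym m ≤ 2 * (1 + (m : ℝ) ^ 2) ^ (-1 / 2 : ℝ) := by
  rw [neg_div, Real.rpow_neg (one_add_sq_pos m).le, ← Real.sqrt_eq_rpow, sym]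
  rcases eq_or_ne m 0 with rfl | h
  · simp
  · have h1 : (1 : ℝ) ≤ |(m : ℝ)| := by exact_mod_cast Int.one_le_abs h
    have h2 : Real.sqrt (1 + (m : ℝ) ^ 2) ≤ 2 * |(m : ℝ)| := by
      rw [Real.sqrt_le_left (by positivity), mul_pow, sq_abs]
      rw [← sq_abs]
      nlinarith
    rw [← div_eq_mul_inv, inv_le_comm₀ (by positivity) (by positivity), inv_div]
    linarith

/-- With k = |m − s|, `alias_facts` gives |m| − |l| ≤ 2k, n/|m| ≤ 1 and n/|l| ≤ 1 + 2k, and 1/|l| −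
1/|m| = (|m| − |l|)/(|l||m|). -/
lemma tameSymbol_sym : TameSymbol fun m => (sym m : ℂ) where
  even m := by simp [sym]
  decay := ⟨2, fun m => by
    rw [Complex.norm_real, Real.norm_of_nonneg (sym_nonneg m)]
    exact sym_decay m⟩
  alias_le := by
    -- The product of the three bounds is 2k(1 + 2k), which is at most 6(1 + k²).
    refine ⟨6, by norm_num, fun n hn l m s hl hs hd => ?_⟩
    rw [← Complex.ofReal_sub, Complex.norm_real, Real.norm_eq_abs]
    have hnR : (1 : ℝ) ≤ n := by exact_mod_cast hn
    rcases eq_or_ne m l with rfl | hm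
    · rw [sub_self, abs_zero]
      positivity
    obtain ⟨h1, h2, h3⟩ := alias_facts hl hs hd hm
    have hlR : |(l : ℝ)| ≤ n := by exact_mod_cast hl
    rw [← sq_abs ((m - s : ℤ) : ℝ)]
    set k := |((m - s : ℤ) : ℝ)|
    have hk0 : 0 ≤ k := abs_nonneg _
    simp only [sym]
    set a := |(l : ℝ)|
    set b := |(m : ℝ)|
    rw [le_div_iff₀ (by positivity)]
    have hb : 0 < b := by linarith
    have hbn : b⁻¹ * n ≤ 1 := by
      rw [inv_mul_le_iff₀ hb]; linarith
    -- At l = 0 the symbol is 0 by convention, so there is no quotient to compare; instead |m| ≥ 2n,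
    -- hence k ≥ n.
    rcases eq_or_ne l 0 with hl0 | hl0
    · have ha : a = 0 := by simp [a, hl0]
      rw [ha] at h2 ⊢
      rw [inv_zero, zero_sub, abs_neg, abs_of_nonneg (by positivity)]
      have : (n : ℝ) ≤ k := by linarith
      nlinarith
    · have ha : 1 ≤ a := by
        simp only [a]
        exact_mod_cast Int.one_le_abs hl0
      have ha0 : 0 < a := by linarith
      have h4 : b⁻¹ ≤ a⁻¹ := inv_anti₀ ha0 (by linarith)
      rw [abs_of_nonneg (by linarith)]
      have h5 : a⁻¹ * n ≤ 1 + 2 * k := by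
        rw [inv_mul_le_iff₀ ha0]
        nlinarith
      have h6 : a⁻¹ - b⁻¹ = (b - a) * (a⁻¹ * b⁻¹) := by
        field_simp
      have h7 : (a⁻¹ - b⁻¹) * (n : ℝ) ^ 2 = (b - a) * ((a⁻¹ * n) * (b⁻¹ * n)) := by
        rw [h6]; ring
      rw [h7]
      have h8 : (a⁻¹ * n) * (b⁻¹ * n) ≤ (1 + 2 * k) * 1 :=
        mul_le_mul h5 hbn (by positivity) (by positivity)
      have h9 : (b - a) * ((a⁻¹ * n) * (b⁻¹ * n)) ≤ (2 * k) * ((1 + 2 * k) * 1) :=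
        mul_le_mul (by linarith) h8 (by positivity) (by positivity)
      nlinarith [sq_nonneg (k - 1)]

/-- For distinct aliases the symbols differ only when l = 0; then |m| ≥ 2n, so |m − s| ≥ n and the
bound exceeds 1. -/
lemma tameSymbol_dirac : TameSymbol fun m => (dirac m : ℂ) where
  even m := by simp [dirac]
  decay := ⟨1, fun m => by
    rw [Complex.norm_real, dirac]
    split_ifs with h
    · simp [h]
    · simp only [norm_zero, one_mul]
      positivity⟩
  alias_le := by
    refine ⟨1, by norm_num, fun n hn l m s hl hs hd => ?_⟩
    rw [← Complex.ofReal_sub, Complex.norm_real, Real.norm_eq_abs]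
    have hnR : (1 : ℝ) ≤ n := by exact_mod_cast hn
    rcases eq_or_ne m l with rfl | hm
    · rw [sub_self, abs_zero]
      positivity
    obtain ⟨h1, h2, h3⟩ := alias_facts hl hs hd hm
    have hm0 : m ≠ 0 := by
      rintro rfl
      simp at h1
      omega
    rw [← sq_abs ((m - s : ℤ) : ℝ)]
    simp only [dirac, if_neg hm0, sub_zero]
    split_ifs with hl0
    · rw [hl0] at h2
      simp only [Int.cast_zero, abs_zero, add_zero] at h2
      rw [abs_one, le_div_iff₀ (by positivity)]
      have : (n : ℝ) ≤ |((m - s : ℤ) : ℝ)| := by linarith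
      nlinarith
    · rw [abs_zero]
      positivity

/-- Evenness is what keeps the coefficients at n and −n equal, the condition that excludes sin(nt).
-/
lemma IsMult.inX {T : Op} {τ : ℤ → ℂ} (hT : IsMult T τ) (hτ : ∀ m, τ (-m) = τ m) {n : ℕ}
    {u : ℝ → ℂ} (hu : InX n u) : InX n (T u) := by
  have h := hT u hu.wiener
  exact ⟨h.1, fun m hm => by rw [h.2, hu.vanish m hm, mul_zero],
    by rw [h.2, h.2, hτ, hu.symm]⟩

/-- The powers of n balance: n^(2q+2) from the weight at l, n⁻² from D, and n^(−2q) from the weight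
at s, the last through `peetre` and |m| ≥ n. Only a power of m − s remains. -/
lemma alias_weight {q c D : ℝ} (hq : 0 ≤ q) {n : ℕ} (hn : 1 ≤ n) {l m s : ℤ}
    (hl : |l| ≤ n) (hnm : (n : ℤ) ≤ |m|)
    (hD : D ≤ c * (1 + ((m - s : ℤ) : ℝ) ^ 2) / (n : ℝ) ^ 2) (hc : 0 ≤ c) :
    (1 + (l : ℝ) ^ 2) ^ (q + 1) * D * (1 + (s : ℝ) ^ 2) ^ (-q) ≤
      (c * 2 ^ (q + 1) * 2 ^ q) * (1 + ((m - s : ℤ) : ℝ) ^ 2) ^ (q + 1) := by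
  have hnR : (1 : ℝ) ≤ n := by exact_mod_cast hn
  have hlR : |(l : ℝ)| ≤ n := by exact_mod_cast hl
  have hmR : n ≤ |(m : ℝ)| := by exact_mod_cast hnm
  set w := 1 + ((m - s : ℤ) : ℝ) ^ 2 with hw
  set v := 1 + (s : ℝ) ^ 2 with hv
  have hw0 : 0 < w := by positivity
  have hv0 : 0 < v := by positivity
  have h1 : (1 + (l : ℝ) ^ 2) ^ (q + 1) ≤ (2 * (n : ℝ) ^ 2) ^ (q + 1) := by
    apply Real.rpow_le_rpow (by positivity) _ (by linarith)
    rw [← sq_abs (l : ℝ)]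
    have := pow_le_pow_left₀ (abs_nonneg _) hlR 2
    nlinarith
  have h2 : ((n : ℝ) ^ 2) ^ q ≤ (2 * w * v) ^ q := by
    apply Real.rpow_le_rpow (by positivity) _ hq
    have h3 := peetre m s
    have h4 := pow_le_pow_left₀ (by positivity) hmR 2
    rw [sq_abs] at h4
    rw [hw, hv]
    push_cast
    linarith
  have h3 : (1 : ℝ) ≤ v ^ q * (2 ^ q * w ^ q * ((n : ℝ) ^ 2) ^ (-q)) := by
    rw [Real.mul_rpow (by positivity) hv0.le, Real.mul_rpow (by positivity) hw0.le] at h2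
    have h4 : ((n : ℝ) ^ 2) ^ q * ((n : ℝ) ^ 2) ^ (-q) = 1 := by
      rw [← Real.rpow_add (by positivity)]; simp
    have h5 : (0 : ℝ) ≤ ((n : ℝ) ^ 2) ^ (-q) := by positivity
    nlinarith [mul_le_mul_of_nonneg_right h2 h5]
  have h4 : v ^ (-q) ≤ 2 ^ q * w ^ q * ((n : ℝ) ^ 2) ^ (-q) := by
    rw [Real.rpow_neg hv0.le, inv_le_iff_one_le_mul₀' (by positivity)]
    exact h3
  calc (1 + (l : ℝ) ^ 2) ^ (q + 1) * D * v ^ (-q)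
      ≤ (1 + (l : ℝ) ^ 2) ^ (q + 1) * (c * w / (n : ℝ) ^ 2) * v ^ (-q) := by gcongr
    _ ≤ (2 * (n : ℝ) ^ 2) ^ (q + 1) * (c * w / (n : ℝ) ^ 2) *
          (2 ^ q * w ^ q * ((n : ℝ) ^ 2) ^ (-q)) := by gcongr
    _ = (c * 2 ^ (q + 1) * 2 ^ q) * w ^ (q + 1) := by
      have h5 : ((n : ℝ) ^ 2) ^ (q + 1) = ((n : ℝ) ^ 2) ^ q * (n : ℝ) ^ 2 := by
        rw [Real.rpow_add (by positivity), Real.rpow_one]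
      have h6 : w ^ (q + 1) = w ^ q * w := by rw [Real.rpow_add hw0, Real.rpow_one]
      have h7 : ((n : ℝ) ^ 2) ^ q * ((n : ℝ) ^ 2) ^ (-q) = 1 := by
        rw [← Real.rpow_add (by positivity)]; simp
      rw [Real.mul_rpow (by positivity) (by positivity), h5, h6]
      field_simp
      linear_combination c * h7

/-- The interpolant of `T (P_n - 1) f φ` gains one order of smoothness and a factor `1/n`
for `φ ∈ X_n`: aliased frequencies cancel at the nodes. -/
lemma alias_error {T : Op} {τ : ℤ → ℂ} (hT : IsMult T τ) (hτ : TameSymbol τ) {f : ℝ → ℂ}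
    (hf : Rapid f) {q : ℝ} (hq : 0 ≤ q) : ∃ C : ℝ≥0∞, C ≠ ⊤ ∧ ∀ n : ℕ, 1 ≤ n → ∀ φ, InX n φ →
    sobolevNorm (q + 1) (interp n (T (interp n (f * φ)) - T (f * φ))) ≤
      C * (n : ℝ≥0∞)⁻¹ * sobolevNorm q φ := by
  obtain ⟨c, hc, hcτ⟩ := hτ.alias_le
  set g : ℤ → ℝ≥0∞ := fun k => wt (q + 1) k * ‖hat f k‖ₑ
  set g₁ : ℤ → ℝ≥0∞ := fun k => wt 1 k * ‖hat f k‖ₑ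
  set c₁ := ENNReal.ofReal (c * 2 ^ (q + 1) * 2 ^ q)
  set c₂ := ENNReal.ofReal c
  have hA : c₁ * (2 * ∑' k, g k) ≠ ⊤ :=
    ENNReal.mul_ne_top ENNReal.ofReal_ne_top (ENNReal.mul_ne_top (by simp) (hf.decay _))
  have hB : c₂ * (2 * ∑' k, g₁ k) ≠ ⊤ :=
    ENNReal.mul_ne_top ENNReal.ofReal_ne_top (ENNReal.mul_ne_top (by simp) (hf.decay _))
  obtain ⟨C, hC, hC2⟩ := exists_sq_eq (ENNReal.mul_ne_top hA hB)
  refine ⟨C, hC, fun n hn φ hφ => sobolevNorm_le_of_nsq ?_⟩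
  have hnR : (0 : ℝ) < n := by exact_mod_cast hn
  have hu := hf.wiener.mul' hφ.wiener
  set u := f * φ
  -- Here s is a frequency of φ, m one of fφ, and l the alias of m in the window. The cut-off |s| ≤
  -- n costs nothing because φ is in X_n.
  let H : ℤ → ℤ → ℤ → ℝ≥0∞ := fun l s m =>
    if |s| ≤ n then aliasInd n l m * ‖τ l - τ m‖ₑ * ‖hat f (m - s)‖ₑ else 0
  rw [mul_pow, hC2, mul_assoc (c₁ * (2 * ∑' k, g k)), nsq, nsq]
  refine schur (K := fun l s => ∑' m, H l s m) (wt_ne_zero _) (wt_ne_top _) ?_ ?_ ?_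
  · intro l
    -- The first term already lies in X_n, so the outer interpolation leaves it alone; both terms
    -- then involve the same aliased coefficients, with τ_l against τ_m.
    have hX : InX n (T (interp n u)) := hT.inX hτ.even (inX_interp hn u)
    have h1 := hat_interp hn (hT u hu.1).1 l
    have h2 := (hat_interp hn hu.1 l).mul_left (τ l)
    rw [← (hT _ (inX_interp hn u).wiener).2] at h2
    have h3 := h2.sub h1
    rw [interp_sub, hX.interp_eq hn, (hX.wiener.sub' (interp_wiener hn _).1).2]
    refine (enorm_le_of_hasSum h3).trans ?_
    calc ∑' m, ‖τ l * (aliasMat n l m * hat u m) - aliasMat n l m * hat (T u) m‖ₑ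
        ≤ ∑' m, ∑' s, H l s m * ‖hat φ s‖ₑ := by
          refine ENNReal.tsum_le_tsum fun m => ?_
          rw [(hT u hu.1).2, show τ l * (aliasMat n l m * hat u m) -
            aliasMat n l m * (τ m * hat u m) = aliasMat n l m * (τ l - τ m) * hat u m by ring,
            enorm_mul, enorm_mul]
          calc ‖aliasMat n l m‖ₑ * ‖τ l - τ m‖ₑ * ‖hat u m‖ₑ
              ≤ aliasInd n l m * ‖τ l - τ m‖ₑ * ∑' s, ‖hat f (m - s) * hat φ s‖ₑ := by
                gcongr
                · exact enorm_aliasMat_le n l m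
                · exact enorm_le_of_hasSum (hu.2 m)
            _ ≤ _ := by
                rw [← ENNReal.tsum_mul_left]
                refine ENNReal.tsum_le_tsum fun s => ?_
                simp only [H]
                split_ifs with hs
                · rw [enorm_mul, mul_assoc _ ‖hat f (m - s)‖ₑ]
                · rw [hφ.vanish s (by omega)]
                  simp
      _ = ∑' s, (∑' m, H l s m) * ‖hat φ s‖ₑ := by
          rw [ENNReal.tsum_comm]
          simp only [ENNReal.tsum_mul_right]
  · intro l
    -- With k = m − s fixed, the congruence of m and l becomes one of s and l − k. So at most two s
    -- belong to each k, and the row sum is controlled by the decay of f.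
    have hterm : ∀ s m, wt (q + 1) l * (H l s m * (wt q s)⁻¹) ≤
        c₁ * (aliasInd n s (l - (m - s)) * g (m - s)) := by
      intro s m
      by_cases hs : |s| ≤ n
      swap
      · simp [H, hs]
      by_cases hl : |l| ≤ n ∧ (2 * n : ℤ) ∣ m - l
      swap
      · simp [H, aliasInd, hl]
      by_cases hm : m = l
      · simp [H, hm]
      have hind : aliasInd n s (l - (m - s)) = 1 := by
        have hd : (2 * n : ℤ) ∣ l - (m - s) - s := by
          rw [show l - (m - s) - s = -(m - l) by ring]
          exact (dvd_neg).mpr hl.2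
        rw [aliasInd, if_pos ⟨hs, hd⟩]
      rw [hind]
      simp only [H, if_pos hs, aliasInd, if_pos hl, one_mul, g]
      have hD := hcτ n hn l m s hl.1 hs hl.2
      have h := alias_weight hq hn hl.1 (le_abs_of_dvd hl.1 hl.2 hm) hD hc
      have h' := ENNReal.ofReal_le_ofReal h
      rw [ENNReal.ofReal_mul (by positivity), ENNReal.ofReal_mul (by positivity),
        ENNReal.ofReal_mul (by positivity), ofReal_norm] at h'
      calc wt (q + 1) l * (‖τ l - τ m‖ₑ * ‖hat f (m - s)‖ₑ * (wt q s)⁻¹)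
          = (wt (q + 1) l * ‖τ l - τ m‖ₑ * wt (-q) s) * ‖hat f (m - s)‖ₑ := by
            rw [wt_inv]; ring
        _ ≤ (c₁ * wt (q + 1) (m - s)) * ‖hat f (m - s)‖ₑ := by
            exact mul_le_mul' h' le_rfl
        _ = _ := by ring
    calc wt (q + 1) l * ∑' s, (∑' m, H l s m) * (wt q s)⁻¹
        = ∑' s, ∑' m, wt (q + 1) l * (H l s m * (wt q s)⁻¹) := by
          simp only [← ENNReal.tsum_mul_left, ← ENNReal.tsum_mul_right]
      _ ≤ ∑' s, ∑' m, c₁ * (aliasInd n s (l - (m - s)) * g (m - s)) :=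
          ENNReal.tsum_le_tsum fun s => ENNReal.tsum_le_tsum fun m => hterm s m
      _ = c₁ * ∑' k, (∑' s, aliasInd n s (l - k)) * g k := by
          simp only [ENNReal.tsum_mul_left]
          congr 1
          simp only [← ENNReal.tsum_mul_right]
          rw [ENNReal.tsum_comm (f := fun k s => aliasInd n s (l - k) * g k)]
          exact tsum_congr fun s => tsum_sub_right (fun k => aliasInd n s (l - k) * g k) s
      _ ≤ c₁ * ∑' k, 2 * g k := by
          gcongr with k
          exact tsum_aliasInd_le n hn _
      _ = _ := by rw [ENNReal.tsum_mul_left]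
  · intro s
    -- The row bound used its n⁻² against the extra order of weight; the column bound keeps its n⁻²,
    -- which is the square of the rate 1/n.
    have hterm : ∀ l m, H l s m ≤ c₂ * ((n : ℝ≥0∞)⁻¹) ^ 2 * (aliasInd n l m * g₁ (m - s)) := by
      intro l m
      by_cases hs : |s| ≤ n
      swap
      · simp [H, hs]
      by_cases hl : |l| ≤ n ∧ (2 * n : ℤ) ∣ m - l
      swap
      · simp [H, aliasInd, hl]
      simp only [H, if_pos hs, aliasInd, if_pos hl, one_mul, g₁]
      have hD := ENNReal.ofReal_le_ofReal (hcτ n hn l m s hl.1 hs hl.2)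
      rw [ofReal_norm, div_eq_mul_inv, ENNReal.ofReal_mul (by positivity),
        ENNReal.ofReal_mul (by positivity), ENNReal.ofReal_inv_of_pos (by positivity),
        ENNReal.ofReal_pow (by positivity), ENNReal.ofReal_natCast] at hD
      calc ‖τ l - τ m‖ₑ * ‖hat f (m - s)‖ₑ
          ≤ (c₂ * ENNReal.ofReal (1 + ((m - s : ℤ) : ℝ) ^ 2) * ((n : ℝ≥0∞) ^ 2)⁻¹) *
            ‖hat f (m - s)‖ₑ := by gcongr
        _ = _ := by
          rw [wt, Real.rpow_one, ENNReal.inv_pow]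
          ring
    calc ∑' l, ∑' m, H l s m
        ≤ ∑' l, ∑' m, c₂ * ((n : ℝ≥0∞)⁻¹) ^ 2 * (aliasInd n l m * g₁ (m - s)) :=
          ENNReal.tsum_le_tsum fun l => ENNReal.tsum_le_tsum fun m => hterm l m
      _ = c₂ * ((n : ℝ≥0∞)⁻¹) ^ 2 * ∑' m, (∑' l, aliasInd n l m) * g₁ (m - s) := by
          simp only [ENNReal.tsum_mul_left]
          rw [ENNReal.tsum_comm]
          simp only [ENNReal.tsum_mul_right]
      _ ≤ c₂ * ((n : ℝ≥0∞)⁻¹) ^ 2 * ∑' m, 2 * g₁ (m - s) := by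
          gcongr with m
          exact tsum_aliasInd_le n hn _
      _ = _ := by
          rw [ENNReal.tsum_mul_left, tsum_sub_right]
          ring

/-! ### Smooth periodic functions -/

lemma hat_deriv {f : ℝ → ℂ} (hf : ContDiff ℝ (⊤ : ℕ∞) f) (hp : Function.Periodic f (2 * Real.pi))
    (m : ℤ) : hat (deriv f) m = Complex.I * m * hat f m := by
  have hc : Continuous (deriv f) := hf.continuous_deriv (by simp)
  have hd : ∀ x, HasDerivAt f (deriv f x) x := fun x =>
    (hf.differentiable (by simp) x).hasDerivAt
  have hper : f (2 * Real.pi) = f 0 := by simpa using hp 0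
  have hpi : (Real.pi : ℂ) ≠ 0 := by exact_mod_cast Real.pi_ne_zero
  rcases eq_or_ne m 0 with rfl | hm
  · rw [hat_eq]
    simp only [neg_zero, expi_zero, one_mul]
    rw [intervalIntegral.integral_eq_sub_of_hasDerivAt (fun x _ => hd x)
      (hc.intervalIntegrable _ _), hper]
    simp
  · have hm' : (m : ℂ) ≠ 0 := by exact_mod_cast hm
    have hI := Complex.I_ne_zero
    have h := fourierCoeffOn_of_hasDerivAt Real.two_pi_pos hm (fun x _ => hd x)
      (hc.intervalIntegrable _ _)
    rw [hper, sub_self, mul_zero, zero_sub] at h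
    simp only [hat]
    rw [h]
    push_cast
    field_simp
    ring

lemma contDiff_deriv {f : ℝ → ℂ} (hf : ContDiff ℝ (⊤ : ℕ∞) f) :
    ContDiff ℝ (⊤ : ℕ∞) (deriv f) := by
  have := hf.iterate_deriv 1
  simpa using this

lemma periodic_deriv {E : Type*} [NormedAddCommGroup E] [NormedSpace ℝ E] {f : ℝ → E} {c : ℝ}
    (hp : Function.Periodic f c) : Function.Periodic (deriv f) c := fun x => by
  rw [← deriv_comp_add_const]
  congr 1
  funext y
  exact hp y

/-- Each derivative multiplies the m-th coefficient by im, the boundary terms cancelling by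
periodicity; then the sup bound is applied to the k-th derivative. -/
lemma hat_decay (k : ℕ) : ∀ f : ℝ → ℂ, ContDiff ℝ (⊤ : ℕ∞) f → Function.Periodic f (2 * Real.pi) →
    ∃ M : ℝ, ∀ m : ℤ, |(m : ℝ)| ^ k * ‖hat f m‖ ≤ M := by
  induction k with
  | zero =>
    intro f hf _
    obtain ⟨M, hM⟩ := (isCompact_Icc (a := (0 : ℝ)) (b := 2 * Real.pi)).exists_bound_of_continuousOn
      hf.continuous.continuousOn
    refine ⟨‖(1 / (2 * Real.pi) : ℂ)‖ * (M * |2 * Real.pi - 0|), fun m => ?_⟩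
    rw [pow_zero, one_mul, hat_eq, norm_mul]
    gcongr
    apply intervalIntegral.norm_integral_le_of_norm_le_const
    intro x hx
    rw [norm_mul, norm_expi, one_mul]
    rw [Set.uIoc_of_le Real.two_pi_pos.le] at hx
    exact hM x ⟨hx.1.le, hx.2⟩
  | succ k ih =>
    intro f hf hp
    obtain ⟨M, hM⟩ := ih (deriv f) (contDiff_deriv hf) (periodic_deriv hp)
    refine ⟨M, fun m => ?_⟩
    have := hM m
    rw [hat_deriv hf hp, norm_mul, norm_mul, Complex.norm_I, one_mul, Complex.norm_intCast] at this
    rw [pow_succ, mul_assoc]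
    exact this

/-- The function descends to the circle, where summable coefficients give pointwise convergence of
the Fourier series. -/
lemma wiener_of_summable {f : ℝ → ℂ} (hf : Continuous f) (hp : Function.Periodic f (2 * Real.pi))
    (hs : Summable fun m => ‖hat f m‖) : Wiener f := by
  refine ⟨hs, fun t => ?_⟩
  have : Fact (0 < 2 * Real.pi) := ⟨Real.two_pi_pos⟩
  let F : C(AddCircle (2 * Real.pi), ℂ) := ⟨hp.lift, continuous_coinduced_dom.mpr hf⟩
  have hexp : ∀ (m : ℤ) (x : ℝ), fourier m (x : AddCircle (2 * Real.pi)) = expi m x := by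
    intro m x
    have hpi : (Real.pi : ℂ) ≠ 0 := by exact_mod_cast Real.pi_ne_zero
    rw [fourier_coe_apply, expi]
    congr 1
    push_cast
    field_simp
  have hco : ∀ m, fourierCoeff F m = hat f m := by
    intro m
    rw [fourierCoeff_eq_intervalIntegral F m 0, hat_eq, zero_add, Complex.real_smul]
    congr 1
    · push_cast; rfl
    · apply intervalIntegral.integral_congr
      intro x _
      simp only [hexp, smul_eq_mul]
      rfl
  have := has_pointwise_sum_fourier_series_of_summable (f := F)
    (by simpa only [funext hco] using hs.of_norm) (t : AddCircle (2 * Real.pi))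
  simp only [hco, hexp, smul_eq_mul] at this
  exact this

lemma summable_inv_one_add_sq : Summable fun m : ℤ => (1 + (m : ℝ) ^ 2)⁻¹ := by
  have h1 := Real.summable_abs_int_rpow (b := 2) (by norm_num)
  have h2 : Summable fun m : ℤ => if m = 0 then (1 : ℝ) else 0 :=
    summable_of_ne_finset_zero (s := {0}) fun m hm => by simpa using hm
  refine Summable.of_nonneg_of_le (fun m => by positivity) (fun m => ?_) (h2.add h1)
  split_ifs with h
  · simp [h]
  · have : 0 < |(m : ℝ)| := by simpa using h
    rw [zero_add, Real.rpow_neg this.le, show (2 : ℝ) = (2 : ℕ) by norm_num, Real.rpow_natCast,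
      sq_abs]
    have : (0 : ℝ) < (m : ℝ) ^ 2 := by positivity
    exact inv_anti₀ this (by linarith)

lemma Rapid.of_contDiff {f : ℝ → ℂ} (hf : ContDiff ℝ (⊤ : ℕ∞) f)
    (hp : Function.Periodic f (2 * Real.pi)) : Rapid f := by
  have key : ∀ r : ℝ, Summable fun m : ℤ => (1 + (m : ℝ) ^ 2) ^ r * ‖hat f m‖ := by
    intro r
    -- The surplus of one over r leaves a factor (1 + m²)⁻¹, which makes the series summable.
    obtain ⟨K, hK⟩ := exists_nat_ge (r + 1)
    obtain ⟨M₀, hM₀⟩ := hat_decay 0 f hf hp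
    obtain ⟨M₁, hM₁⟩ := hat_decay (2 * K) f hf hp
    refine Summable.of_nonneg_of_le (fun m => by positivity) (fun m => ?_)
      (summable_inv_one_add_sq.mul_left (2 ^ K * (M₀ + M₁)))
    have hw := one_add_sq_pos m
    have h1 : (1 + (m : ℝ) ^ 2) ^ r ≤ (1 + (m : ℝ) ^ 2) ^ K * (1 + (m : ℝ) ^ 2)⁻¹ := by
      rw [← Real.rpow_natCast _ K, ← Real.rpow_neg_one, ← Real.rpow_add hw]
      exact Real.rpow_le_rpow_of_exponent_le (by nlinarith [sq_nonneg (m : ℝ)]) (by linarith)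
    have h2 : (1 + (m : ℝ) ^ 2) ^ K ≤ 2 ^ K * (1 + |(m : ℝ)| ^ (2 * K)) := by
      rw [pow_mul, sq_abs]
      rcases le_total ((m : ℝ) ^ 2) 1 with h | h
      · calc (1 + (m : ℝ) ^ 2) ^ K ≤ 2 ^ K := by gcongr; linarith
          _ ≤ _ := by
            have : (0 : ℝ) ≤ 2 ^ K * ((m : ℝ) ^ 2) ^ K := by positivity
            linarith
      · calc (1 + (m : ℝ) ^ 2) ^ K ≤ (2 * (m : ℝ) ^ 2) ^ K := by gcongr; linarith
          _ ≤ _ := by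
            rw [mul_pow]
            have : (0 : ℝ) ≤ 2 ^ K := by positivity
            linarith
    have h3 : (1 + |(m : ℝ)| ^ (2 * K)) * ‖hat f m‖ ≤ M₀ + M₁ := by
      have a := hM₀ m
      have b := hM₁ m
      rw [pow_zero, one_mul] at a
      linarith
    calc (1 + (m : ℝ) ^ 2) ^ r * ‖hat f m‖
        ≤ (2 ^ K * (1 + |(m : ℝ)| ^ (2 * K))) * (1 + (m : ℝ) ^ 2)⁻¹ * ‖hat f m‖ := by
          refine mul_le_mul_of_nonneg_right (h1.trans ?_) (norm_nonneg _)
          gcongr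
      _ = 2 ^ K * (((1 + |(m : ℝ)| ^ (2 * K))) * ‖hat f m‖) * (1 + (m : ℝ) ^ 2)⁻¹ := by ring
      _ ≤ _ := by gcongr
  refine ⟨wiener_of_summable hf.continuous hp (by simpa using key 0), fun r => ?_⟩
  have := (key r).tsum_ofReal_ne_top
  convert this using 3 with m
  rw [ENNReal.ofReal_mul (by positivity), ofReal_norm, wt]

lemma rapid_expi (k : ℤ) : Rapid (expi k) := by
  refine Rapid.of_contDiff ?_ (periodic_expi k)
  have h : ContDiff ℝ (⊤ : ℕ∞) fun t : ℝ => (t : ℂ) := Complex.ofRealCLM.contDiff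
  exact (contDiff_const.mul h).cexp

/-! ### The multipliers built from the curve -/

section curve

variable {γ : ℝ → Plane}

lemma IsAnalyticBoundary.contDiff_dγ (hγ : IsAnalyticBoundary γ) (k : ℕ) :
    ContDiff ℝ (⊤ : ℕ∞) (dγ γ k) := by
  have h : ContDiff ℝ (⊤ : ℕ∞) γ := (contDiff_omega_iff_analyticOnNhd.mpr hγ.analytic).of_le (by simp)
  have := h.iterate_deriv k
  change ContDiff ℝ (⊤ : ℕ∞) (iteratedDeriv k γ)
  rwa [iteratedDeriv_eq_iterate]

lemma IsAnalyticBoundary.periodic_dγ (hγ : IsAnalyticBoundary γ) (k : ℕ) :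
    Function.Periodic (dγ γ k) (2 * Real.pi) := by
  change Function.Periodic (iteratedDeriv k γ) (2 * Real.pi)
  induction k with
  | zero => simpa only [iteratedDeriv_zero] using hγ.periodic
  | succ k ih =>
    rw [iteratedDeriv_succ]
    exact periodic_deriv ih

lemma contDiff_rot {n : WithTop ℕ∞} {f : ℝ → Plane} (hf : ContDiff ℝ n f) :
    ContDiff ℝ n fun t => rot (f t) := by
  rw [contDiff_euclidean] at hf ⊢
  intro i
  fin_cases i
  · simpa [rot] using hf 1
  · simpa [rot] using (hf 0).neg

lemma rapid_ofReal {f : ℝ → ℝ} (hf : ContDiff ℝ (⊤ : ℕ∞) f)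
    (hp : Function.Periodic f (2 * Real.pi)) : Rapid fun t => (f t : ℂ) :=
  Rapid.of_contDiff (Complex.ofRealCLM.contDiff.comp hf) fun t => by simp only [hp t]

lemma contDiff_e₁ (κ : ℝ) (hγ : IsAnalyticBoundary γ) : ContDiff ℝ (⊤ : ℕ∞) (e₁ κ γ) :=
  contDiff_const.mul ((hγ.contDiff_dγ 1).norm_sq ℝ)

lemma contDiff_e₂ (κ : ℝ) (hγ : IsAnalyticBoundary γ) : ContDiff ℝ (⊤ : ℕ∞) (e₂ κ γ) :=
  contDiff_const.mul ((contDiff_rot (hγ.contDiff_dγ 1)).inner ℝ (hγ.contDiff_dγ 2))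

lemma contDiff_e₃ (κ : ℝ) (hγ : IsAnalyticBoundary γ) : ContDiff ℝ (⊤ : ℕ∞) (e₃ κ γ) :=
  contDiff_const.mul ((hγ.contDiff_dγ 1).inner ℝ (hγ.contDiff_dγ 2))

lemma rapid_e₁ (κ : ℝ) (hγ : IsAnalyticBoundary γ) : Rapid fun t => (e₁ κ γ t : ℂ) :=
  rapid_ofReal (contDiff_e₁ κ hγ) fun t => by simp only [e₁, hγ.periodic_dγ _ t]

lemma rapid_e₂ (κ : ℝ) (hγ : IsAnalyticBoundary γ) : Rapid fun t => (e₂ κ γ t : ℂ) :=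
  rapid_ofReal (contDiff_e₂ κ hγ) fun t => by simp only [e₂, hγ.periodic_dγ _ t]

lemma rapid_e₃ (κ : ℝ) (hγ : IsAnalyticBoundary γ) : Rapid fun t => (e₃ κ γ t : ℂ) :=
  rapid_ofReal (contDiff_e₃ κ hγ) fun t => by simp only [e₃, hγ.periodic_dγ _ t]

lemma contDiff_norm_pow_four (hγ : IsAnalyticBoundary γ) : ContDiff ℝ (⊤ : ℕ∞) fun t => ‖dγ γ 1 t‖ ^ 4 := by
  have : (fun t => ‖dγ γ 1 t‖ ^ 4) = fun t => (‖dγ γ 1 t‖ ^ 2) ^ 2 := by funext t; ring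
  rw [this]
  exact ((hγ.contDiff_dγ 1).norm_sq ℝ).pow 2

lemma rapid_e₆ (κ : ℝ) (hγ : IsAnalyticBoundary γ) : Rapid fun t => (e₆ κ γ t : ℂ) := by
  refine rapid_ofReal ?_ fun t => by simp only [e₆, e₄, e₅, hγ.periodic_dγ _ t]
  have h4 := contDiff_norm_pow_four hγ
  have h3 := (hγ.contDiff_dγ 1).inner ℝ (hγ.contDiff_dγ 3)
  exact ((contDiff_const.mul h4).add (contDiff_const.mul h3)).sub
    ((contDiff_const.mul h4).add (contDiff_const.mul h3))

lemma rapid_e₇ (κ : ℝ) (hγ : IsAnalyticBoundary γ) : Rapid fun t => (e₇ κ γ t : ℂ) := by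
  refine rapid_ofReal ?_ fun t => by simp only [e₇, hγ.periodic_dγ _ t]
  exact contDiff_const.mul (((hγ.contDiff_dγ 2).norm_sq ℝ).add
    ((hγ.contDiff_dγ 1).inner ℝ (hγ.contDiff_dγ 3)))

lemma rapid_e₈ (κ : ℝ) (hγ : IsAnalyticBoundary γ) : Rapid fun t => (e₈ κ γ t : ℂ) := by
  refine rapid_ofReal ?_ fun t => by simp only [e₈, hγ.periodic_dγ _ t]
  exact contDiff_const.mul (((contDiff_rot (hγ.contDiff_dγ 1)).inner ℝ (hγ.contDiff_dγ 4)).add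
    ((contDiff_rot (hγ.contDiff_dγ 2)).inner ℝ (hγ.contDiff_dγ 3)))

lemma rapid_e₉ (κ : ℝ) (hγ : IsAnalyticBoundary γ) : Rapid fun t => (e₉ κ γ t : ℂ) := by
  refine rapid_ofReal ?_ fun t => by simp only [e₉, hγ.periodic_dγ _ t]
  exact contDiff_const.mul ((contDiff_rot (hγ.contDiff_dγ 1)).inner ℝ (hγ.contDiff_dγ 3))

lemma rapid_e₁_inv {κ : ℝ} (hκ : 0 < κ) (hγ : IsAnalyticBoundary γ) : Rapid fun t => (((e₁ κ γ t)⁻¹ : ℝ) : ℂ) := by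
  refine rapid_ofReal ((contDiff_e₁ κ hγ).inv fun t => ?_) fun t => by
    simp only [e₁, hγ.periodic_dγ _ t]
  have h1 := hγ.regular t
  have : 0 < e₁ κ γ t := by
    simp only [e₁, dγ, iteratedDeriv_one]
    positivity
  exact this.ne'

end curve

/-! ### Bounded operators and small discretization errors -/

/-- Fourier multipliers of order `-a`. -/
def OrdOp (T : Op) (a : ℝ) : Prop :=
  ∃ τ : ℤ → ℂ, IsMult T τ ∧ ∃ c : ℝ, ∀ m : ℤ, ‖τ m‖ ≤ c * (1 + (m : ℝ) ^ 2) ^ (-a / 2)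

/-- Multipliers with a tame symbol. -/
def TameOp (T : Op) : Prop := ∃ τ : ℤ → ℂ, IsMult T τ ∧ TameSymbol τ

/-- Operators gaining `b` orders of smoothness on the Sobolev space of order `p`. -/
def BddOp (V : Op) (p b : ℝ) : Prop := ∃ C : ℝ≥0∞, C ≠ ⊤ ∧ ∀ u, Wiener u →
  Wiener (V u) ∧ sobolevNorm (p + b) (V u) ≤ C * sobolevNorm p u

/-- Families of operators whose interpolants are `O(1/n)` on `X_n`, from order `q` to order `r`. -/
def Small (q r : ℝ) (X : ℕ → Op) : Prop := ∃ C : ℝ≥0∞, C ≠ ⊤ ∧ ∀ n : ℕ, 1 ≤ n → ∀ φ, InX n φ →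
  Wiener (X n φ) ∧ sobolevNorm r (interp n (X n φ)) ≤ C * (n : ℝ≥0∞)⁻¹ * sobolevNorm q φ

lemma TameOp.ordOp {T : Op} (h : TameOp T) : OrdOp T 1 := by
  obtain ⟨τ, hT, hτ⟩ := h
  exact ⟨τ, hT, hτ.decay⟩

lemma TameOp.inX {T : Op} (h : TameOp T) {n : ℕ} {u : ℝ → ℂ} (hu : InX n u) : InX n (T u) := by
  obtain ⟨τ, hT, hτ⟩ := h
  exact hT.inX hτ.even hu

lemma OrdOp.wiener {T : Op} {a : ℝ} (h : OrdOp T a) {u : ℝ → ℂ} (hu : Wiener u) :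
    Wiener (T u) := by
  obtain ⟨τ, hT, -⟩ := h
  exact (hT u hu).1

lemma OrdOp.map_sub {T : Op} {a : ℝ} (h : OrdOp T a) {u v : ℝ → ℂ} (hu : Wiener u)
    (hv : Wiener v) : T (u - v) = T u - T v := by
  obtain ⟨τ, hT, -⟩ := h
  refine (hT _ (hu.sub hv)).1.ext ((hT u hu).1.sub (hT v hv).1) fun m => ?_
  rw [(hT _ (hu.sub hv)).2, ((hT u hu).1.sub' (hT v hv).1).2, (hu.sub' hv).2, (hT u hu).2,
    (hT v hv).2]
  ring

lemma OrdOp.bound {T : Op} {a : ℝ} (h : OrdOp T a) : ∃ C : ℝ≥0∞, C ≠ ⊤ ∧ ∀ (p : ℝ) (u : ℝ → ℂ),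
    Wiener u → sobolevNorm (p + a) (T u) ≤ C * sobolevNorm p u := by
  obtain ⟨τ, hT, c, hc⟩ := h
  exact ⟨ENNReal.ofReal c, ENNReal.ofReal_ne_top, fun p u hu =>
    sobolevNorm_mult_le (hT u hu).2 hc⟩

lemma OrdOp.bddOp {T : Op} {a : ℝ} (h : OrdOp T a) (p : ℝ) : BddOp T p a := by
  obtain ⟨C, hC, hb⟩ := h.bound
  exact ⟨C, hC, fun u hu => ⟨h.wiener hu, hb p u hu⟩⟩

lemma BddOp.mono {V : Op} {p b b' : ℝ} (h : BddOp V p b) (hb : b' ≤ b) : BddOp V p b' := by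
  obtain ⟨C, hC, h⟩ := h
  exact ⟨C, hC, fun u hu => ⟨(h u hu).1, (sobolevNorm_mono (by linarith) _).trans (h u hu).2⟩⟩

lemma BddOp.add {V W : Op} {p b : ℝ} (hV : BddOp V p b) (hW : BddOp W p b) :
    BddOp (fun u => V u + W u) p b := by
  obtain ⟨C, hC, hV⟩ := hV
  obtain ⟨D, hD, hW⟩ := hW
  refine ⟨C + D, ENNReal.add_ne_top.mpr ⟨hC, hD⟩, fun u hu => ⟨(hV u hu).1.add (hW u hu).1, ?_⟩⟩
  refine (sobolevNorm_add_le _ (hV u hu).1 (hW u hu).1).trans ?_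
  rw [add_mul]
  exact add_le_add (hV u hu).2 (hW u hu).2

lemma BddOp.smul {V : Op} {p b : ℝ} (c : ℂ) (hV : BddOp V p b) :
    BddOp (fun u => c • V u) p b := by
  obtain ⟨C, hC, hV⟩ := hV
  refine ⟨‖c‖ₑ * C, ENNReal.mul_ne_top (by simp) hC, fun u hu => ⟨(hV u hu).1.smul c, ?_⟩⟩
  refine (sobolevNorm_smul _ c (hV u hu).1).trans ?_
  rw [mul_assoc]
  gcongr
  exact (hV u hu).2

lemma BddOp.mul {V : Op} {p b : ℝ} (hV : BddOp V p b) {f : ℝ → ℂ} (hf : Rapid f)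
    (hpb : 0 ≤ p + b) : BddOp (fun u => f * V u) p b := by
  obtain ⟨C, hC, hV⟩ := hV
  obtain ⟨D, hD, hf'⟩ := hf.mul_bound hpb
  refine ⟨D * C, ENNReal.mul_ne_top hD hC, fun u hu => ⟨hf.wiener.mul (hV u hu).1, ?_⟩⟩
  refine (hf' _ (hV u hu).1).trans ?_
  rw [mul_assoc]
  gcongr
  exact (hV u hu).2

lemma Small.congr {q r : ℝ} {X Y : ℕ → Op} (hX : Small q r X)
    (h : ∀ n : ℕ, 1 ≤ n → ∀ φ, InX n φ → Y n φ = X n φ) : Small q r Y := by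
  obtain ⟨C, hC, hX⟩ := hX
  exact ⟨C, hC, fun n hn φ hφ => by rw [h n hn φ hφ]; exact hX n hn φ hφ⟩

lemma Small.zero (q r : ℝ) : Small q r fun _ _ => 0 :=
  ⟨0, ENNReal.zero_ne_top, fun _ _ _ _ => ⟨Wiener.zero, by
    rw [interp_zero, sobolevNorm_zero]; exact zero_le⟩⟩

lemma Small.add {q r : ℝ} {X Y : ℕ → Op} (hX : Small q r X) (hY : Small q r Y) :
    Small q r fun n φ => X n φ + Y n φ := by
  obtain ⟨C, hC, hX⟩ := hX
  obtain ⟨D, hD, hY⟩ := hY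
  refine ⟨C + D, ENNReal.add_ne_top.mpr ⟨hC, hD⟩, fun n hn φ hφ =>
    ⟨(hX n hn φ hφ).1.add (hY n hn φ hφ).1, ?_⟩⟩
  rw [interp_add]
  refine (sobolevNorm_add_le _ (interp_wiener hn _).1 (interp_wiener hn _).1).trans ?_
  rw [add_mul, add_mul]
  exact add_le_add (hX n hn φ hφ).2 (hY n hn φ hφ).2

lemma Small.smul {q r : ℝ} {X : ℕ → Op} (c : ℂ) (hX : Small q r X) :
    Small q r fun n φ => c • X n φ := by
  obtain ⟨C, hC, hX⟩ := hX
  refine ⟨‖c‖ₑ * C, ENNReal.mul_ne_top (by simp) hC, fun n hn φ hφ =>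
    ⟨(hX n hn φ hφ).1.smul c, ?_⟩⟩
  rw [interp_smul]
  refine (sobolevNorm_smul _ c (interp_wiener hn _).1).trans ?_
  rw [mul_assoc, mul_assoc, ← mul_assoc C]
  gcongr
  exact (hX n hn φ hφ).2

lemma Small.neg {q r : ℝ} {X : ℕ → Op} (hX : Small q r X) : Small q r fun n φ => -X n φ :=
  (hX.smul (-1)).congr fun _ _ _ _ => by simp

lemma Small.sub {q r : ℝ} {X Y : ℕ → Op} (hX : Small q r X) (hY : Small q r Y) :
    Small q r fun n φ => X n φ - Y n φ :=
  (hX.add hY.neg).congr fun _ _ _ _ => sub_eq_add_neg _ _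

/-- Only the interpolant of X is controlled, but P_n(fX) = P_n(f P_n X), and the right side is
bounded since r > 1/2. -/
lemma Small.mul {q r : ℝ} {X : ℕ → Op} (hX : Small q r X) {f : ℝ → ℂ} (hf : Rapid f)
    (hr : 1 / 2 < r) : Small q r fun n φ => f * X n φ := by
  obtain ⟨C, hC, hX⟩ := hX
  obtain ⟨D, hD, hf'⟩ := hf.mul_bound (q := r) (by linarith)
  obtain ⟨P, hP, hP'⟩ := interp_bound hr
  refine ⟨P * (D * C), ENNReal.mul_ne_top hP (ENNReal.mul_ne_top hD hC), fun n hn φ hφ =>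
    ⟨hf.wiener.mul (hX n hn φ hφ).1, ?_⟩⟩
  have hw := (interp_wiener hn (X n φ)).1
  rw [← interp_mul_interp hn]
  calc sobolevNorm r (interp n (f * interp n (X n φ)))
      ≤ P * (D * (C * (n : ℝ≥0∞)⁻¹ * sobolevNorm q φ)) := by
        refine (hP' n hn _ (hf.wiener.mul hw)).trans ?_
        gcongr
        refine (hf' _ hw).trans ?_
        gcongr
        exact (hX n hn φ hφ).2
    _ = _ := by ring

/-- A tame operator maps X_n into itself and gains one order, so an estimate in order q + 1 can be
applied to its values. -/
lemma Small.comp {q r : ℝ} {X : ℕ → Op} (hX : Small (q + 1) r X) {T : Op} (hT : TameOp T) :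
    Small q r fun n φ => X n (T φ) := by
  obtain ⟨C, hC, hX⟩ := hX
  obtain ⟨D, hD, hT'⟩ := hT.ordOp.bound
  refine ⟨C * D, ENNReal.mul_ne_top hC hD, fun n hn φ hφ => ⟨(hX n hn _ (hT.inX hφ)).1, ?_⟩⟩
  refine (hX n hn _ (hT.inX hφ)).2.trans ?_
  rw [mul_right_comm C D, mul_assoc (C * _) D]
  gcongr
  exact hT' q φ hφ.wiener

/-- The interpolation inside T is indispensable, as X is small only at the nodes; the one outside is
free, since T keeps the interpolant in X_n. -/
lemma Small.post {q r : ℝ} {X : ℕ → Op} (hX : Small q r X) {T : Op} (hT : TameOp T) :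
    Small q (r + 1) fun n φ => T (interp n (X n φ)) := by
  obtain ⟨C, hC, hX⟩ := hX
  obtain ⟨D, hD, hT'⟩ := hT.ordOp.bound
  refine ⟨D * C, ENNReal.mul_ne_top hD hC, fun n hn φ hφ => ?_⟩
  have hI := inX_interp hn (X n φ)
  refine ⟨hT.ordOp.wiener hI.wiener, ?_⟩
  rw [(hT.inX hI).interp_eq hn]
  refine (hT' r _ hI.wiener).trans ?_
  rw [mul_assoc, mul_assoc, ← mul_assoc C]
  gcongr
  exact (hX n hn φ hφ).2

/-- Interpolation between two operators that gain at least three orders in total. -/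
lemma small_interp_between {T V : Op} {p a b : ℝ} (hT : OrdOp T a) (hV : BddOp V p b)
    (hab : 3 ≤ a + b) (ha : a ≤ 2) (hp : 1 / 2 < p) :
    Small p (p + 2) fun n φ => T (interp n (V φ)) - T (V φ) := by
  obtain ⟨C, hC, hV⟩ := hV
  obtain ⟨D, hD, hT'⟩ := hT.bound
  obtain ⟨P, hP, hP'⟩ := interp_bound (q := p + 2) (by linarith)
  -- The interpolation error is taken in the order that T lifts to p + 2; a ≤ 2 keeps this order
  -- above 1/2.
  obtain ⟨R, hR, hR'⟩ := interp_error (q := p + 2 - a) (by linarith)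
  refine ⟨P * (D * (R * C)), ENNReal.mul_ne_top hP (ENNReal.mul_ne_top hD
    (ENNReal.mul_ne_top hR hC)), fun n hn φ hφ => ?_⟩
  have hw := (hV φ hφ.wiener).1
  have hI := (interp_wiener hn (V φ)).1
  beta_reduce
  rw [← hT.map_sub hI hw]
  have hTw := hT.wiener (hI.sub hw)
  refine ⟨hTw, ?_⟩
  have h1 := hT' (p + 2 - a) _ (hI.sub hw)
  rw [sub_add_cancel] at h1
  -- The error needs V φ in order p + 3 − a, and a + b ≥ 3 supplies it.
  have h2 : sobolevNorm (p + 2 - a + 1) (V φ) ≤ C * sobolevNorm p φ :=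
    (sobolevNorm_mono (by linarith) _).trans (hV φ hφ.wiener).2
  calc sobolevNorm (p + 2) (interp n (T (interp n (V φ) - V φ)))
      ≤ P * (D * (R * (n : ℝ≥0∞)⁻¹ * (C * sobolevNorm p φ))) := by
        refine (hP' n hn _ hTw).trans ?_
        gcongr
        refine h1.trans ?_
        gcongr
        refine (hR' n hn _ hw).trans ?_
        gcongr
    _ = _ := by ring

/-- The error of `T P_n f Y_n` when `Y_n` approximates `Y`. -/
lemma Small.post_mul {T Y : Op} {Yn : ℕ → Op} {p : ℝ} (hY : Small p (p + 1) fun n φ => Yn n φ - Y φ)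
    (hYb : BddOp Y p 2) (hT : TameOp T) {f : ℝ → ℂ} (hf : Rapid f) (hp : 1 / 2 < p) :
    Small p (p + 2) fun n φ => T (interp n (f * Yn n φ)) - T (f * Y φ) := by
  have h1 := ((hY.mul hf (by linarith)).post hT)
  rw [show p + 1 + 1 = p + 2 by ring] at h1
  have h2 := small_interp_between hT.ordOp (hYb.mul hf (by linarith)) (by norm_num) (by norm_num) hp
  -- The error splits as T P_n f(Yn − Y) plus (T P_n − T) f Y: a propagated error and a fresh
  -- interpolation error.
  refine (h1.add h2).congr fun n hn φ hφ => ?_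
  have hd : f * (Yn n φ - Y φ) = f * Yn n φ - f * Y φ := mul_sub _ _ _
  rw [hd, interp_sub, hT.ordOp.map_sub (interp_wiener hn _).1 (interp_wiener hn _).1]
  abel

/-! ### Sums and multiples of tame symbols and operators -/

lemma TameSymbol.add {τ σ : ℤ → ℂ} (hτ : TameSymbol τ) (hσ : TameSymbol σ) :
    TameSymbol fun m => τ m + σ m where
  even m := by rw [hτ.even, hσ.even]
  decay := by
    obtain ⟨c, hc⟩ := hτ.decay
    obtain ⟨d, hd⟩ := hσ.decay
    refine ⟨c + d, fun m => (norm_add_le _ _).trans ?_⟩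
    rw [add_mul]
    exact add_le_add (hc m) (hd m)
  alias_le := by
    obtain ⟨c, hc0, hc⟩ := hτ.alias_le
    obtain ⟨d, hd0, hd⟩ := hσ.alias_le
    refine ⟨c + d, by positivity, fun n hn l m s h1 h2 h3 => ?_⟩
    rw [add_sub_add_comm, add_mul, add_div]
    exact (norm_add_le _ _).trans (add_le_add (hc n hn l m s h1 h2 h3) (hd n hn l m s h1 h2 h3))

lemma TameSymbol.smul {τ : ℤ → ℂ} (z : ℂ) (hτ : TameSymbol τ) :
    TameSymbol fun m => z * τ m where
  even m := by rw [hτ.even]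
  decay := by
    obtain ⟨c, hc⟩ := hτ.decay
    refine ⟨‖z‖ * c, fun m => ?_⟩
    rw [norm_mul, mul_assoc]
    exact mul_le_mul_of_nonneg_left (hc m) (norm_nonneg _)
  alias_le := by
    obtain ⟨c, hc0, hc⟩ := hτ.alias_le
    refine ⟨‖z‖ * c, by positivity, fun n hn l m s h1 h2 h3 => ?_⟩
    rw [← mul_sub, norm_mul, mul_assoc, mul_div_assoc]
    exact mul_le_mul_of_nonneg_left (hc n hn l m s h1 h2 h3) (norm_nonneg _)

lemma tameOp_logOp : TameOp logOp := ⟨_, fun _ hu => logOp_mult hu, tameSymbol_sym⟩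

lemma tameOp_meanOp : TameOp meanOp := ⟨_, fun _ hu => meanOp_mult hu, tameSymbol_dirac⟩

lemma TameOp.smul {T : Op} (z : ℂ) (h : TameOp T) : TameOp fun u => z • T u := by
  obtain ⟨τ, hT, hτ⟩ := h
  refine ⟨_, fun u hu => ?_, hτ.smul z⟩
  have h := (hT u hu).1.smul' z
  exact ⟨h.1, fun m => by rw [h.2, (hT u hu).2]; ring⟩

lemma TameOp.add {T U : Op} (hT : TameOp T) (hU : TameOp U) : TameOp fun u => T u + U u := by
  obtain ⟨τ, hT, hτ⟩ := hT
  obtain ⟨σ, hU, hσ⟩ := hU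
  refine ⟨_, fun u hu => ?_, hτ.add hσ⟩
  have h := (hT u hu).1.add' (hU u hu).1
  exact ⟨h.1, fun m => by rw [h.2, (hT u hu).2, (hU u hu).2]; ring⟩

lemma TameOp.small {T : Op} (hT : TameOp T) {f : ℝ → ℂ} (hf : Rapid f) {q : ℝ} (hq : 0 ≤ q) :
    Small q (q + 1) fun n φ => T (interp n (f * φ)) - T (f * φ) := by
  have hT' := hT.ordOp
  obtain ⟨τ, hT, hτ⟩ := hT
  obtain ⟨C, hC, h⟩ := alias_error hT hτ hf hq
  exact ⟨C, hC, fun n hn φ hφ => ⟨(hT'.wiener (interp_wiener hn _).1).sub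
    (hT'.wiener (hf.wiener.mul hφ.wiener)), h n hn φ hφ⟩⟩

/-! ### Separated kernels -/

/-- Finite sums of products of smooth functions of `t` and of `ζ`. -/
inductive Sep : (ℝ → ℝ → ℂ) → Prop
  | zero : Sep fun _ _ => 0
  | add_mul (b : ℝ → ℝ → ℂ) (α β : ℝ → ℂ) : Sep b → Rapid α → Rapid β →
      Sep fun t ζ => b t ζ + α t * β ζ

lemma Sep.continuous {b : ℝ → ℝ → ℂ} (h : Sep b) (t : ℝ) : Continuous (b t) := by
  induction h with
  | zero => exact continuous_const
  | add_mul b α β _ _ hβ ih => exact ih.add (continuous_const.mul hβ.wiener.continuous)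

/-- The logarithmic part of `intOp`. -/
def logPart (b : ℝ → ℝ → ℂ) : Op := fun φ t =>
  ∫ ζ in (0 : ℝ)..(2 * Real.pi), logKer (t - ζ) * (b t ζ * φ ζ)

/-- The smooth part of `intOp`. -/
def smoothPart (b : ℝ → ℝ → ℂ) : Op := fun φ t =>
  ∫ ζ in (0 : ℝ)..(2 * Real.pi), b t ζ * φ ζ

/-- The logarithmic part of `quadOp`. -/
def logPartQ (b : ℝ → ℝ → ℂ) (n : ℕ) : Op := fun φ t =>
  ∫ ζ in (0 : ℝ)..(2 * Real.pi), logKer (t - ζ) * interp n (fun s => b t s * φ s) ζ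

/-- The smooth part of `quadOp`. -/
def smoothPartQ (b : ℝ → ℝ → ℂ) (n : ℕ) : Op := fun φ t =>
  ∫ ζ in (0 : ℝ)..(2 * Real.pi), interp n (fun s => b t s * φ s) ζ

lemma intOp_eq (b c : ℝ → ℝ → ℂ) (φ : ℝ → ℂ) : intOp b c φ = logPart b φ + smoothPart c φ := rfl

lemma quadOp_eq (b c : ℝ → ℝ → ℂ) (n : ℕ) (φ : ℝ → ℂ) :
    quadOp n b c φ = logPartQ b n φ + smoothPartQ c n φ := rfl

lemma intervalIntegrable_logKer_mul (t : ℝ) {g : ℝ → ℂ} (hg : Continuous g) (a b : ℝ) :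
    IntervalIntegrable (fun ζ => logKer (t - ζ) * g ζ) MeasureTheory.volume a b :=
  (intervalIntegrable_logKer t a b).mul_continuousOn hg.continuousOn

lemma integral_logKer_mul (g : ℝ → ℂ) (t : ℝ) :
    ∫ ζ in (0 : ℝ)..(2 * Real.pi), logKer (t - ζ) * g ζ = -(2 * Real.pi) * logOp g t := by
  have hpi : (Real.pi : ℂ) ≠ 0 := by exact_mod_cast Real.pi_ne_zero
  rw [logOp]
  field_simp

lemma integral_eq_meanOp (g : ℝ → ℂ) (t : ℝ) :
    ∫ ζ in (0 : ℝ)..(2 * Real.pi), g ζ = 2 * Real.pi * meanOp g t := by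
  have hpi : (Real.pi : ℂ) ≠ 0 := by exact_mod_cast Real.pi_ne_zero
  rw [meanOp]
  field_simp

/-- Each separated term is the logarithmic multiplier between two multiplications, which brings
`alias_error` within reach of kernels that are not convolutions. -/
lemma logPart_add_mul {b : ℝ → ℝ → ℂ} {α β φ : ℝ → ℂ} (hb : ∀ t, Continuous (b t))
    (hβ : Continuous β) (hφ : Continuous φ) :
    logPart (fun t ζ => b t ζ + α t * β ζ) φ =
      logPart b φ + (-(2 * Real.pi) : ℂ) • (α * logOp (β * φ)) := by
  funext t
  simp only [logPart, Pi.add_apply, Pi.smul_apply, Pi.mul_apply, smul_eq_mul]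
  have h : ∀ ζ, logKer (t - ζ) * ((b t ζ + α t * β ζ) * φ ζ) =
      logKer (t - ζ) * (b t ζ * φ ζ) + α t * (logKer (t - ζ) * (β * φ) ζ) := fun ζ => by
    simp only [Pi.mul_apply]
    ring
  have hi : IntervalIntegrable (fun ζ => logKer (t - ζ) * (b t ζ * φ ζ)) MeasureTheory.volume 0
      (2 * Real.pi) := intervalIntegrable_logKer_mul t ((hb t).mul hφ) _ _
  simp only [h]
  rw [intervalIntegral.integral_add hi
    ((intervalIntegrable_logKer_mul t (hβ.mul hφ) _ _).const_mul _),
    intervalIntegral.integral_const_mul, integral_logKer_mul (β * φ)]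
  ring

lemma smoothPart_add_mul {b : ℝ → ℝ → ℂ} {α β φ : ℝ → ℂ} (hb : ∀ t, Continuous (b t))
    (hβ : Continuous β) (hφ : Continuous φ) :
    smoothPart (fun t ζ => b t ζ + α t * β ζ) φ =
      smoothPart b φ + (2 * Real.pi : ℂ) • (α * meanOp (β * φ)) := by
  funext t
  simp only [smoothPart, Pi.add_apply, Pi.smul_apply, Pi.mul_apply, smul_eq_mul]
  have h : ∀ ζ, (b t ζ + α t * β ζ) * φ ζ = b t ζ * φ ζ + α t * (β * φ) ζ := fun ζ => by
    simp only [Pi.mul_apply]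
    ring
  have hi : IntervalIntegrable (fun ζ => b t ζ * φ ζ) MeasureTheory.volume 0
      (2 * Real.pi) := ((hb t).mul hφ).intervalIntegrable _ _
  simp only [h]
  rw [intervalIntegral.integral_add hi
    (((hβ.mul hφ).intervalIntegrable _ _).const_mul _),
    intervalIntegral.integral_const_mul, integral_eq_meanOp (β * φ) t]
  ring

lemma interp_kernel_add_mul (n : ℕ) (b : ℝ → ℝ → ℂ) (α β φ : ℝ → ℂ) (t ζ : ℝ) :
    interp n (fun s => (b t s + α t * β s) * φ s) ζ =
      interp n (fun s => b t s * φ s) ζ + α t * interp n (β * φ) ζ := by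
  have : (fun s => (b t s + α t * β s) * φ s) = (fun s => b t s * φ s) + α t • (β * φ) := by
    funext s
    simp only [Pi.add_apply, Pi.smul_apply, Pi.mul_apply, smul_eq_mul]
    ring
  rw [this, interp_add, interp_smul]
  rfl

lemma continuous_interp {n : ℕ} (hn : 1 ≤ n) (g : ℝ → ℂ) : Continuous (interp n g) :=
  (interp_wiener hn g).1.continuous

lemma logPartQ_add_mul {n : ℕ} (hn : 1 ≤ n) (b : ℝ → ℝ → ℂ) (α β φ : ℝ → ℂ) :
    logPartQ (fun t ζ => b t ζ + α t * β ζ) n φ =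
      logPartQ b n φ + (-(2 * Real.pi) : ℂ) • (α * logOp (interp n (β * φ))) := by
  funext t
  simp only [logPartQ, Pi.add_apply, Pi.smul_apply, Pi.mul_apply, smul_eq_mul,
    interp_kernel_add_mul, mul_add, mul_left_comm _ (α t)]
  rw [intervalIntegral.integral_add (intervalIntegrable_logKer_mul t (continuous_interp hn _) _ _)
    ((intervalIntegrable_logKer_mul t (continuous_interp hn _) _ _).const_mul _),
    intervalIntegral.integral_const_mul, integral_logKer_mul (interp n (β * φ))]

lemma smoothPartQ_add_mul {n : ℕ} (hn : 1 ≤ n) (b : ℝ → ℝ → ℂ) (α β φ : ℝ → ℂ) :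
    smoothPartQ (fun t ζ => b t ζ + α t * β ζ) n φ =
      smoothPartQ b n φ + (2 * Real.pi : ℂ) • (α * meanOp (interp n (β * φ))) := by
  funext t
  simp only [smoothPartQ, Pi.add_apply, Pi.smul_apply, Pi.mul_apply, smul_eq_mul,
    interp_kernel_add_mul]
  rw [intervalIntegral.integral_add ((continuous_interp hn _).intervalIntegrable _ _)
    (((continuous_interp hn _).intervalIntegrable _ _).const_mul _),
    intervalIntegral.integral_const_mul, integral_eq_meanOp (interp n (β * φ)) t]
  ring

lemma Sep.small_logPart {b : ℝ → ℝ → ℂ} (h : Sep b) {q : ℝ} (hq : 0 ≤ q) :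
    Small q (q + 1) fun n φ => logPartQ b n φ - logPart b φ := by
  induction h with
  | zero =>
    refine (Small.zero q (q + 1)).congr fun n hn φ hφ => ?_
    funext t
    have : (fun _ : ℝ => (0 : ℂ)) = 0 := rfl
    simp [logPartQ, logPart, this, interp_zero]
  | add_mul b α β hb hα hβ ih =>
    have h1 := ((tameOp_logOp.small hβ hq).mul hα (by linarith)).smul (-(2 * Real.pi) : ℂ)
    refine (ih.add h1).congr fun n hn φ hφ => ?_
    rw [logPartQ_add_mul hn, logPart_add_mul hb.continuous hβ.wiener.continuous
      hφ.wiener.continuous, mul_sub, smul_sub]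
    abel

lemma Sep.small_smoothPart {b : ℝ → ℝ → ℂ} (h : Sep b) {q : ℝ} (hq : 0 ≤ q) :
    Small q (q + 1) fun n φ => smoothPartQ b n φ - smoothPart b φ := by
  induction h with
  | zero =>
    refine (Small.zero q (q + 1)).congr fun n hn φ hφ => ?_
    funext t
    have : (fun _ : ℝ => (0 : ℂ)) = 0 := rfl
    simp [smoothPartQ, smoothPart, this, interp_zero]
  | add_mul b α β hb hα hβ ih =>
    have h1 := ((tameOp_meanOp.small hβ hq).mul hα (by linarith)).smul (2 * Real.pi : ℂ)
    refine (ih.add h1).congr fun n hn φ hφ => ?_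
    rw [smoothPartQ_add_mul hn, smoothPart_add_mul hb.continuous hβ.wiener.continuous
      hφ.wiener.continuous, mul_sub, smul_sub]
    abel

/-- The quadrature error for separated kernels. -/
lemma small_quadOp {b c : ℝ → ℝ → ℂ} (hb : Sep b) (hc : Sep c) {q : ℝ} (hq : 0 ≤ q) :
    Small q (q + 1) fun n φ => quadOp n b c φ - intOp b c φ :=
  ((hb.small_logPart hq).add (hc.small_smoothPart hq)).congr fun n _ φ _ => by
    rw [quadOp_eq, intOp_eq]
    abel

lemma Sep.congr {b c : ℝ → ℝ → ℂ} (h : Sep b) (hbc : ∀ t ζ, c t ζ = b t ζ) : Sep c := by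
  have : c = b := funext fun t => funext fun ζ => hbc t ζ
  rwa [this]

/-! ### Trigonometric convolution kernels -/

/-- The kernel `∑ₖ aₖ e^{ik(t-ζ)}`. -/
def trigKer (s : Finset ℤ) (a : ℤ → ℂ) (t ζ : ℝ) : ℂ := ∑ k ∈ s, a k * expi k (t - ζ)

lemma trigKer_insert {s : Finset ℤ} {k : ℤ} (hk : k ∉ s) (a : ℤ → ℂ) :
    trigKer (insert k s) a =
      fun t ζ => trigKer s a t ζ + (a k • expi k) t * expi (-k) ζ := by
  funext t ζ
  rw [trigKer, Finset.sum_insert hk, trigKer, add_comm, expi_arg_sub, ← mul_assoc]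
  rfl

lemma Rapid.smul {f : ℝ → ℂ} (hf : Rapid f) (c : ℂ) : Rapid (c • f) := by
  have h := hf.wiener.smul' c
  refine ⟨h.1, fun r => ?_⟩
  have he : ∀ k, wt r k * ‖hat (c • f) k‖ₑ = ‖c‖ₑ * (wt r k * ‖hat f k‖ₑ) := fun k => by
    rw [h.2, enorm_mul]; ring
  simp only [he, ENNReal.tsum_mul_left]
  exact ENNReal.mul_ne_top (by simp) (hf.decay r)

lemma sep_trigKer (s : Finset ℤ) (a : ℤ → ℂ) : Sep (trigKer s a) := by
  induction s using Finset.induction_on with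
  | empty => exact Sep.zero.congr fun t ζ => by simp [trigKer]
  | insert k s hk ih =>
    rw [trigKer_insert hk]
    exact ih.add_mul _ _ _ ((rapid_expi k).smul _) (rapid_expi _)

/-- Conjugation by an exponential translates the symbol. -/
lemma IsMult.shift {T : Op} {τ : ℤ → ℂ} (hT : IsMult T τ) (c : ℂ) (k : ℤ) {u : ℝ → ℂ}
    (hu : Wiener u) : Wiener (c • expi k * T (expi (-k) * u)) ∧
      ∀ m, hat (c • expi k * T (expi (-k) * u)) m = c * τ (m - k) * hat u m := by
  have h1 := hu.expi_mul' (-k)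
  have h2 := hT _ h1.1
  have h3 := h2.1.expi_mul' k
  have h4 := h3.1.smul' c
  rw [smul_mul_assoc]
  refine ⟨h4.1, fun m => ?_⟩
  rw [h4.2, h3.2, h2.2, h1.2, sub_neg_eq_add, sub_add_cancel, mul_assoc]

lemma isMult_logOp : IsMult logOp fun m => (sym m : ℂ) := fun _ hu => logOp_mult hu

lemma isMult_meanOp : IsMult meanOp fun m => (dirac m : ℂ) := fun _ hu => meanOp_mult hu

lemma isMult_logPart_trigKer (s : Finset ℤ) (a : ℤ → ℂ) : IsMult (logPart (trigKer s a))
    fun m => ∑ k ∈ s, -(2 * Real.pi) * (a k * (sym (m - k) : ℂ)) := by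
  induction s using Finset.induction_on with
  | empty =>
    intro u _
    have : logPart (trigKer ∅ a) u = 0 := by
      funext t
      simp [logPart, trigKer]
    rw [this]
    exact ⟨Wiener.zero, fun m => by rw [Wiener.zero'.2]; simp⟩
  | insert k s hk ih =>
    intro u hu
    rw [trigKer_insert hk, logPart_add_mul (sep_trigKer s a).continuous (continuous_expi _)
      hu.continuous]
    have h1 := isMult_logOp.shift (a k) k hu
    have h2 := h1.1.smul' (-(2 * Real.pi))
    have h3 := (ih u hu).1.add' h2.1
    refine ⟨h3.1, fun m => ?_⟩
    rw [h3.2, h2.2, h1.2, (ih u hu).2]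
    beta_reduce
    rw [Finset.sum_insert hk]
    ring

lemma isMult_smoothPart_trigKer (s : Finset ℤ) (a : ℤ → ℂ) : IsMult (smoothPart (trigKer s a))
    fun m => ∑ k ∈ s, 2 * Real.pi * (a k * (dirac (m - k) : ℂ)) := by
  induction s using Finset.induction_on with
  | empty =>
    intro u _
    have : smoothPart (trigKer ∅ a) u = 0 := by
      funext t
      simp [smoothPart, trigKer]
    rw [this]
    exact ⟨Wiener.zero, fun m => by rw [Wiener.zero'.2]; simp⟩
  | insert k s hk ih =>
    intro u hu
    rw [trigKer_insert hk, smoothPart_add_mul (sep_trigKer s a).continuous (continuous_expi _)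
      hu.continuous]
    have h1 := isMult_meanOp.shift (a k) k hu
    have h2 := h1.1.smul' (2 * Real.pi)
    have h3 := (ih u hu).1.add' h2.1
    refine ⟨h3.1, fun m => ?_⟩
    rw [h3.2, h2.2, h1.2, (ih u hu).2]
    beta_reduce
    rw [Finset.sum_insert hk]
    ring

/-- Away from the exceptional cases the difference is at most |k|/(|m||m − k|), hence O(m⁻²). The
cases m = 0 and m = k, where the symbol is 0 by convention, are bounded using `sym_le_one`. -/
lemma abs_sym_sub_le (m k : ℤ) :
    |sym (m - k) - sym m| ≤ 2 * (1 + |(k : ℝ)|) ^ 2 * (1 + (m : ℝ) ^ 2)⁻¹ := by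
  have hk0 : 0 ≤ |(k : ℝ)| := abs_nonneg _
  have hw := one_add_sq_pos m
  rw [← div_eq_mul_inv, le_div_iff₀ hw]
  rcases eq_or_ne m 0 with rfl | hm
  · have h1 := sym_nonneg (0 - k)
    have h2 := sym_le_one (0 - k)
    have h3 : sym 0 = 0 := by simp [sym]
    rw [h3, sub_zero, abs_of_nonneg h1]
    simp only [Int.cast_zero]
    nlinarith
  rcases eq_or_ne m k with rfl | hmk
  · have h1 := sym_nonneg m
    have h2 := sym_le_one m
    have h3 : sym (m - m) = 0 := by simp [sym]
    rw [h3, zero_sub, abs_neg, abs_of_nonneg h1]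
    rw [← sq_abs (m : ℝ)]
    nlinarith [mul_le_mul_of_nonneg_right h2 (by positivity : 0 ≤ 1 + |(m : ℝ)| ^ 2)]
  · have ha : 1 ≤ |(m : ℝ)| := by exact_mod_cast Int.one_le_abs hm
    have hb : 1 ≤ |((m - k : ℤ) : ℝ)| := by
      exact_mod_cast Int.one_le_abs (sub_ne_zero.mpr hmk)
    have hab : |(m : ℝ)| ≤ |((m - k : ℤ) : ℝ)| + |(k : ℝ)| := by
      have := abs_add_le ((m - k : ℤ) : ℝ) (k : ℝ)
      push_cast at this ⊢
      rwa [sub_add_cancel] at this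
    have hd : |(|(m : ℝ)| - |((m - k : ℤ) : ℝ)|)| ≤ |(k : ℝ)| := by
      refine (abs_abs_sub_abs_le _ _).trans ?_
      push_cast
      rw [sub_sub_cancel]
    rw [← sq_abs (m : ℝ)]
    simp only [sym]
    set x := |(m : ℝ)|
    set y := |((m - k : ℤ) : ℝ)|
    set z := |(k : ℝ)|
    have hx : 0 < x := by linarith
    have hy : 0 < y := by linarith
    have e : y⁻¹ - x⁻¹ = (x - y) * (y⁻¹ * x⁻¹) := by field_simp
    rw [e, abs_mul, abs_of_pos (by positivity : 0 < y⁻¹ * x⁻¹)]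
    have h1 : y⁻¹ * x ≤ 1 + z := by
      rw [inv_mul_le_iff₀ hy]
      nlinarith
    have h2 : x⁻¹ * (1 + x ^ 2) ≤ 2 * x := by
      rw [inv_mul_le_iff₀ hx]
      nlinarith
    calc |x - y| * (y⁻¹ * x⁻¹) * (1 + x ^ 2) = |x - y| * (y⁻¹ * (x⁻¹ * (1 + x ^ 2))) := by ring
      _ ≤ z * (y⁻¹ * (2 * x)) := by gcongr
      _ = 2 * z * (y⁻¹ * x) := by ring
      _ ≤ 2 * z * (1 + z) := by gcongr
      _ ≤ _ := by nlinarith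

lemma abs_dirac_le (m k : ℤ) :
    |dirac (m - k)| ≤ 2 * (1 + |(k : ℝ)|) ^ 2 * (1 + (m : ℝ) ^ 2)⁻¹ := by
  rw [← div_eq_mul_inv, le_div_iff₀ (one_add_sq_pos m), dirac]
  split_ifs with h
  · have : m = k := by omega
    subst this
    rw [abs_one, ← sq_abs (m : ℝ)]
    nlinarith [abs_nonneg (m : ℝ)]
  · rw [abs_zero, zero_mul]
    positivity

/-- Trigonometric logarithmic kernels vanishing on the diagonal have order `-2`. -/
lemma ordOp_trigKer {s : Finset ℤ} {a : ℤ → ℂ} (ha : ∑ k ∈ s, a k = 0) (s' : Finset ℤ)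
    (d : ℤ → ℂ) : OrdOp (intOp (trigKer s a) (trigKer s' d)) 2 := by
  refine ⟨fun m => (∑ k ∈ s, -(2 * Real.pi) * (a k * (sym (m - k) : ℂ))) +
    ∑ k ∈ s', 2 * Real.pi * (d k * (dirac (m - k) : ℂ)), fun u hu => ?_,
    (∑ k ∈ s, ‖(2 * Real.pi : ℂ)‖ * (‖a k‖ * (2 * (1 + |(k : ℝ)|) ^ 2))) +
    ∑ k ∈ s', ‖(2 * Real.pi : ℂ)‖ * (‖d k‖ * (2 * (1 + |(k : ℝ)|) ^ 2)), fun m => ?_⟩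
  · have h1 := isMult_logPart_trigKer s a u hu
    have h2 := isMult_smoothPart_trigKer s' d u hu
    have h3 := h1.1.add' h2.1
    rw [intOp_eq]
    exact ⟨h3.1, fun m => by rw [h3.2, h1.2, h2.2, add_mul]⟩
  · rw [show (-2 / 2 : ℝ) = -1 by norm_num, Real.rpow_neg_one, add_mul, Finset.sum_mul,
      Finset.sum_mul]
    -- As the a_k sum to zero, the symbol at m may be subtracted from each term; the shifted symbols
    -- become differences of order −2.
    have e : ∑ k ∈ s, -(2 * Real.pi) * (a k * (sym (m - k) : ℂ)) =
        ∑ k ∈ s, -(2 * Real.pi) * (a k * ((sym (m - k) - sym m : ℝ) : ℂ)) := by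
      simp only [Complex.ofReal_sub, mul_sub, Finset.sum_sub_distrib]
      rw [← Finset.mul_sum, ← Finset.mul_sum, ← Finset.sum_mul, ha]
      simp [Finset.mul_sum]
    beta_reduce
    rw [e]
    refine (norm_add_le _ _).trans (add_le_add ?_ ?_)
    · refine (norm_sum_le _ _).trans (Finset.sum_le_sum fun k _ => ?_)
      rw [norm_mul, norm_mul, norm_neg, Complex.norm_real, Real.norm_eq_abs, mul_assoc, mul_assoc]
      have := abs_sym_sub_le m k
      gcongr
    · refine (norm_sum_le _ _).trans (Finset.sum_le_sum fun k _ => ?_)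
      rw [norm_mul _ (d k * _), norm_mul (d k), Complex.norm_real, Real.norm_eq_abs, mul_assoc,
        mul_assoc]
      have := abs_dirac_le m k
      gcongr

/-! ### The elementary operators -/

lemma expi_eq (k : ℤ) (x : ℝ) :
    expi k x = (Real.cos (k * x) : ℂ) + Complex.I * (Real.sin (k * x) : ℂ) := by
  rw [expi, show Complex.I * k * x = ((k * x : ℝ) : ℂ) * Complex.I by push_cast; ring,
    Complex.exp_mul_I]
  push_cast
  ring

lemma cos_sq_half (x : ℝ) : Real.cos (x / 2) ^ 2 = (1 + Real.cos x) / 2 := by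
  rw [Real.cos_sq, show 2 * (x / 2) = x by ring]
  ring

lemma kerS₁_eq : kerS₁ = trigKer {1, -1} fun k => k / (8 * Real.pi * Complex.I) := by
  funext t ζ
  have hpi : (Real.pi : ℂ) ≠ 0 := by exact_mod_cast Real.pi_ne_zero
  have hI := Complex.I_ne_zero
  rw [trigKer, Finset.sum_pair (by norm_num), expi_eq, expi_eq, kerS₁]
  simp only [Int.cast_neg, Int.cast_one, one_mul, neg_mul, Real.cos_neg, Real.sin_neg,
    Complex.ofReal_neg]
  field_simp
  ring

lemma kerS₂_eq : kerS₂ = trigKer {0, 2, -2}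
    fun k => if k = 0 then -1 / (16 * Real.pi) else 1 / (32 * Real.pi) := by
  funext t ζ
  have hpi : (Real.pi : ℂ) ≠ 0 := by exact_mod_cast Real.pi_ne_zero
  rw [trigKer, Finset.sum_insert (by decide), Finset.sum_pair (by norm_num), expi_eq, expi_eq,
    expi_eq, kerS₂]
  simp only [Int.cast_neg, Int.cast_ofNat, Int.cast_zero, zero_mul, neg_mul, Real.cos_neg,
    Real.sin_neg, Complex.ofReal_neg, Real.cos_zero, Real.sin_zero, Complex.ofReal_zero,
    Complex.ofReal_one, if_true, if_neg (by norm_num : (2 : ℤ) ≠ 0),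
    if_neg (by norm_num : (-2 : ℤ) ≠ 0), Real.cos_two_mul', Real.sin_two_mul]
  have h := Real.sin_sq_add_cos_sq (t - ζ)
  have h' : (Real.sin (t - ζ) : ℂ) ^ 2 + (Real.cos (t - ζ) : ℂ) ^ 2 = 1 := by exact_mod_cast h
  push_cast at h' ⊢
  field_simp
  linear_combination (-256) * h'

lemma kerB₁log_eq : kerB₁log = trigKer {2, -2} fun k => -k / (32 * Real.pi * Complex.I) := by
  funext t ζ
  have hpi : (Real.pi : ℂ) ≠ 0 := by exact_mod_cast Real.pi_ne_zero
  have hI := Complex.I_ne_zero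
  rw [trigKer, Finset.sum_pair (by norm_num), expi_eq, expi_eq, kerB₁log]
  simp only [Int.cast_neg, Int.cast_ofNat, neg_mul, Real.cos_neg, Real.sin_neg,
    Complex.ofReal_neg]
  field_simp
  ring

/-- Here m₁ = sin x + ½ sin 2x. The odd polynomial k(5 − k²) takes the values 4 and 2 at k = 1, 2,
so it encodes both coefficients at once. -/
lemma kerB₁smooth_eq : kerB₁smooth = trigKer {1, -1, 2, -2}
    fun k => -(k * (5 - k ^ 2)) / (64 * Real.pi * Complex.I) := by
  funext t ζ
  have hpi : (Real.pi : ℂ) ≠ 0 := by exact_mod_cast Real.pi_ne_zero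
  have hI := Complex.I_ne_zero
  rw [trigKer, Finset.sum_insert (by decide), Finset.sum_insert (by decide),
    Finset.sum_pair (by norm_num), expi_eq, expi_eq, expi_eq, expi_eq, kerB₁smooth, m₁, cos_sq_half]
  simp only [Int.cast_neg, Int.cast_ofNat, Int.cast_one, one_mul, neg_mul, Real.cos_neg,
    Real.sin_neg, Complex.ofReal_neg, Real.cos_two_mul', Real.sin_two_mul]
  push_cast
  field_simp
  ring

lemma kerB₂log_eq : kerB₂log = trigKer {0, 2, -2}
    fun k => if k = 0 then 1 / (4 * Real.pi) else -1 / (8 * Real.pi) := by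
  funext t ζ
  have hpi : (Real.pi : ℂ) ≠ 0 := by exact_mod_cast Real.pi_ne_zero
  rw [trigKer, Finset.sum_insert (by decide), Finset.sum_pair (by norm_num), expi_eq, expi_eq,
    expi_eq, kerB₂log]
  simp only [Int.cast_neg, Int.cast_ofNat, Int.cast_zero, zero_mul, neg_mul, Real.cos_neg,
    Real.sin_neg, Complex.ofReal_neg, Real.cos_zero, Real.sin_zero, Complex.ofReal_zero,
    Complex.ofReal_one, if_true, if_neg (by norm_num : (2 : ℤ) ≠ 0),
    if_neg (by norm_num : (-2 : ℤ) ≠ 0)]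
  field_simp
  ring

/-- Here m₂ = ½ + (3/2) cos x + cos 2x, so the frequencies 0 and ±2 share one coefficient. -/
lemma kerB₂smooth_eq : kerB₂smooth = trigKer {0, 1, -1, 2, -2}
    fun k => -(if k = 1 ∨ k = -1 then 3 / (16 * Real.pi) else 1 / (8 * Real.pi)) := by
  funext t ζ
  have hpi : (Real.pi : ℂ) ≠ 0 := by exact_mod_cast Real.pi_ne_zero
  rw [trigKer, Finset.sum_insert (by decide), Finset.sum_insert (by decide),
    Finset.sum_insert (by decide), Finset.sum_pair (by norm_num), expi_eq, expi_eq, expi_eq,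
    expi_eq, expi_eq, kerB₂smooth, m₂, cos_sq_half]
  rw [if_neg (by decide), if_pos (by decide), if_pos (by decide), if_neg (by decide),
    if_neg (by decide)]
  simp only [Int.cast_neg, Int.cast_ofNat, Int.cast_one, one_mul, neg_mul, Real.cos_neg,
    Int.cast_zero, zero_mul, Real.cos_zero, Real.sin_zero, Complex.ofReal_zero, Complex.ofReal_one,
    Real.sin_neg, Complex.ofReal_neg, Real.cos_two_mul]
  push_cast
  field_simp
  ring

lemma trigKer_empty (a : ℤ → ℂ) : trigKer ∅ a = 0 := by
  funext t ζ
  simp [trigKer]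

/-- As for `S₂`, `B₁` and `B₂` below, the logarithmic factor vanishes on the diagonal, that is, its
coefficients sum to zero. -/
lemma ordOp_S₁ : OrdOp opS₁ 2 := by
  rw [opS₁, kerS₁_eq, ← trigKer_empty 0]
  refine ordOp_trigKer ?_ _ _
  rw [Finset.sum_pair (by norm_num)]
  push_cast
  ring

lemma ordOp_S₂ : OrdOp opS₂ 2 := by
  rw [opS₂, kerS₂_eq, ← trigKer_empty 0]
  refine ordOp_trigKer ?_ _ _
  rw [Finset.sum_insert (by decide), Finset.sum_pair (by norm_num)]
  norm_num
  ring

lemma ordOp_B₁ : OrdOp (intOp kerB₁log kerB₁smooth) 2 := by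
  rw [kerB₁log_eq, kerB₁smooth_eq]
  refine ordOp_trigKer ?_ _ _
  rw [Finset.sum_pair (by norm_num)]
  push_cast
  ring

lemma ordOp_B₂ : OrdOp (intOp kerB₂log kerB₂smooth) 2 := by
  rw [kerB₂log_eq, kerB₂smooth_eq]
  refine ordOp_trigKer ?_ _ _
  rw [Finset.sum_insert (by decide), Finset.sum_pair (by norm_num)]
  norm_num
  ring

lemma small_B₁ {q : ℝ} (hq : 0 ≤ q) : Small q (q + 1) fun n φ =>
    quadOp n kerB₁log kerB₁smooth φ - intOp kerB₁log kerB₁smooth φ := by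
  rw [kerB₁log_eq, kerB₁smooth_eq]
  exact small_quadOp (sep_trigKer _ _) (sep_trigKer _ _) hq

lemma small_B₂ {q : ℝ} (hq : 0 ≤ q) : Small q (q + 1) fun n φ =>
    quadOp n kerB₂log kerB₂smooth φ - intOp kerB₂log kerB₂smooth φ := by
  rw [kerB₂log_eq, kerB₂smooth_eq]
  exact small_quadOp (sep_trigKer _ _) (sep_trigKer _ _) hq

/-- Two separated terms suffice; the constant function 1 enters as `expi 0`, so that every factor is
rapid. -/
lemma sep_commutator {f : ℝ → ℝ} (hf : Rapid fun t => (f t : ℂ)) (c : ℂ) :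
    Sep fun t ζ => c * ((f ζ : ℂ) - (f t : ℂ)) := by
  have h1 : Rapid (expi 0) := rapid_expi 0
  refine ((Sep.zero.add_mul _ (c • expi 0) _ (h1.smul c) hf).add_mul _
    ((-c) • fun t => (f t : ℂ)) (expi 0) (hf.smul _) h1).congr fun t ζ => ?_
  simp only [Pi.smul_apply, smul_eq_mul, expi_zero]
  ring

lemma small_comm {f : ℝ → ℝ} (hf : Rapid fun t => (f t : ℂ)) {q : ℝ} (hq : 0 ≤ q) :
    Small q (q + 1) fun n φ => quadOp n (kerComm f) 0 φ - intOp (kerComm f) 0 φ :=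
  small_quadOp (sep_commutator hf _) (Sep.zero.congr fun _ _ => rfl) hq

lemma small_commM {f : ℝ → ℝ} (hf : Rapid fun t => (f t : ℂ)) {q : ℝ} (hq : 0 ≤ q) :
    Small q (q + 1) fun n φ => quadOp n (kerComm f) (kerCommM f) φ -
      intOp (kerComm f) (kerCommM f) φ :=
  small_quadOp (sep_commutator hf _) (sep_commutator hf _) hq

lemma intOp_kerSt₀ (φ : ℝ → ℂ) : intOp kerSt₀ 0 φ = logOp φ := by
  funext t
  simp only [intOp, kerSt₀, logOp, Pi.zero_apply, zero_mul, intervalIntegral.integral_zero, add_zero,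
    mul_left_comm _ (-1 / (2 * (Real.pi : ℂ)))]
  exact intervalIntegral.integral_const_mul _ _

lemma intOp_kerM₀ (φ : ℝ → ℂ) : intOp 0 kerM₀ φ = Complex.I • meanOp φ := by
  funext t
  simp only [intOp, kerM₀, meanOp, Pi.zero_apply, zero_mul, mul_zero,
    intervalIntegral.integral_zero, zero_add, Pi.smul_apply, smul_eq_mul]
  rw [intervalIntegral.integral_const_mul]
  ring

lemma opS₀_eq (φ : ℝ → ℂ) : opS₀ φ = logOp φ + Complex.I • meanOp φ := by
  rw [← intOp_kerSt₀, ← intOp_kerM₀]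
  simp only [opS₀, intOp_eq]
  have h1 : smoothPart 0 φ = 0 := by funext t; simp [smoothPart]
  have h2 : logPart 0 φ = 0 := by funext t; simp [logPart]
  rw [h1, h2, add_zero, zero_add]

lemma interp_const_mul (n : ℕ) (c : ℂ) (φ : ℝ → ℂ) :
    interp n (fun s => c * φ s) = c • interp n φ := interp_smul n c φ

lemma quadOp_kerSt₀ (n : ℕ) (φ : ℝ → ℂ) : quadOp n kerSt₀ 0 φ = logOp (interp n φ) := by
  rw [← intOp_kerSt₀]
  funext t
  simp only [quadOp, intOp, kerSt₀, Pi.zero_apply, zero_mul, interp_const_mul]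
  rw [show (fun _ : ℝ => (0 : ℂ)) = 0 from rfl, interp_zero]
  rfl

lemma quadOp_kerM₀ (n : ℕ) (φ : ℝ → ℂ) :
    quadOp n 0 kerM₀ φ = Complex.I • meanOp (interp n φ) := by
  rw [← intOp_kerM₀]
  funext t
  simp only [quadOp, intOp, kerM₀, Pi.zero_apply, zero_mul, interp_const_mul]
  rw [show (fun _ : ℝ => (0 : ℂ)) = 0 from rfl, interp_zero]
  rfl

lemma tameOp_M₀ : TameOp fun φ => Complex.I • meanOp φ := tameOp_meanOp.smul _

lemma tameOp_S₀ : TameOp opS₀ := by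
  have := tameOp_logOp.add tameOp_M₀
  rwa [← funext opS₀_eq] at this

/-! ### The discretization errors of the entries of `𝓙` -/

lemma mulOp_eq (f : ℝ → ℝ) (φ : ℝ → ℂ) : mulOp f φ = (fun t => (f t : ℂ)) * φ := rfl

section entries

variable {κ : ℝ} {γ : ℝ → Plane} {p : ℝ}

/-! ### Entries built from S₀, S₁, S₂ alone -/

lemma bddOp_A (hγ : IsAnalyticBoundary γ) (hp : 1 / 2 < p) :
    BddOp (opA κ γ (contOps κ γ)) p 1 := by
  have h0 := ((tameOp_S₀.ordOp.bddOp p).mul (rapid_e₁ κ hγ) (by linarith)).smul (1 / 2)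
  have h1 := ((ordOp_S₁.bddOp p).mono (b' := 1) (by norm_num)).mul (rapid_e₃ κ hγ) (by linarith)
  have h2 := ((ordOp_S₂.bddOp p).mono (b' := 1) (by norm_num)).mul (rapid_e₆ κ hγ) (by linarith)
  exact (h0.add h1).add h2

lemma opA_disc {n : ℕ} (hn : 1 ≤ n) {φ : ℝ → ℂ} (hφ : InX n φ) :
    opA κ γ (discOps κ γ n) φ = opA κ γ (contOps κ γ) φ := by
  simp only [opA, discOps, contOps, Function.comp, hφ.interp_eq hn]

/-- The critical term is the one with S₀, which gains a single order; the two orders of V just reach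
the required total of three. -/
lemma small_A {V : Op} {b : ℝ} (hγ : IsAnalyticBoundary γ) (hp : 1 / 2 < p)
    (hV : BddOp V p b) (hb : 2 ≤ b) :
    Small p (p + 2) fun n φ => opA κ γ (discOps κ γ n) (V φ) - opA κ γ (contOps κ γ) (V φ) := by
  have h0 := ((small_interp_between tameOp_S₀.ordOp hV (by linarith) (by norm_num) hp).mul
    (rapid_e₁ κ hγ) (by linarith)).smul (1 / 2)
  have h1 := (small_interp_between ordOp_S₁ hV (by linarith) (by norm_num) hp).mul
    (rapid_e₃ κ hγ) (by linarith)
  have h2 := (small_interp_between ordOp_S₂ hV (by linarith) (by norm_num) hp).mul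
    (rapid_e₆ κ hγ) (by linarith)
  refine ((h0.add h1).add h2).congr fun n hn φ hφ => ?_
  funext t
  simp only [opA, discOps, contOps, mulOp_eq, Function.comp, Pi.add_apply, Pi.sub_apply,
    Pi.mul_apply, Pi.smul_apply, smul_eq_mul]
  ring

lemma bddOp_E₂S₂ (hγ : IsAnalyticBoundary γ) (hp : 1 / 2 < p) :
    BddOp (fun φ => mulOp (e₂ κ γ) (opS₂ φ)) p 2 :=
  (ordOp_S₂.bddOp p).mul (rapid_e₂ κ hγ) (by linarith)

lemma bddOp_E₁S₂ (hγ : IsAnalyticBoundary γ) (hp : 1 / 2 < p) :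
    BddOp (fun φ => mulOp (e₁ κ γ) (opS₂ φ)) p 2 :=
  (ordOp_S₂.bddOp p).mul (rapid_e₁ κ hγ) (by linarith)

/-- The rightmost factor acts on X_n and is exact. Only the interpolation between factors errs, and
each such product gains at least three orders, the tightest being S₂ after A and S₀ after S₁ or S₂.
-/
lemma small_F₁ (hγ : IsAnalyticBoundary γ) (hp : 1 / 2 < p) :
    Small p (p + 2) fun n φ => opF₁ κ γ (discOps κ γ n) φ - opF₁ κ γ (contOps κ γ) φ := by
  have h1 := (small_interp_between ordOp_S₂ (bddOp_E₂S₂ (κ := κ) hγ hp) (by norm_num)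
    (by norm_num) hp).mul (rapid_e₂ κ hγ) (by linarith)
  have hV : BddOp (fun φ => mulOp (e₃ κ γ) (opS₁ φ) + mulOp (e₆ κ γ) (opS₂ φ)) p 2 :=
    ((ordOp_S₁.bddOp p).mul (rapid_e₃ κ hγ) (by linarith)).add
      ((ordOp_S₂.bddOp p).mul (rapid_e₆ κ hγ) (by linarith))
  have h2 := small_interp_between tameOp_S₀.ordOp hV (by norm_num) (by norm_num) hp
  have h3 := (small_interp_between ordOp_S₂ (bddOp_A (κ := κ) hγ hp) (by norm_num)
    (by norm_num) hp).mul (rapid_e₁ κ hγ) (by linarith)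
  refine ((h1.add h2).add h3).congr fun n hn φ hφ => ?_
  funext t
  simp only [opF₁, opA_disc hn hφ]
  simp only [discOps, contOps, mulOp_eq, Function.comp, hφ.interp_eq hn, Pi.add_apply,
    Pi.sub_apply, Pi.mul_apply, Pi.smul_apply, smul_eq_mul]
  ring

lemma small_F₂ (hγ : IsAnalyticBoundary γ) (hp : 1 / 2 < p) :
    Small p (p + 2) fun n φ => opF₂ κ γ (discOps κ γ n) φ - opF₂ κ γ (contOps κ γ) φ := by
  have hV : BddOp (fun φ => opS₀ φ + mulOp (e₁ κ γ) (opS₂ φ)) p 1 :=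
    (tameOp_S₀.ordOp.bddOp p).add ((bddOp_E₁S₂ hγ hp).mono (by norm_num))
  have h1 := (small_interp_between ordOp_S₂ hV (by norm_num) (by norm_num) hp).mul
    (rapid_e₂ κ hγ) (by linarith)
  have h2 := small_interp_between tameOp_S₀.ordOp (bddOp_E₂S₂ (κ := κ) hγ hp) (by norm_num)
    (by norm_num) hp
  have h3 := (small_interp_between ordOp_S₂ (bddOp_E₂S₂ (κ := κ) hγ hp) (by norm_num)
    (by norm_num) hp).mul (rapid_e₁ κ hγ) (by linarith)
  refine ((h1.sub h2).sub h3).congr fun n hn φ hφ => ?_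
  funext t
  simp only [opF₂, discOps, contOps, mulOp_eq, Function.comp, hφ.interp_eq hn, Pi.add_apply,
    Pi.sub_apply, Pi.mul_apply]
  ring

lemma small_F₃ (hγ : IsAnalyticBoundary γ) (hp : 1 / 2 < p) :
    Small p (p + 2) fun n φ => opF₃ κ γ (discOps κ γ n) φ - opF₃ κ γ (contOps κ γ) φ := by
  have h1 := small_A (κ := κ) hγ hp (bddOp_E₂S₂ (κ := κ) hγ hp) le_rfl
  have h2 := (small_interp_between ordOp_S₂ (bddOp_A (κ := κ) hγ hp) (by norm_num)
    (by norm_num) hp).mul (rapid_e₂ κ hγ) (by linarith)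
  refine (h1.sub h2).congr fun n hn φ hφ => ?_
  have hS : (discOps κ γ n).S₂ φ = opS₂ φ := by
    simp only [discOps, Function.comp, hφ.interp_eq hn]
  have hS' : (contOps κ γ).S₂ = opS₂ := rfl
  have hS'' : (discOps κ γ n).S₂ = opS₂ ∘ interp n := rfl
  simp only [opF₃, opA_disc hn hφ, hS, hS']
  funext t
  simp only [hS'', mulOp_eq, Function.comp, Pi.sub_apply, Pi.mul_apply]
  ring

/-- The products S₁S₀ and S₂S₀ carry no error, since S₀ maps X_n into itself and no multiplication
intervenes. -/
lemma small_F₄ (hγ : IsAnalyticBoundary γ) (hp : 1 / 2 < p) :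
    Small p (p + 2) fun n φ => opF₄ κ γ (discOps κ γ n) φ - opF₄ κ γ (contOps κ γ) φ := by
  have h1 := (small_interp_between ordOp_S₂ (bddOp_E₂S₂ (κ := κ) hγ hp) (by norm_num)
    (by norm_num) hp).mul (rapid_e₂ κ hγ) (by linarith)
  have h2 := small_A (κ := κ) hγ hp (bddOp_E₁S₂ (κ := κ) hγ hp) le_rfl
  refine (h1.add h2).congr fun n hn φ hφ => ?_
  have hS : (discOps κ γ n).S₂ φ = opS₂ φ := by
    simp only [discOps, Function.comp, hφ.interp_eq hn]
  have hS0 : (discOps κ γ n).S₀ φ = opS₀ φ := by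
    simp only [discOps, Function.comp, hφ.interp_eq hn]
  have hS1' : (discOps κ γ n).S₁ (opS₀ φ) = opS₁ (opS₀ φ) := by
    simp only [discOps, Function.comp, (tameOp_S₀.inX hφ).interp_eq hn]
  have hS2' : (discOps κ γ n).S₂ (opS₀ φ) = opS₂ (opS₀ φ) := by
    simp only [discOps, Function.comp, (tameOp_S₀.inX hφ).interp_eq hn]
  have c0 : (contOps κ γ).S₀ = opS₀ := rfl
  have c1 : (contOps κ γ).S₁ = opS₁ := rfl
  have c2 : (contOps κ γ).S₂ = opS₂ := rfl
  have hS'' : (discOps κ γ n).S₂ = opS₂ ∘ interp n := rfl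
  simp only [opF₄, hS, hS0, hS1', hS2', c0, c1, c2]
  funext t
  simp only [hS'', mulOp_eq, Function.comp, Pi.add_apply, Pi.sub_apply, Pi.mul_apply, Pi.smul_apply]
  ring

/-! ### Entries with quadrature operators -/

lemma St₀_disc (n : ℕ) (φ : ℝ → ℂ) : (discOps κ γ n).St₀ φ = logOp (interp n φ) :=
  quadOp_kerSt₀ n φ

lemma St₀_cont (φ : ℝ → ℂ) : (contOps κ γ).St₀ φ = logOp φ := intOp_kerSt₀ φ

lemma M₀_disc (n : ℕ) (φ : ℝ → ℂ) :
    (discOps κ γ n).M₀ φ = Complex.I • meanOp (interp n φ) := quadOp_kerM₀ n φ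

lemma M₀_cont (φ : ℝ → ℂ) : (contOps κ γ).M₀ φ = Complex.I • meanOp φ := intOp_kerM₀ φ

lemma small_B₁_post (hp : 1 / 2 < p) {f : ℝ → ℝ} (hf : Rapid fun t => (f t : ℂ)) :
    Small p (p + 2) fun n φ =>
      logOp (interp n (mulOp f (quadOp n kerB₁log kerB₁smooth φ))) -
        logOp (mulOp f (intOp kerB₁log kerB₁smooth φ)) :=
  (small_B₁ (by linarith)).post_mul (ordOp_B₁.bddOp p) tameOp_logOp hf hp

lemma small_B₂_post (hp : 1 / 2 < p) {f : ℝ → ℝ} (hf : Rapid fun t => (f t : ℂ)) :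
    Small p (p + 2) fun n φ =>
      logOp (interp n (mulOp f (quadOp n kerB₂log kerB₂smooth φ))) -
        logOp (mulOp f (intOp kerB₂log kerB₂smooth φ)) :=
  (small_B₂ (by linarith)).post_mul (ordOp_B₂.bddOp p) tameOp_logOp hf hp

lemma small_TameOp_ES₂ {T : Op} (hT : TameOp T) (hp : 1 / 2 < p) {f : ℝ → ℝ}
    (hf : Rapid fun t => (f t : ℂ)) :
    Small p (p + 2) fun n φ => T (interp n (mulOp f (opS₂ φ))) - T (mulOp f (opS₂ φ)) :=
  small_interp_between hT.ordOp ((ordOp_S₂.bddOp p).mul hf (by linarith)) (by norm_num)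
    (by norm_num) hp

/-- The commutator quadrature is estimated in order p + 1 because S̃₀φ is one order smoother. B₁ and
B₂ are corrected by the outer S̃₀, and M₀S₀ is exact on X_n. -/
lemma small_J₁ (hγ : IsAnalyticBoundary γ) (hp : 1 / 2 < p) :
    Small p (p + 2) fun n φ => opJ₁ κ γ (discOps κ γ n) φ - opJ₁ κ γ (contOps κ γ) φ := by
  have h1 := ((small_comm (rapid_e₁ κ hγ) (q := p + 1) (by linarith)).comp tameOp_logOp).smul
    (1 / 2)
  rw [show p + 1 + 1 = p + 2 by ring] at h1
  have h2 := small_TameOp_ES₂ tameOp_logOp hp (rapid_e₇ κ hγ)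
  have h3 := (small_B₁_post hp (rapid_e₃ κ hγ)).smul 4
  have h4 := small_B₂_post hp (rapid_e₁ κ hγ)
  have h5 := small_TameOp_ES₂ tameOp_M₀ hp (rapid_e₁ κ hγ)
  refine ((((h1.add h2).add h3).add h4).add h5).congr fun n hn φ hφ => ?_
  funext t
  simp only [opJ₁, St₀_disc, St₀_cont, M₀_disc, M₀_cont]
  simp only [discOps, contOps, Function.comp, hφ.interp_eq hn,
    (tameOp_S₀.inX hφ).interp_eq hn, Pi.add_apply, Pi.sub_apply, Pi.smul_apply, smul_eq_mul]
  ring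

/-- Both quadrature operators act after a multiplier that keeps X_n and gains one order, so their
error is needed only in order p + 1. The last two products are exact. -/
lemma small_J₂ (hγ : IsAnalyticBoundary γ) (hp : 1 / 2 < p) :
    Small p (p + 2) fun n φ => opJ₂ κ γ (discOps κ γ n) φ - opJ₂ κ γ (contOps κ γ) φ := by
  have h1 := ((small_commM (rapid_e₁ κ hγ) (q := p + 1) (by linarith)).comp tameOp_S₀).smul
    (1 / 2)
  have h2 := ((small_B₂ (q := p + 1) (by linarith)).comp tameOp_logOp).mul (rapid_e₁ κ hγ)
    (by linarith)
  rw [show p + 1 + 1 = p + 2 by ring] at h1 h2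
  refine (h1.add h2).congr fun n hn φ hφ => ?_
  funext t
  simp only [opJ₂, St₀_disc, St₀_cont, M₀_disc, M₀_cont]
  simp only [discOps, contOps, Function.comp, hφ.interp_eq hn, mulOp_eq,
    (tameOp_S₀.inX hφ).interp_eq hn, (tameOp_M₀.inX hφ).interp_eq hn, Pi.add_apply,
    Pi.sub_apply, Pi.mul_apply, Pi.smul_apply, smul_eq_mul]
  ring

lemma small_J₃ (hγ : IsAnalyticBoundary γ) (hp : 1 / 2 < p) :
    Small p (p + 2) fun n φ => opJ₃ κ γ (discOps κ γ n) φ - opJ₃ κ γ (contOps κ γ) φ := by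
  have h1 := ((small_comm (rapid_e₂ κ hγ) (q := p + 1) (by linarith)).comp tameOp_logOp).smul
    (1 / 2)
  have h5 := ((small_B₂ (q := p + 1) (by linarith)).comp tameOp_logOp).mul (rapid_e₂ κ hγ)
    (by linarith)
  rw [show p + 1 + 1 = p + 2 by ring] at h1 h5
  have h2 := small_TameOp_ES₂ tameOp_logOp hp (rapid_e₈ κ hγ)
  have h3 := (small_B₁_post hp (rapid_e₉ κ hγ)).smul 2
  have h4 := small_B₂_post hp (rapid_e₂ κ hγ)
  have h6 := small_TameOp_ES₂ tameOp_M₀ hp (rapid_e₂ κ hγ)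
  refine (((((h1.add h2).add h3).add h4).sub h5).add h6).congr fun n hn φ hφ => ?_
  funext t
  simp only [opJ₃, St₀_disc, St₀_cont, M₀_disc, M₀_cont]
  simp only [discOps, contOps, Function.comp, hφ.interp_eq hn, mulOp_eq,
    (tameOp_M₀.inX hφ).interp_eq hn, Pi.add_apply,
    Pi.sub_apply, Pi.mul_apply, Pi.smul_apply, smul_eq_mul]
  ring

end entries

/-- As |γ'| never vanishes, the inverse of E₁ is multiplication by a smooth function, and
`Small.mul` absorbs it into the constant. -/
lemma small_row {κ : ℝ} {γ : ℝ → Plane} {p : ℝ} (hκ : 0 < κ) (hγ : IsAnalyticBoundary γ)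
    (hp : 1 / 2 < p) {X Y : ℕ → Op} (hX : Small p (p + 2) X) (hY : Small p (p + 2) Y) :
    ∃ C : ℝ≥0∞, C ≠ ⊤ ∧ ∀ n : ℕ, 1 ≤ n → ∀ φ ψ, InX n φ → InX n ψ →
      sobolevNorm (p + 2) (interp n (E₁inv κ γ (X n φ + Y n ψ))) ≤
        C * (n : ℝ≥0∞)⁻¹ * (sobolevNorm p φ + sobolevNorm p ψ) := by
  obtain ⟨C, hC, hX⟩ := hX.mul (rapid_e₁_inv hκ hγ) (by linarith)
  obtain ⟨D, hD, hY⟩ := hY.mul (rapid_e₁_inv hκ hγ) (by linarith)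
  refine ⟨C + D, ENNReal.add_ne_top.mpr ⟨hC, hD⟩, fun n hn φ ψ hφ hψ => ?_⟩
  have e : E₁inv κ γ (X n φ + Y n ψ) = (fun t => (((e₁ κ γ t)⁻¹ : ℝ) : ℂ)) * X n φ +
      (fun t => (((e₁ κ γ t)⁻¹ : ℝ) : ℂ)) * Y n ψ := mul_add _ _ _
  rw [e, interp_add]
  refine (sobolevNorm_add_le _ (interp_wiener hn _).1 (interp_wiener hn _).1).trans ?_
  calc _ ≤ C * (n : ℝ≥0∞)⁻¹ * sobolevNorm p φ + D * (n : ℝ≥0∞)⁻¹ * sobolevNorm p ψ :=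
        add_le_add (hX n hn φ hφ).2 (hY n hn ψ hψ).2
    _ ≤ (C + D) * (n : ℝ≥0∞)⁻¹ * sobolevNorm p φ + (C + D) * (n : ℝ≥0∞)⁻¹ * sobolevNorm p ψ := by
        gcongr
        · exact le_self_add
        · exact le_add_self
    _ = _ := by ring

theorem exists_interp₂_error_le (κ : ℝ) (hκ : 0 < κ) (γ : ℝ → Plane)
    (hγ : IsAnalyticBoundary γ) (p : ℝ) (hp : 1 / 2 < p) :
    ∃ C : ℝ, 0 < C ∧ ∀ n : ℕ, 1 ≤ n → ∀ ψ : (ℝ → ℂ) × (ℝ → ℂ),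
      ψ.1 ∈ trigPoly n → ψ.2 ∈ trigPoly n →
      sobolevNorm₂ (p + 2)
          (interp₂ n
            (calEnInv κ γ n (opJn κ γ n ψ) -
              calEinv κ γ (opJ κ γ ψ))) ≤
        ENNReal.ofReal (C / n) * sobolevNorm₂ p ψ := by
  obtain ⟨C, hC, h1⟩ := small_row hκ hγ hp
    ((small_F₁ (κ := κ) hγ hp).add (small_J₂ (κ := κ) hγ hp)) (small_F₂ (κ := κ) hγ hp)
  obtain ⟨D, hD, h2⟩ := small_row hκ hγ hp
    ((small_F₃ (κ := κ) hγ hp).add (small_J₃ (κ := κ) hγ hp))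
    ((small_F₄ (κ := κ) hγ hp).add (small_J₁ (κ := κ) hγ hp))
  have hCD : C + D ≠ ⊤ := ENNReal.add_ne_top.mpr ⟨hC, hD⟩
  -- The added 1 serves only to make the constant positive.
  refine ⟨(C + D).toReal + 1, by positivity, fun n hn ψ hψ₁ hψ₂ => ?_⟩
  have hX₁ := InX.of_trigPoly hψ₁
  have hX₂ := InX.of_trigPoly hψ₂
  have hn0 : (0 : ℝ) < n := by exact_mod_cast hn
  have hconst : (C + D) * (n : ENNReal)⁻¹ ≤ ENNReal.ofReal (((C + D).toReal + 1) / n) := by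
    rw [div_eq_mul_inv, ENNReal.ofReal_mul (by positivity), ENNReal.ofReal_inv_of_pos hn0,
      ENNReal.ofReal_natCast]
    gcongr
    rw [← ENNReal.ofReal_toReal hCD]
    apply ENNReal.ofReal_le_ofReal
    rw [ENNReal.toReal_ofReal (by positivity)]
    linarith
  refine le_trans ?_ (mul_le_mul' hconst le_rfl)
  rw [add_mul, add_mul]
  refine add_le_add ((le_of_eq ?_).trans (h1 n hn _ _ hX₁ hX₂))
    ((le_of_eq ?_).trans (h2 n hn _ _ hX₁ hX₂))
  · refine congrArg (sobolevNorm (p + 2)) (congrArg (interp n) ?_)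
    funext t
    simp only [calEnInv, calEinv, opJn, opJ, calJ, E₁inv, mulOp, Prod.fst_sub, Pi.sub_apply,
      Pi.add_apply]
    ring
  · refine congrArg (sobolevNorm (p + 2)) (congrArg (interp n) ?_)
    funext t
    simp only [calEnInv, calEinv, opJn, opJ, calJ, E₁inv, mulOp, Prod.snd_sub, Pi.sub_apply,
      Pi.add_apply]
    ring

end BiharmonicCavity

end

theorem theorem4p4 (κ : ℝ) (hκ : 0 < κ) (γ : ℝ → BiharmonicCavity.Plane)
    (hγ : BiharmonicCavity.IsAnalyticBoundary γ) (p : ℝ) (hp : 1 / 2 < p) :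
    ∃ C : ℝ, 0 < C ∧ ∀ n : ℕ, 1 ≤ n → ∀ ψ : (ℝ → ℂ) × (ℝ → ℂ),
      ψ.1 ∈ BiharmonicCavity.trigPoly n → ψ.2 ∈ BiharmonicCavity.trigPoly n →
      BiharmonicCavity.sobolevNorm₂ (p + 2)
          (BiharmonicCavity.interp₂ n
            (BiharmonicCavity.calEnInv κ γ n (BiharmonicCavity.opJn κ γ n ψ) -
              BiharmonicCavity.calEinv κ γ (BiharmonicCavity.opJ κ γ ψ))) ≤
        ENNReal.ofReal (C / n) * BiharmonicCavity.sobolevNorm₂ p ψ :=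
  BiharmonicCavity.exists_interp₂_error_le κ hκ γ hγ p hp
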